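/- **Notation.** An integral whose path carries an arrow, such as $\int_{p\swarrow q}$ or $\int_{p\searrow q}$ with real $p<q$, is taken along a straight line of slope $1$ (for $\swarrow$) or $-1$ (for $\searrow$), from $\infty$ to $\infty$ in the direction of the arrow, crossing the real axis at a point strictly between $p$ and $q$. Powers $u^{w}$ are principal values. The parabolic cylinder function is $$U(a,z)=\frac{\Gamma(\frac12-a)}{2\pi i}\,e^{-z^2/4}\int_C e^{-w^2/2+zw}\,w^{a-1/2}\,dw ,$$ where $C$ comes from $\infty$ in the third quadrant parallel to the real axis, circles the origin once in the positive direction, and returns to $\infty$ in the second quadrant parallel to the real axis; for $a=\frac12,\frac32,\frac52,\dots$ the value $U(a,z)$ is the limit of the right-hand side as $a$ is approached. For $s\in\mathbb C$, $s\notin\{0,-2,-4,\dots\}$, put $$\mathcal F(s)=\pi^{-s/2}\,\Gamma\!\left(\tfrac s2\right)\int_{0\swarrow1}\frac{e^{i\pi u^2}u^{-s}}{e^{i\pi u}-e^{-i\pi u}}\,du .$$ **Theorem.** For every $s\in\mathbb C$ all the integrals below converge absolutely, and the following holds, whatever the crossing points of the paths. 1. For $s\notin\{0,-2,-4,\dots\}$,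 $$\mathcal F(s)=2^{s/2}\,\Gamma\!\left(\tfrac s2\right)e^{-i\pi(1-s)/4}\int_{-\frac12\searrow\frac12}\frac{e^{-i\pi u^2/2+i\pi u}}{2i\cos\pi u}\,U\!\left(s-\tfrac12,\sqrt{2\pi}\,e^{i\pi/4}u\right)du .$$ 2. For $s\notin\{1,3,5,\dots\}$, $$\overline{\mathcal F(1-\overline s)}=\pi^{-(1-s)/2}\,\Gamma\!\left(\tfrac{1-s}2\right)\int_{0\searrow1}\frac{e^{-i\pi u^2}u^{s-1}}{e^{i\pi u}-e^{-i\pi u}}\,du$$ $$=2^{(1-s)/2}\,\Gamma\!\left(\tfrac{1-s}2\right)e^{i\pi s/4}\int_{-\frac12\swarrow\frac12}\frac{e^{i\pi u^2/2-i\pi u}}{2i\cos\pi u}\,U\!\left(\tfrac12-s,\sqrt{2\pi}\,e^{-i\pi/4}u\right)du .$$ 3. With the common gamma factor cancelled, the equality of the $\swarrow$-integral and the $\searrow$-integral expressions for $\mathcal F(s)$ in 1, and the equality of the two integral expressions in 2, hold for every $s\in\mathbb C$. 4. For $s\notin\{0,-2,-4,\dots\}\cup\{1,3,5,\dots\}$,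 $$\pi^{-s/2}\,\Gamma\!\left(\tfrac s2\right)\zeta(s)=\mathcal F(s)+\overline{\mathcal F(1-\overline s)},$$ and therefore $$\pi^{-s/2}\,\Gamma\!\left(\tfrac s2\right)\zeta(s)=2^{s/2}\,\Gamma\!\left(\tfrac s2\right)e^{-i\pi(1-s)/4}\int_{-\frac12\searrow\frac12}\frac{e^{-i\pi u^2/2+i\pi u}}{2i\cos\pi u}\,U\!\left(s-\tfrac12,\sqrt{2\pi}\,e^{i\pi/4}u\right)du$$ $$\qquad+\,2^{(1-s)/2}\,\Gamma\!\left(\tfrac{1-s}2\right)e^{i\pi s/4}\int_{-\frac12\swarrow\frac12}\frac{e^{i\pi u^2/2-i\pi u}}{2i\cos\pi u}\,U\!\left(\tfrac12-s,\sqrt{2\pi}\,e^{-i\pi/4}u\right)du .$$ -/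

import Mathlib

open Complex MeasureTheory Filter Topology

namespace ParabolicRS

/-- The contour integral `∫_C e^{-w²/2 + z w} w^{a - 1/2} dw` (principal branch of the power). The path
`C` comes from `-∞ - i` along `Im w = -1` to `1 - i`, goes up to `1 + i`, and returns along `Im w = 1`
to `-∞ + i`; it circles the origin once in the positive direction and avoids `(-∞, 0]`. -/
noncomputable def hankelIntegral (a z : ℂ) : ℂ :=
  let f : ℂ → ℂ := fun w => exp (-w ^ 2 / 2 + z * w) * w ^ (a - 1 / 2)
  (∫ t in Set.Iic (1 : ℝ), f (t - I)) + (∫ t in (-1 : ℝ)..1, f (1 + t * I) * I)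
    - ∫ t in Set.Iic (1 : ℝ), f (t + I)

/-- `Γ(1/2 - a) / (2 π i) · e^{-z²/4} · ∫_C e^{-w²/2 + z w} w^{a - 1/2} dw`; this is meaningful unless
`a` is one of the poles `1/2, 3/2, 5/2, …` of the gamma factor. -/
noncomputable def parabolicUContour (a z : ℂ) : ℂ :=
  Gamma (1 / 2 - a) / (2 * Real.pi * I) * exp (-z ^ 2 / 4) * hankelIntegral a z

open Classical in
/-- The parabolic cylinder function `U(a, z)`: the contour formula, and at `a = 1/2, 3/2, 5/2, …`,
where the gamma factor has a pole that the contour integral cancels, its limit in `a` (so that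
`U` is entire in both variables). -/
noncomputable def parabolicU (a z : ℂ) : ℂ :=
  if ∃ n : ℕ, a = n + 1 / 2 then limUnder (𝓝[≠] a) (fun b => parabolicUContour b z)
  else parabolicUContour a z

/-- The direction `↙` of slope `1`, namely `-e^{iπ/4} = -(1 + i)/√2`. -/
noncomputable def southWest : ℂ := -exp (I * Real.pi / 4)

/-- The direction `↘` of slope `-1`, namely `e^{-iπ/4} = (1 - i)/√2`. -/
noncomputable def southEast : ℂ := exp (-(I * Real.pi / 4))

/-- Integral of `f` along the straight line through the real point `c` with direction `d`. -/
noncomputable def lineIntegral (c : ℝ) (d : ℂ) (f : ℂ → ℂ) : ℂ :=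
  ∫ t : ℝ, f (c + t * d) * d

/-- Absolute convergence of `lineIntegral c d f`. -/
def LineIntegrable (c : ℝ) (d : ℂ) (f : ℂ → ℂ) : Prop :=
  Integrable (fun t : ℝ => f (c + t * d) * d)

/-- `e^{iπu²} u^{-s} / (e^{iπu} - e^{-iπu})`, principal branch of the power. -/
noncomputable def rsIntegrand (s u : ℂ) : ℂ :=
  exp (I * Real.pi * u ^ 2) * u ^ (-s) / (exp (I * Real.pi * u) - exp (-(I * Real.pi * u)))

/-- `e^{-iπu²} u^{s-1} / (e^{iπu} - e^{-iπu})`, principal branch of the power. -/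
noncomputable def rsIntegrandDual (s u : ℂ) : ℂ :=
  exp (-(I * Real.pi * u ^ 2)) * u ^ (s - 1) /
    (exp (I * Real.pi * u) - exp (-(I * Real.pi * u)))

/-- `e^{-iπu²/2 + iπu} / (2i cos πu) · U(s - 1/2, √(2π) e^{iπ/4} u)`. -/
noncomputable def cylinderIntegrand (s u : ℂ) : ℂ :=
  exp (-(I * Real.pi * u ^ 2 / 2) + I * Real.pi * u) / (2 * I * cos (Real.pi * u)) *
    parabolicU (s - 1 / 2) ((Real.sqrt (2 * Real.pi) : ℂ) * exp (I * Real.pi / 4) * u)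

/-- `e^{iπu²/2 - iπu} / (2i cos πu) · U(1/2 - s, √(2π) e^{-iπ/4} u)`. -/
noncomputable def cylinderIntegrandDual (s u : ℂ) : ℂ :=
  exp (I * Real.pi * u ^ 2 / 2 - I * Real.pi * u) / (2 * I * cos (Real.pi * u)) *
    parabolicU (1 / 2 - s) ((Real.sqrt (2 * Real.pi) : ℂ) * exp (-(I * Real.pi / 4)) * u)

/-- `𝓕(s) = π^{-s/2} Γ(s/2) ∫_{0↙1} e^{iπu²} u^{-s} / (e^{iπu} - e^{-iπu}) du`, the path crossing
the real axis at `c`. -/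
noncomputable def rsF (c : ℝ) (s : ℂ) : ℂ :=
  (Real.pi : ℂ) ^ (-s / 2) * Gamma (s / 2) * lineIntegral c southWest (rsIntegrand s)

end ParabolicRS

namespace ParabolicRS

/-! ### Holomorphic dependence on a parameter -/

/-! Both integrals for 𝓕(s) are Mellin transforms of the same function, Mordell's integral of
e^{iπu² + 2πixu} / (e^{iπu} - e^{-iπu}) along a line of slope 1. This integral is elementary
(`diag_mul_mordell`): changing x by 1 and moving the line by 1 give two functional equations
(`mordell_sub`, `mordell_shift`), and these determine it.

On the Riemann–Siegel side, Γ(s) u^{-s} is a rotated Laplace integral in τ, so Γ(s) times the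
integral is, up to a constant, the Mellin transform of Mordell's integral at x = `laplacePoint τ`
(`integral_rsIntegrand_mul_Gamma`). On the cylinder side, collapsing the contour onto the negative
axis gives, for Re s > 0, U(s - 1/2, z) = e^{-z²/4} Γ(s)⁻¹ ∫ t^{s-1} e^{-t²/2 - zt} dt over t > 0
(`parabolicU_eq_laplaceGauss`). After Fubini, the inner integral along ↘ is a conjugated Mordell
integral at another point; by the closed form, its product with e^{-t²/2} is a constant times
Mordell's integral at `laplacePoint (√(2π) t)` (`exp_mul_integral_cylKernel`). This proves
`cylinder_identity` for Re s > 0. Both sides are holomorphic in Re s < 1, so it extends to all s.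
The dual identity follows by complex conjugation and s ↦ 1 - s̄.

For the zeta function, the closed form at `laplacePoint τ` splits into a geometric series, whose
Mellin transform contains Γ(s) ζ(s), and a Gaussian term (`neg_diag_mul_mordell`). For Re s > 2 the
path of the dual integral may be moved onto the line through 0. There it becomes a multiple of the
half-line integral produced by the Gaussian term. The relation between `Gammaℝ s` and `Gammaℝ (1 -
s)` matches the constants, and the identity theorem on ℂ ∖ {1} removes the restriction on s
(`riemannSiegel`). -/

theorem differentiableOn_integral_of_locally_dominated {α : Type*} [MeasurableSpace α]
    {μ : Measure α} {F : ℂ → α → ℂ} {U : Set ℂ} (hU : IsOpen U)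
    (hmeas : ∀ s ∈ U, AEStronglyMeasurable (F s) μ)
    (hdiff : ∀ᵐ x ∂μ, DifferentiableOn ℂ (fun s => F s x) U)
    (hdom : ∀ s ∈ U, ∃ ε > 0, ∃ B : α → ℝ, Integrable B μ ∧
      ∀ᵐ x ∂μ, ∀ s' ∈ Metric.ball s ε, s' ∈ U → ‖F s' x‖ ≤ B x) :
    DifferentiableOn ℂ (fun s => ∫ x, F s x ∂μ) U := by
  intro s hs
  obtain ⟨ε₀, hε₀, B, hB, hle⟩ := hdom s hs
  obtain ⟨ε₁, hε₁, hsub⟩ := Metric.isOpen_iff.1 hU s hs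
  -- With a quarter of the radius, closed ε-balls around points of the ε-ball of s remain in U and
  -- in the domain of the majorant.
  set ε := min ε₀ ε₁ / 4 with hε
  have hεpos : 0 < ε := by positivity
  have hε0 : 4 * ε ≤ ε₀ := by rw [hε]; linarith [min_le_left ε₀ ε₁]
  have hε1 : 4 * ε ≤ ε₁ := by rw [hε]; linarith [min_le_right ε₀ ε₁]
  -- The derivative is measurable in x as an almost everywhere limit of difference quotients with
  -- steps ε / (n + 1).
  have hF's : AEStronglyMeasurable (fun x => deriv (fun s => F s x) s) μ := by
    refine aestronglyMeasurable_of_tendsto_ae (u := atTop) (ι := ℕ)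
      (f := fun n x => ((ε / (n + 1 : ℝ) : ℝ) : ℂ)⁻¹ * (F (s + (ε / (n + 1 : ℝ) : ℝ)) x - F s x))
      ?_ ?_
    · intro n
      refine AEStronglyMeasurable.const_mul (AEStronglyMeasurable.sub (hmeas _ (hsub ?_))
        (hmeas _ hs)) _
      rw [Metric.mem_ball, dist_eq_norm, add_sub_cancel_left, Complex.norm_real,
        Real.norm_of_nonneg (by positivity)]
      have : ε / (n + 1 : ℝ) ≤ ε := div_le_self hεpos.le (by linarith [n.cast_nonneg (α := ℝ)])
      linarith
    · filter_upwards [hdiff] with x hx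
      have h1 := (hx.differentiableAt (hU.mem_nhds hs)).hasDerivAt.tendsto_slope_zero
      have h2 : Tendsto (fun n : ℕ => (((ε / (n + 1 : ℝ) : ℝ)) : ℂ)) atTop (𝓝[≠] 0) := by
        refine tendsto_nhdsWithin_iff.2 ⟨?_, Eventually.of_forall fun n => ?_⟩
        · have : Tendsto (fun n : ℕ => ε / (n + 1 : ℝ)) atTop (𝓝 0) := by
            simpa [div_eq_mul_inv] using tendsto_one_div_add_atTop_nhds_zero_nat.const_mul ε
          exact (Complex.continuous_ofReal.tendsto' 0 0 Complex.ofReal_zero).comp this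
        · simp only [Set.mem_compl_iff, Set.mem_singleton_iff, Complex.ofReal_eq_zero]
          positivity
      exact h1.comp h2
  have hmem : ∀ s' ∈ Metric.ball s ε, ∀ z ∈ Metric.closedBall s' ε, z ∈ U ∧ z ∈ Metric.ball s ε₀ := by
    intro s' hs' z hz
    have : dist z s < 4 * ε := by
      have := dist_triangle z s' s
      rw [Metric.mem_closedBall] at hz
      rw [Metric.mem_ball] at hs'
      linarith
    exact ⟨hsub (by rw [Metric.mem_ball]; linarith), by rw [Metric.mem_ball]; linarith⟩
  refine (hasDerivAt_integral_of_dominated_loc_of_deriv_le (Metric.ball_mem_nhds s hεpos)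
    (bound := fun x => B x / ε) (F' := fun s x => deriv (fun s => F s x) s) ?_ ?_ hF's ?_ ?_
    ?_).2.differentiableAt.differentiableWithinAt
  · filter_upwards [hU.mem_nhds hs] with s' hs' using hmeas s' hs'
  · refine hB.mono' (hmeas s hs) ?_
    filter_upwards [hle] with x hx using hx s (Metric.mem_ball_self hε₀) hs
  -- Cauchy's estimate on a circle of radius ε turns the majorant B of F into the majorant B / ε of
  -- its derivative, so no separate bound on the derivative is needed.
  · filter_upwards [hle, hdiff] with x hx hd s' hs'
    refine Complex.norm_deriv_le_of_forall_mem_sphere_norm_le hεpos ?_ ?_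
    · refine DifferentiableOn.diffContOnCl (hd.mono ?_)
      rw [closure_ball _ hεpos.ne']
      exact fun z hz => (hmem s' hs' z hz).1
    · intro z hz
      have := hmem s' hs' z (Metric.sphere_subset_closedBall hz)
      exact hx z this.2 this.1
  · exact hB.div_const ε
  · filter_upwards [hdiff] with x hd s' hs'
    exact (hd.differentiableAt (hU.mem_nhds
      (hmem s' hs' s' (Metric.mem_closedBall_self hεpos.le)).1)).hasDerivAt

/-! ### Slanted lines -/

/-- The unit vector `e^{iπ/4}` of slope `1`. -/
noncomputable def diag : ℂ := exp (I * Real.pi / 4)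

theorem diag_eq : diag = ((Real.sqrt 2 / 2 : ℝ) : ℂ) + ((Real.sqrt 2 / 2 : ℝ) : ℂ) * I := by
  rw [diag, show I * (Real.pi : ℂ) / 4 = ((Real.pi / 4 : ℝ) : ℂ) * I by push_cast; ring,
    Complex.exp_mul_I, ← Complex.ofReal_cos, ← Complex.ofReal_sin, Real.cos_pi_div_four,
    Real.sin_pi_div_four]

theorem diag_re : diag.re = Real.sqrt 2 / 2 := by rw [diag_eq]; simp
theorem diag_im : diag.im = Real.sqrt 2 / 2 := by rw [diag_eq]; simp

theorem diag_sq : diag ^ 2 = I := by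
  rw [diag, ← Complex.exp_nat_mul, show ((2 : ℕ) : ℂ) * (I * Real.pi / 4) = Real.pi / 2 * I by
    push_cast; ring, Complex.exp_pi_div_two_mul_I]

theorem norm_diag : ‖diag‖ = 1 := by
  rw [diag, show I * (Real.pi : ℂ) / 4 = ((Real.pi / 4 : ℝ) : ℂ) * I by push_cast; ring,
    Complex.norm_exp_ofReal_mul_I]

theorem diag_ne_zero : diag ≠ 0 := Complex.exp_ne_zero _

theorem conj_diag : (starRingEnd ℂ) diag = exp (-(I * Real.pi / 4)) := by
  rw [diag, ← Complex.exp_conj]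
  congr 1
  simp only [map_div₀, map_mul, Complex.conj_I, Complex.conj_ofReal, map_ofNat]
  ring

theorem southWest_eq : southWest = -diag := rfl

theorem southEast_eq : southEast = (starRingEnd ℂ) diag := conj_diag.symm

/-- The abscissa at which the line of slope `1` through `u` meets the real axis. -/
def crossing (u : ℂ) : ℝ := u.re - u.im

theorem continuous_crossing : Continuous crossing :=
  Complex.continuous_re.sub Complex.continuous_im

theorem crossing_ofReal (c : ℝ) : crossing c = c := by simp [crossing]

theorem crossing_add_mul_diag (a : ℂ) (t : ℝ) : crossing (a + t * diag) = crossing a := by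
  simp [crossing, diag_re, diag_im]

theorem isOpen_crossing_strip (α β : ℝ) : IsOpen {u : ℂ | α < crossing u ∧ crossing u < β} :=
  (isOpen_lt continuous_const continuous_crossing).inter
    (isOpen_lt continuous_crossing continuous_const)

theorem isPreconnected_crossing_strip (α β : ℝ) :
    IsPreconnected {u : ℂ | α < crossing u ∧ crossing u < β} := by
  have hlin : IsLinearMap ℝ crossing :=
    ⟨fun x y => by simp [crossing]; ring, fun c x => by simp [crossing]; ring⟩
  exact ((convex_halfSpace_gt hlin α).inter (convex_halfSpace_lt hlin β)).isPreconnected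

/-- An integrand holomorphic in a slanted strip, with Gaussian decay along the lines that is locally
uniform, has the same integral along all these lines. -/
theorem integral_line_eq_of_differentiableOn {α β : ℝ} {g : ℂ → ℂ}
    (hg : DifferentiableOn ℂ g {u | α < crossing u ∧ crossing u < β})
    (hdecay : ∀ a₀ : ℂ, α < crossing a₀ → crossing a₀ < β → ∃ ε > 0, ∃ T C : ℝ,
      ∀ a ∈ Metric.ball a₀ ε, ∀ t : ℝ, T ≤ |t| → ‖g (a + t * diag)‖ ≤ C * Real.exp (-t ^ 2))
    {a b : ℂ} (ha : α < crossing a ∧ crossing a < β) (hb : α < crossing b ∧ crossing b < β) :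
    ∫ t : ℝ, g (a + t * diag) = ∫ t : ℝ, g (b + t * diag) := by
  set S := {u : ℂ | α < crossing u ∧ crossing u < β} with hS
  have hSo : IsOpen S := isOpen_crossing_strip α β
  have hmaps : ∀ (t : ℝ), Set.MapsTo (fun a : ℂ => a + t * diag) S S := fun t a ha => by
    simpa [hS, crossing_add_mul_diag] using ha
  -- The line integral is treated as a holomorphic function of its base point; this replaces an
  -- explicit contour shift.
  have hD : DifferentiableOn ℂ (fun a => ∫ t : ℝ, g (a + t * diag)) S := by
    refine differentiableOn_integral_of_locally_dominated hSo ?_ ?_ ?_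
    · intro a ha
      refine Continuous.aestronglyMeasurable (hg.continuousOn.comp_continuous (by fun_prop) ?_)
      exact fun t => hmaps t ha
    · exact Eventually.of_forall fun t => hg.comp (by fun_prop) (hmaps t)
    · intro a ha
      obtain ⟨ε, hε, T, C, h⟩ := hdecay a ha.1 ha.2
      obtain ⟨ε₁, hε₁, hsub⟩ := Metric.isOpen_iff.1 hSo a ha
      have hcomp : IsCompact (Metric.closedBall a (ε₁ / 2) ×ˢ Set.Icc (-|T|) |T|) :=
        (isCompact_closedBall a _).prod isCompact_Icc
      obtain ⟨M, hM⟩ := hcomp.exists_bound_of_continuousOn (f := fun p : ℂ × ℝ => g (p.1 + p.2 * diag))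
        (hg.continuousOn.comp (by fun_prop) (by
          rintro ⟨a', t⟩ ⟨ha', -⟩
          exact hmaps t (hsub (Metric.closedBall_subset_ball (by linarith) ha'))))
      -- The compactness bound M, valid for |t| ≤ T, is absorbed into the Gaussian through M ≤ |M|
      -- e^{T²} e^{-t²}.
      refine ⟨min ε (ε₁ / 2), by positivity, fun t => (|C| + |M| * Real.exp (T ^ 2)) *
        Real.exp (-t ^ 2), ?_, Eventually.of_forall fun t a' ha' _ => ?_⟩
      · simpa using (integrable_exp_neg_mul_sq one_pos).const_mul (|C| + |M| * Real.exp (T ^ 2))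
      · rcases le_total T |t| with ht | ht
        · refine (h a' (Metric.ball_subset_ball (min_le_left _ _) ha') t ht).trans ?_
          refine mul_le_mul_of_nonneg_right ?_ (Real.exp_pos _).le
          have : 0 ≤ |M| * Real.exp (T ^ 2) := by positivity
          linarith [le_abs_self C]
        · have h1 := hM (a', t) ⟨Metric.ball_subset_closedBall
            (Metric.ball_subset_ball (min_le_right _ _) ha'),
            abs_le.1 (ht.trans (le_abs_self T))⟩
          have h2 : t ^ 2 ≤ T ^ 2 := sq_le_sq.2 (ht.trans (le_abs_self T))
          calc _ ≤ M := h1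
            _ ≤ |M| * 1 := by rw [mul_one]; exact le_abs_self M
            _ ≤ |M| * Real.exp (T ^ 2 + -t ^ 2) := by
              gcongr; exact Real.one_le_exp (by linarith)
            _ = |M| * Real.exp (T ^ 2) * Real.exp (-t ^ 2) := by rw [Real.exp_add]; ring
            _ ≤ _ := mul_le_mul_of_nonneg_right (by linarith [abs_nonneg C]) (Real.exp_pos _).le
  refine hSo.is_const_of_deriv_eq_zero (isPreconnected_crossing_strip α β) hD ?_ ha hb
  intro x hx
  have hd := (hD.differentiableAt (hSo.mem_nhds hx)).hasDerivAt
  -- Moving the base point along the line only translates t. The derivative in the direction `diag`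
  -- is therefore zero, and by holomorphy so is the complex derivative.
  have hline : HasDerivAt (fun h : ℝ => x + h * diag) diag 0 := by
    simpa using ((Complex.ofRealCLM.hasDerivAt (x := (0 : ℝ))).mul_const diag).const_add x
  have hd0 : HasDerivAt (fun a => ∫ t : ℝ, g (a + t * diag))
      (deriv (fun a => ∫ t : ℝ, g (a + t * diag)) x) (x + ((0 : ℝ) : ℂ) * diag) := by
    simpa using hd
  have h1 := HasDerivAt.comp (0 : ℝ) hd0 hline
  have h2 : ((fun a => ∫ t : ℝ, g (a + t * diag)) ∘ fun h : ℝ => x + h * diag) =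
      fun _ => ∫ t : ℝ, g (x + t * diag) := by
    funext h
    simp only [Function.comp]
    rw [← integral_add_right_eq_self (fun t : ℝ => g (x + t * diag)) h]
    congr 1; funext t; push_cast; ring_nf
  rw [h2] at h1
  have h3 := h1.unique (hasDerivAt_const _ _)
  simpa [diag_ne_zero] using h3

/-! ### The denominator `e^{iπu} - e^{-iπu}` -/

/-- The denominator `e^{iπu} - e^{-iπu}`. -/
noncomputable def den (u : ℂ) : ℂ := exp (I * Real.pi * u) - exp (-(I * Real.pi * u))

theorem differentiable_den : Differentiable ℂ den := by unfold den; fun_prop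

theorem continuous_den : Continuous den := differentiable_den.continuous

theorem den_eq (u : ℂ) : den u = 2 * I * sin (Real.pi * u) := by
  rw [den, Complex.sin, show -(↑Real.pi * u) * I = -(I * Real.pi * u) by ring,
    show (↑Real.pi * u) * I = I * Real.pi * u by ring]
  linear_combination (exp (I * Real.pi * u) - exp (-(I * Real.pi * u))) * I_sq

theorem den_eq_zero_iff {u : ℂ} : den u = 0 ↔ ∃ n : ℤ, u = n := by
  have hpi : (Real.pi : ℂ) ≠ 0 := by exact_mod_cast Real.pi_ne_zero
  rw [den_eq, mul_eq_zero, or_iff_right (by simp), Complex.sin_eq_zero_iff]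
  refine exists_congr fun n => ?_
  rw [mul_comm (n : ℂ), mul_right_inj' hpi]

theorem den_ne_zero_of_im {u : ℂ} (h : u.im ≠ 0) : den u ≠ 0 := by
  rw [Ne, den_eq_zero_iff]; rintro ⟨n, rfl⟩; simp at h

theorem den_ne_zero_of_crossing {u : ℂ} {n : ℤ} (h₀ : n < crossing u) (h₁ : crossing u < n + 1) :
    den u ≠ 0 := by
  rw [Ne, den_eq_zero_iff]; rintro ⟨m, rfl⟩
  simp only [crossing, intCast_re, intCast_im, sub_zero] at h₀ h₁
  norm_cast at h₀ h₁
  omega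

theorem den_neg (u : ℂ) : den (-u) = -den u := by simp [den]

theorem exp_I_mul_pi : exp (I * Real.pi) = -1 := by rw [mul_comm, Complex.exp_pi_mul_I]

theorem den_add_one (u : ℂ) : den (u + 1) = -den u := by
  have h : exp (-(I * Real.pi)) = -1 := by rw [Complex.exp_neg, exp_I_mul_pi]; norm_num
  rw [den, den, mul_add, neg_add, exp_add, exp_add, mul_one, h, exp_I_mul_pi]
  ring

theorem conj_den (u : ℂ) : (starRingEnd ℂ) (den u) = -den ((starRingEnd ℂ) u) := by
  simp only [den, map_sub, ← Complex.exp_conj, map_neg, map_mul, Complex.conj_I, Complex.conj_ofReal]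
  simp

/-- The two exponentials have moduli e^{-π Im u} and e^{π Im u}, and these already differ by more
than 1 at height 1. -/
theorem one_le_norm_den {u : ℂ} (h : 1 ≤ |u.im|) : 1 ≤ ‖den u‖ := by
  have h1 : ‖exp (I * Real.pi * u)‖ = Real.exp (-(Real.pi * u.im)) := by
    rw [Complex.norm_exp]; simp
  have h2 : ‖exp (-(I * Real.pi * u))‖ = Real.exp (Real.pi * u.im) := by
    rw [Complex.norm_exp]; simp
  have h3 : |Real.exp (-(Real.pi * u.im)) - Real.exp (Real.pi * u.im)| ≤ ‖den u‖ := by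
    rw [← h1, ← h2]; exact abs_norm_sub_norm_le _ _
  refine le_trans ?_ h3
  have key : ∀ y : ℝ, 1 ≤ y → 1 ≤ Real.exp (Real.pi * y) - Real.exp (-(Real.pi * y)) := by
    intro y hy
    have h5 : Real.exp (-(Real.pi * y)) ≤ 1 := Real.exp_le_one_iff.2 (by
      have := Real.pi_pos; nlinarith)
    have h6 := Real.add_one_le_exp (Real.pi * y)
    nlinarith [Real.pi_gt_three]
  rcases le_abs.1 h with h' | h'
  · rw [abs_sub_comm]; exact (key _ h').trans (le_abs_self _)
  · have := key _ h'
    simp only [mul_neg, neg_neg] at this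
    exact this.trans (le_abs_self _)

theorem abs_im_add_mul_diag {a : ℂ} {t : ℝ} (h : 2 * (1 + ‖a‖) ≤ |t|) :
    1 ≤ |(a + t * diag).im| := by
  have h1 : (a + t * diag).im = a.im + t * (Real.sqrt 2 / 2) := by simp [diag_im]
  have h2 : |t| * (1 / 2) ≤ |t * (Real.sqrt 2 / 2)| := by
    rw [abs_mul, abs_of_nonneg (by positivity : (0 : ℝ) ≤ Real.sqrt 2 / 2)]
    have : (1 : ℝ) ≤ Real.sqrt 2 := by rw [Real.one_le_sqrt]; norm_num
    gcongr
  have h3 := Complex.abs_im_le_norm a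
  have h4 : |t * (Real.sqrt 2 / 2)| ≤ |a.im + t * (Real.sqrt 2 / 2)| + |a.im| := by
    have := abs_sub (a.im + t * (Real.sqrt 2 / 2)) a.im
    simpa using this
  rw [h1]; linarith

theorem continuous_add_mul_diag (a : ℂ) : Continuous fun t : ℝ => a + t * diag := by fun_prop

theorem exists_norm_inv_den_le {c : ℝ} (hc : c ∈ Set.Ioo (0 : ℝ) 1) :
    ∃ C : ℝ, 0 ≤ C ∧ ∀ t : ℝ, ‖(den (c + t * diag))⁻¹‖ ≤ C := by
  have hne : ∀ t : ℝ, den (c + t * diag) ≠ 0 := fun t =>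
    den_ne_zero_of_crossing (n := 0) (by simpa [crossing_add_mul_diag, crossing_ofReal] using hc.1)
      (by simpa [crossing_add_mul_diag, crossing_ofReal] using hc.2)
  have hcont : Continuous fun t : ℝ => (den (c + t * diag))⁻¹ :=
    (continuous_den.comp (continuous_add_mul_diag c)).inv₀ hne
  set T : ℝ := 2 * (1 + ‖(c : ℂ)‖)
  obtain ⟨M, hM⟩ := (isCompact_Icc (a := -T) (b := T)).exists_bound_of_continuousOn
    hcont.continuousOn
  refine ⟨max M 1, by positivity, fun t => ?_⟩
  rcases le_total T |t| with h | h
  · refine le_max_of_le_right ?_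
    rw [norm_inv]
    exact inv_le_one_of_one_le₀ (one_le_norm_den (abs_im_add_mul_diag h))
  · exact le_max_of_le_left (hM t (abs_le.1 h))

/-! ### Gaussian bounds -/

/-- Since `diag ^ 2 = I`, the quadratic part of iπu² along a line of slope 1 is the real number
-πt²; this is why the paths are slanted. -/
theorem gaussian_exponent (a : ℂ) (t : ℝ) :
    I * Real.pi * (a + t * diag) ^ 2 =
      I * Real.pi * a ^ 2 + 2 * Real.pi * I * a * diag * t + ((-(Real.pi * t ^ 2) : ℝ) : ℂ) := by
  push_cast
  linear_combination (I * Real.pi * t ^ 2) * diag_sq + (Real.pi * (t : ℂ) ^ 2) * I_sq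

theorem norm_exp_gaussian_le (a : ℂ) (t : ℝ) :
    ‖exp (I * Real.pi * (a + t * diag) ^ 2)‖ ≤
      Real.exp (Real.pi * ‖a‖ ^ 2 + 2 * Real.pi * ‖a‖ * |t| - Real.pi * t ^ 2) := by
  rw [gaussian_exponent, Complex.norm_exp, Complex.add_re, Complex.add_re, Complex.ofReal_re,
    Real.exp_le_exp, ← sub_eq_add_neg]
  have hpi := Real.pi_pos.le
  have h1 : (I * Real.pi * a ^ 2).re ≤ Real.pi * ‖a‖ ^ 2 := by
    refine (Complex.re_le_norm _).trans (le_of_eq ?_)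
    simp [abs_of_nonneg hpi]
  have h2 : (2 * Real.pi * I * a * diag * t).re ≤ 2 * Real.pi * ‖a‖ * |t| := by
    refine (Complex.re_le_norm _).trans (le_of_eq ?_)
    simp [abs_of_nonneg hpi, norm_diag]
  linarith

/-- Completing the square gives k|t| ≤ k²/4 + t², and π > 3 leaves enough of the Gaussian to pay for
t² and retain e^{-t²}. -/
theorem exp_quadratic_le (k₀ k t : ℝ) :
    Real.exp (k₀ + k * |t| - Real.pi * t ^ 2) ≤ Real.exp (k₀ + k ^ 2 / 4) * Real.exp (-t ^ 2) := by
  rw [← Real.exp_add, Real.exp_le_exp]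
  nlinarith [sq_nonneg (k / 2 - |t|), sq_abs t, Real.pi_gt_three, sq_nonneg t]

theorem integrable_of_norm_le_exp {f : ℝ → ℂ} (hf : AEStronglyMeasurable f) (k₀ k : ℝ)
    (h : ∀ t, ‖f t‖ ≤ Real.exp (k₀ + k * |t| - Real.pi * t ^ 2)) : Integrable f := by
  refine Integrable.mono' (g := fun t => Real.exp (k₀ + k ^ 2 / 4) * Real.exp (-t ^ 2)) ?_ hf
    (Eventually.of_forall fun t => (h t).trans (exp_quadratic_le k₀ k t))
  simpa using (integrable_exp_neg_mul_sq one_pos).const_mul (Real.exp (k₀ + k ^ 2 / 4))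

theorem integral_gaussian_line (a x : ℂ) :
    ∫ t : ℝ, exp (I * Real.pi * (a + t * diag) ^ 2 + 2 * Real.pi * I * x * (a + t * diag)) =
      exp (-(I * Real.pi * x ^ 2)) := by
  have hpi : (Real.pi : ℂ) ≠ 0 := by exact_mod_cast Real.pi_ne_zero
  have h := integral_cexp_quadratic (b := -(Real.pi : ℂ)) (by simp [Real.pi_pos])
    (2 * Real.pi * I * diag * (a + x)) (I * Real.pi * a ^ 2 + 2 * Real.pi * I * x * a)
  rw [neg_neg, div_self hpi, one_cpow, one_mul] at h
  convert h using 1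
  · congr 1; funext t; rw [gaussian_exponent]; congr 1; push_cast; ring
  · congr 1
    rw [mul_pow, mul_pow, mul_pow, diag_sq]
    field_simp
    linear_combination (-(a + x) ^ 2 * 4) * I_sq

/-! ### Mordell's integral -/

/-- The integrand `e^{iπu² + 2πixu} / (e^{iπu} - e^{-iπu})` of Mordell's integral. -/
noncomputable def mordellIntegrand (x u : ℂ) : ℂ :=
  exp (I * Real.pi * u ^ 2 + 2 * Real.pi * I * x * u) / den u

theorem den_line_ne_zero {c : ℝ} (hc : c ∈ Set.Ioo (0 : ℝ) 1) (t : ℝ) :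
    den (c + t * diag) ≠ 0 :=
  den_ne_zero_of_crossing (n := 0) (by simpa [crossing_add_mul_diag, crossing_ofReal] using hc.1)
    (by simpa [crossing_add_mul_diag, crossing_ofReal] using hc.2)

theorem norm_exp_linear_le (x a : ℂ) (t : ℝ) :
    ‖exp (2 * Real.pi * I * x * (a + t * diag))‖ ≤
      Real.exp (2 * Real.pi * ‖x‖ * ‖a‖ + 2 * Real.pi * ‖x‖ * |t|) := by
  rw [Complex.norm_exp, Real.exp_le_exp]
  refine (Complex.re_le_norm _).trans ?_
  have h : ‖a + t * diag‖ ≤ ‖a‖ + |t| := by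
    refine (norm_add_le _ _).trans (le_of_eq ?_)
    simp [norm_diag]
  have hpi := Real.pi_pos
  calc _ = 2 * Real.pi * ‖x‖ * ‖a + t * diag‖ := by simp [abs_of_pos hpi]
    _ ≤ 2 * Real.pi * ‖x‖ * (‖a‖ + |t|) := by gcongr
    _ = _ := by ring

theorem integrable_mordellIntegrand {c : ℝ} (hc : c ∈ Set.Ioo (0 : ℝ) 1) (x : ℂ) :
    Integrable fun t : ℝ => mordellIntegrand x (c + t * diag) := by
  obtain ⟨C, hC, hden⟩ := exists_norm_inv_den_le hc
  simp only [mordellIntegrand, div_eq_mul_inv]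
  refine Integrable.mul_bdd (c := C) ?_ ?_ (Eventually.of_forall hden)
  · refine integrable_of_norm_le_exp (by fun_prop) (Real.pi * ‖(c : ℂ)‖ ^ 2 +
      2 * Real.pi * ‖x‖ * ‖(c : ℂ)‖) (2 * Real.pi * ‖(c : ℂ)‖ + 2 * Real.pi * ‖x‖) fun t => ?_
    rw [Complex.exp_add, norm_mul]
    refine (mul_le_mul (norm_exp_gaussian_le c t) (norm_exp_linear_le x c t) (norm_nonneg _)
      (Real.exp_pos _).le).trans (le_of_eq ?_)
    rw [← Real.exp_add]; congr 1; ring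
  · exact ((continuous_den.comp (continuous_add_mul_diag c)).inv₀
      (den_line_ne_zero hc)).aestronglyMeasurable

/-- First functional equation: shifting x by ±1/2 multiplies the integrand by e^{±iπu}, whose
difference is the denominator, so a pure Gaussian integral remains. -/
theorem mordell_sub {c : ℝ} (hc : c ∈ Set.Ioo (0 : ℝ) 1) (x : ℂ) :
    (∫ t : ℝ, mordellIntegrand (x + 1 / 2) (c + t * diag)) -
      ∫ t : ℝ, mordellIntegrand (x - 1 / 2) (c + t * diag) = exp (-(I * Real.pi * x ^ 2)) := by
  rw [← integral_sub (integrable_mordellIntegrand hc _) (integrable_mordellIntegrand hc _),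
    ← integral_gaussian_line c x]
  congr 1; funext t
  have h := den_line_ne_zero hc t
  rw [mordellIntegrand, mordellIntegrand, ← sub_div, div_eq_iff h, den, mul_sub (exp _), ← exp_add,
    ← exp_add]
  congr 2 <;> ring

theorem mordellIntegrand_add_one (x u : ℂ) :
    mordellIntegrand x (u + 1) = exp (2 * Real.pi * I * x) * mordellIntegrand (x + 1) u := by
  rw [mordellIntegrand, mordellIntegrand, den_add_one, div_neg, ← neg_div, ← mul_div_assoc,
    ← exp_add]
  congr 1
  rw [show I * Real.pi * (u + 1) ^ 2 + 2 * Real.pi * I * x * (u + 1) =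
    2 * Real.pi * I * x + (I * Real.pi * u ^ 2 + 2 * Real.pi * I * (x + 1) * u) + I * Real.pi by
    ring, exp_add _ (I * Real.pi), exp_I_mul_pi]
  ring

theorem differentiable_dslope {f : ℂ → ℂ} (hf : Differentiable ℂ f) (c : ℂ) :
    Differentiable ℂ (dslope f c) := by
  rw [← differentiableOn_univ] at hf ⊢
  exact (Complex.differentiableOn_dslope univ_mem).2 hf

theorem deriv_den_one : deriv den 1 ≠ 0 := by
  have h : HasDerivAt den (exp (I * Real.pi * 1) * (I * Real.pi) -
      exp (-(I * Real.pi * 1)) * (-(I * Real.pi))) 1 := by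
    have h0 : HasDerivAt (fun u : ℂ => I * Real.pi * u) (I * Real.pi) 1 := by
      simpa using (hasDerivAt_id (1 : ℂ)).const_mul (I * Real.pi)
    exact h0.cexp.sub h0.neg.cexp
  have h' : exp (-(I * Real.pi)) = -1 := by rw [Complex.exp_neg, exp_I_mul_pi]; norm_num
  rw [h.deriv, mul_one, h', exp_I_mul_pi]
  have hpi : (Real.pi : ℂ) ≠ 0 := by exact_mod_cast Real.pi_ne_zero
  rw [show -1 * (I * (Real.pi : ℂ)) - -1 * -(I * Real.pi) = -(2 * (I * Real.pi)) by ring]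
  simp

/-- Second functional equation, from moving the line from c to c + 1 across the pole at u = 1.
Subtracting e^{2πix} times the integrand for x = 0 cancels the pole, so no residue has to be
computed. -/
theorem mordell_shift {c : ℝ} (hc : c ∈ Set.Ioo (0 : ℝ) 1) (x : ℂ) :
    (∫ t : ℝ, mordellIntegrand x (c + t * diag)) -
      exp (2 * Real.pi * I * x) * ∫ t : ℝ, mordellIntegrand 0 (c + t * diag) =
    exp (2 * Real.pi * I * x) * (∫ t : ℝ, mordellIntegrand (x + 1) (c + t * diag)) -
      exp (2 * Real.pi * I * x) * ∫ t : ℝ, mordellIntegrand 1 (c + t * diag) := by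
  set E : ℂ → ℂ := fun u => exp (2 * Real.pi * I * x * u) with hE
  have hEd : Differentiable ℂ E := by fun_prop
  -- Both E - E(1) and `den` vanish at 1, the latter simply; dividing each by u - 1 through `dslope`
  -- gives the holomorphic extension of the combined integrand.
  set g : ℂ → ℂ := fun u => exp (I * Real.pi * u ^ 2) * dslope E 1 u / dslope den 1 u with hg
  have hden1 : den 1 = 0 := den_eq_zero_iff.2 ⟨1, by simp⟩
  have hgne : ∀ u : ℂ, u ≠ 1 → g u =
      mordellIntegrand x u - exp (2 * Real.pi * I * x) * mordellIntegrand 0 u := by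
    intro u hu
    have h1 : u - 1 ≠ 0 := sub_ne_zero.2 hu
    simp only [hg, dslope_of_ne _ hu, slope_def_field, hden1, sub_zero, mordellIntegrand, exp_add,
      mul_zero, zero_mul, exp_zero, mul_one]
    rw [mul_div_assoc, div_div_div_cancel_right₀ h1]
    simp only [hE]
    ring_nf
  have hdsl : ∀ u : ℂ, 0 < crossing u → crossing u < 2 → dslope den 1 u ≠ 0 := by
    intro u h0 h2
    rcases eq_or_ne u 1 with rfl | hu
    · rw [dslope_same]; exact deriv_den_one
    · rw [dslope_of_ne _ hu, slope_def_field, hden1, sub_zero]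
      refine div_ne_zero ?_ (sub_ne_zero.2 hu)
      rw [Ne, den_eq_zero_iff]
      rintro ⟨n, rfl⟩
      simp only [crossing, intCast_re, intCast_im, sub_zero] at h0 h2
      norm_cast at h0 h2
      exact hu (by rw [show n = 1 by omega]; simp)
  have hline := integral_line_eq_of_differentiableOn (α := 0) (β := 2) (g := g) (a := c)
    (b := c + 1) ?_ ?_ ?_ ?_
  · have hcr : ∀ t : ℝ, crossing (c + t * diag) = c := fun t => by
      rw [crossing_add_mul_diag, crossing_ofReal]
    have e1 : ∀ t : ℝ, g (c + t * diag) = mordellIntegrand x (c + t * diag) -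
        exp (2 * Real.pi * I * x) * mordellIntegrand 0 (c + t * diag) := by
      intro t
      refine hgne _ fun h => ?_
      have := hcr t
      rw [h, ← Complex.ofReal_one, crossing_ofReal] at this
      linarith [hc.2]
    have e2 : ∀ t : ℝ, g (c + 1 + t * diag) =
        exp (2 * Real.pi * I * x) * mordellIntegrand (x + 1) (c + t * diag) -
        exp (2 * Real.pi * I * x) * mordellIntegrand 1 (c + t * diag) := by
      intro t
      rw [add_right_comm, hgne, mordellIntegrand_add_one, mordellIntegrand_add_one]
      · simp
      · intro h
        have := hcr t
        rw [add_eq_right.1 h, ← Complex.ofReal_zero, crossing_ofReal] at this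
        linarith [hc.1]
    simp only [e1, e2] at hline
    rwa [integral_sub (integrable_mordellIntegrand hc _)
      ((integrable_mordellIntegrand hc _).const_mul _), integral_sub
      ((integrable_mordellIntegrand hc _).const_mul _)
      ((integrable_mordellIntegrand hc _).const_mul _), integral_const_mul, integral_const_mul,
      integral_const_mul] at hline
  · refine DifferentiableOn.div ?_ (differentiable_dslope differentiable_den 1).differentiableOn
      fun u hu => hdsl u hu.1 hu.2
    exact (Differentiable.mul (by fun_prop) (differentiable_dslope hEd 1)).differentiableOn
  · intro a₀ _ _
    set A := ‖a₀‖ + 1 with hA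
    have hpi := Real.pi_pos
    -- A bounds ‖a‖ on the unit ball around a₀. Beyond |t| = 2(1 + A) the point has height at least
    -- 1, so the denominator has norm at least 1.
    refine ⟨1, one_pos, 2 * (1 + A), 2 * Real.exp ((Real.pi * A ^ 2 + 2 * Real.pi * ‖x‖ * (1 + A)) +
      (2 * Real.pi * A + 2 * Real.pi * ‖x‖) ^ 2 / 4), fun a ha t ht => ?_⟩
    have haA : ‖a‖ ≤ A := by
      have := norm_sub_norm_le a a₀
      rw [Metric.mem_ball, dist_eq_norm] at ha
      linarith
    have him : 1 ≤ |(a + t * diag).im| := abs_im_add_mul_diag (by linarith)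
    have hd := one_le_norm_den him
    have hne : a + t * diag ≠ 1 := by
      intro h; rw [h] at him; norm_num at him
    rw [hgne _ hne, show mordellIntegrand x (a + t * diag) - exp (2 * Real.pi * I * x) *
      mordellIntegrand 0 (a + t * diag) = exp (I * Real.pi * (a + t * diag) ^ 2) *
        (exp (2 * Real.pi * I * x * (a + t * diag)) - exp (2 * Real.pi * I * x)) /
          den (a + t * diag) by
        simp only [mordellIntegrand, exp_add, mul_zero, zero_mul, exp_zero]; ring,
      norm_div, norm_mul]
    have h1 : ‖exp (2 * Real.pi * I * x)‖ ≤ Real.exp (2 * Real.pi * ‖x‖ * (1 + A + |t|)) := by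
      rw [Complex.norm_exp, Real.exp_le_exp]
      refine (Complex.re_le_norm _).trans ?_
      have : 0 ≤ A := by positivity
      calc _ = 2 * Real.pi * ‖x‖ * 1 := by simp [abs_of_pos hpi]
        _ ≤ _ := by gcongr; linarith [abs_nonneg t]
    have h2 : ‖exp (2 * Real.pi * I * x * (a + t * diag))‖ ≤
        Real.exp (2 * Real.pi * ‖x‖ * (1 + A + |t|)) := by
      refine (norm_exp_linear_le x a t).trans (Real.exp_le_exp.2 ?_)
      rw [← mul_add]
      gcongr
      linarith
    have h3 : ‖exp (I * Real.pi * (a + t * diag) ^ 2)‖ ≤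
        Real.exp (Real.pi * A ^ 2 + 2 * Real.pi * A * |t| - Real.pi * t ^ 2) := by
      refine (norm_exp_gaussian_le a t).trans (Real.exp_le_exp.2 ?_)
      gcongr
    calc _ ≤ ‖exp (I * Real.pi * (a + t * diag) ^ 2)‖ *
          ‖exp (2 * Real.pi * I * x * (a + t * diag)) - exp (2 * Real.pi * I * x)‖ :=
          div_le_self (by positivity) hd
      _ ≤ Real.exp (Real.pi * A ^ 2 + 2 * Real.pi * A * |t| - Real.pi * t ^ 2) *
          (2 * Real.exp (2 * Real.pi * ‖x‖ * (1 + A + |t|))) := by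
          refine mul_le_mul h3 ?_ (norm_nonneg _) (Real.exp_pos _).le
          exact (norm_sub_le _ _).trans (by linarith)
      _ = 2 * Real.exp ((Real.pi * A ^ 2 + 2 * Real.pi * ‖x‖ * (1 + A)) +
            (2 * Real.pi * A + 2 * Real.pi * ‖x‖) * |t| - Real.pi * t ^ 2) := by
          rw [mul_left_comm, ← Real.exp_add]; congr 2; ring
      _ ≤ _ := by
          rw [mul_assoc 2 (Real.exp _)]
          exact mul_le_mul_of_nonneg_left (exp_quadratic_le _ _ _) zero_le_two
  · rw [crossing_ofReal]; exact ⟨hc.1, by linarith [hc.2]⟩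
  · rw [show (c : ℂ) + 1 = ((c + 1 : ℝ) : ℂ) by push_cast; rfl, crossing_ofReal]
    exact ⟨by linarith [hc.1], by linarith [hc.2]⟩

/-- `mordell_sub` at x + 1/2 and at 1/2 expresses the differences M(x+1) - M(x) and M(1) - M(0);
inserted in `mordell_shift`, they eliminate every unknown except M(x). -/
theorem diag_mul_mordell {c : ℝ} (hc : c ∈ Set.Ioo (0 : ℝ) 1) (x : ℂ) :
    diag * (∫ t : ℝ, mordellIntegrand x (c + t * diag)) * den x =
      exp (I * Real.pi * x) - exp (-(I * Real.pi * x ^ 2)) := by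
  have h1 := mordell_shift hc x
  have h2 := mordell_sub hc (x + 1 / 2)
  have h3 := mordell_sub hc (1 / 2)
  rw [show x + 1 / 2 + 1 / 2 = x + 1 by ring, add_sub_cancel_right] at h2
  rw [show (1 : ℂ) / 2 + 1 / 2 = 1 by ring, sub_self] at h3
  set M := ∫ t : ℝ, mordellIntegrand x (c + t * diag)
  set p := exp (I * Real.pi * x) with hp
  have hp0 : p ≠ 0 := exp_ne_zero _
  have e1 : exp (2 * Real.pi * I * x) = p * p := by rw [hp, ← exp_add]; congr 1; ring
  have e2 : exp (-(I * Real.pi * x)) = p⁻¹ := exp_neg _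
  have e3 : exp (-(I * Real.pi * (1 / 2) ^ 2)) = diag⁻¹ := by
    rw [diag, ← exp_neg]; congr 1; ring
  have e4 : exp (-(I * Real.pi * (x + 1 / 2) ^ 2)) = exp (-(I * Real.pi * x ^ 2)) * p⁻¹ * diag⁻¹ := by
    rw [diag, ← e2, ← exp_neg, ← exp_add, ← exp_add]; congr 1; ring
  rw [e1] at h1
  rw [e3] at h3
  rw [e4] at h2
  rw [den, e2, ← hp]
  have hd := diag_ne_zero
  have h4 : M * (1 - p * p) = p * p * (exp (-(I * Real.pi * x ^ 2)) * p⁻¹ * diag⁻¹) -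
      p * p * diag⁻¹ := by
    linear_combination h1 + (p * p) * h2 - (p * p) * h3
  field_simp at h4 ⊢
  linear_combination (-1) * h4

/-! ### Complex powers -/

theorem norm_cpow_le_exp {u : ℂ} (hu : u ≠ 0) (w : ℂ) :
    ‖u ^ w‖ ≤ Real.exp (‖w‖ * (Real.pi + |Real.log ‖u‖|)) := by
  rw [cpow_def_of_ne_zero hu, Complex.norm_exp, Real.exp_le_exp]
  refine (Complex.re_le_norm _).trans ?_
  rw [norm_mul, mul_comm]
  refine mul_le_mul_of_nonneg_left ?_ (norm_nonneg _)
  refine (Complex.norm_le_abs_re_add_abs_im _).trans ?_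
  rw [Complex.log_re, Complex.log_im, add_comm]
  exact add_le_add_left (Complex.abs_arg_le_pi u) _

/-- The free slope η lets a complex power grow at an exponential rate as small as desired; the price
is only a constant. -/
theorem abs_log_le {r η y : ℝ} (hr : 0 < r) (hη : 0 < η) (hy : r ≤ y) :
    |Real.log y| ≤ |Real.log r| + |Real.log η| + η * y := by
  have hy0 : 0 < y := hr.trans_le hy
  have h1 : Real.log r ≤ Real.log y := Real.log_le_log hr hy
  have h2 : Real.log η + Real.log y ≤ η * y - 1 := by
    rw [← Real.log_mul hη.ne' hy0.ne']; exact Real.log_le_sub_one_of_pos (by positivity)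
  have h3 := neg_abs_le (Real.log r)
  have h4 := neg_abs_le (Real.log η)
  rw [abs_le]
  have : 0 ≤ η * y := by positivity
  constructor <;> linarith [abs_nonneg (Real.log r), abs_nonneg (Real.log η)]

theorem norm_cpow_le {r η N : ℝ} (hr : 0 < r) (hη : 0 < η) {u w : ℂ} (hu : r ≤ ‖u‖)
    (hw : ‖w‖ ≤ N) :
    ‖u ^ w‖ ≤ Real.exp (N * (Real.pi + |Real.log r| + |Real.log η|) + N * η * ‖u‖) := by
  refine (norm_cpow_le_exp (norm_pos_iff.1 (hr.trans_le hu)) w).trans (Real.exp_le_exp.2 ?_)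
  have h := abs_log_le hr hη hu
  have hN : 0 ≤ N := (norm_nonneg w).trans hw
  calc _ ≤ N * (Real.pi + (|Real.log r| + |Real.log η| + η * ‖u‖)) := by gcongr
    _ = _ := by ring

theorem norm_line_le (c : ℝ) (t : ℝ) : ‖(c + t * diag : ℂ)‖ ≤ |c| + |t| := by
  refine (norm_add_le _ _).trans (le_of_eq ?_)
  simp [norm_diag]

theorem le_norm_of_crossing (u : ℂ) : crossing u / 2 ≤ ‖u‖ := by
  have h1 := Complex.re_le_norm u
  have h2 := (neg_le_abs _).trans (Complex.abs_im_le_norm u)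
  rw [crossing]; linarith

theorem le_norm_line (c t : ℝ) : c / 2 ≤ ‖(c + t * diag : ℂ)‖ := by
  have := le_norm_of_crossing (c + t * diag)
  rwa [crossing_add_mul_diag, crossing_ofReal] at this

theorem line_mem_slitPlane {c : ℝ} (hc : 0 < c) (t : ℝ) : (c + t * diag : ℂ) ∈ slitPlane := by
  rw [Complex.mem_slitPlane_iff]
  by_contra! h
  have h1 : crossing (c + t * diag) = c := by rw [crossing_add_mul_diag, crossing_ofReal]
  rw [crossing, h.2] at h1
  linarith [h.1]

/-! ### The Riemann–Siegel integrand -/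

theorem rsIntegrand_eq (s u : ℂ) :
    rsIntegrand s u = exp (I * Real.pi * u ^ 2) * u ^ (-s) / den u := rfl

theorem exists_norm_rsIntegrand_le {c : ℝ} (hc : c ∈ Set.Ioo (0 : ℝ) 1) (N : ℝ) :
    ∃ C : ℝ, ∀ s : ℂ, ‖s‖ ≤ N → ∀ t : ℝ,
      ‖rsIntegrand s (c + t * diag)‖ ≤ C * Real.exp (-t ^ 2) := by
  obtain ⟨C, hC, hden⟩ := exists_norm_inv_den_le hc
  set K := N * (Real.pi + |Real.log (c / 2)| + |Real.log 1|) with hK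
  refine ⟨C * Real.exp (Real.pi * ‖(c : ℂ)‖ ^ 2 + K + N * |c| +
    (2 * Real.pi * ‖(c : ℂ)‖ + N) ^ 2 / 4), fun s hs t => ?_⟩
  have hN : 0 ≤ N := (norm_nonneg s).trans hs
  have h1 := norm_cpow_le (η := 1) (half_pos hc.1) one_pos (le_norm_line c t)
    (N := N) (w := -s) (by rwa [norm_neg])
  rw [rsIntegrand_eq, div_eq_mul_inv, norm_mul, norm_mul]
  calc _ ≤ Real.exp (Real.pi * ‖(c : ℂ)‖ ^ 2 + 2 * Real.pi * ‖(c : ℂ)‖ * |t| - Real.pi * t ^ 2) *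
        Real.exp (K + N * 1 * (|c| + |t|)) * C := by
        gcongr
        · exact norm_exp_gaussian_le c t
        · refine h1.trans (Real.exp_le_exp.2 ?_)
          rw [hK, mul_one]
          gcongr
          exact norm_line_le c t
        · exact hden t
    _ = C * Real.exp (Real.pi * ‖(c : ℂ)‖ ^ 2 + K + N * |c| +
        (2 * Real.pi * ‖(c : ℂ)‖ + N) * |t| - Real.pi * t ^ 2) := by
        rw [← Real.exp_add, mul_comm]; congr 2; ring
    _ ≤ _ := by
        rw [mul_assoc C (Real.exp _)]
        exact mul_le_mul_of_nonneg_left (exp_quadratic_le _ _ _) hC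

theorem continuous_rsIntegrand_line {c : ℝ} (hc : c ∈ Set.Ioo (0 : ℝ) 1) (s : ℂ) :
    Continuous fun t : ℝ => rsIntegrand s (c + t * diag) := by
  simp only [rsIntegrand_eq]
  refine Continuous.div (Continuous.mul (by fun_prop) ?_)
    (continuous_den.comp (continuous_add_mul_diag c)) (den_line_ne_zero hc)
  exact Continuous.cpow (by fun_prop) continuous_const fun t => line_mem_slitPlane hc.1 t

theorem integrable_const_mul_exp_neg_sq (C : ℝ) :
    Integrable fun t : ℝ => C * Real.exp (-t ^ 2) := by
  simpa using (integrable_exp_neg_mul_sq one_pos).const_mul C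

theorem integrable_rsIntegrand {c : ℝ} (hc : c ∈ Set.Ioo (0 : ℝ) 1) (s : ℂ) :
    Integrable fun t : ℝ => rsIntegrand s (c + t * diag) := by
  obtain ⟨C, hC⟩ := exists_norm_rsIntegrand_le hc ‖s‖
  exact (integrable_const_mul_exp_neg_sq C).mono'
    (continuous_rsIntegrand_line hc s).aestronglyMeasurable
    (Eventually.of_forall fun t => hC s le_rfl t)

theorem differentiable_integral_rsIntegrand {c : ℝ} (hc : c ∈ Set.Ioo (0 : ℝ) 1) :
    Differentiable ℂ fun s => ∫ t : ℝ, rsIntegrand s (c + t * diag) := by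
  rw [← differentiableOn_univ]
  refine differentiableOn_integral_of_locally_dominated isOpen_univ
    (fun s _ => (continuous_rsIntegrand_line hc s).aestronglyMeasurable)
    (Eventually.of_forall fun t => ?_) fun s _ => ?_
  · simp only [rsIntegrand_eq]
    have : (c + t * diag : ℂ) ≠ 0 := slitPlane_ne_zero (line_mem_slitPlane hc.1 t)
    intro s _
    refine DifferentiableAt.differentiableWithinAt ?_
    refine DifferentiableAt.div_const (DifferentiableAt.const_mul ?_ _) _
    exact differentiableAt_id.neg.const_cpow (Or.inl this)
  · obtain ⟨C, hC⟩ := exists_norm_rsIntegrand_le hc (‖s‖ + 1)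
    refine ⟨1, one_pos, _, integrable_const_mul_exp_neg_sq C,
      Eventually.of_forall fun t s' hs' _ => hC s' ?_ t⟩
    have := norm_sub_norm_le s' s
    rw [Metric.mem_ball, dist_eq_norm] at hs'
    linarith

/-! ### Laplace transforms of powers -/

theorem integrableOn_cpow_mul_exp_neg {s : ℂ} (hs : 0 < s.re) {r : ℝ} (hr : 0 < r) :
    IntegrableOn (fun t : ℝ => t ^ (s.re - 1) * Real.exp (-r * t)) (Set.Ioi 0) := by
  simpa using integrableOn_rpow_mul_exp_neg_mul_rpow (p := 1) (s := s.re - 1) (by linarith) one_pos hr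

theorem norm_cpow_mul_exp_neg {s r : ℂ} {t : ℝ} (ht : 0 < t) :
    ‖(t : ℂ) ^ (s - 1) * exp (-(r * t))‖ = t ^ (s.re - 1) * Real.exp (-r.re * t) := by
  rw [norm_mul, Complex.norm_cpow_eq_rpow_re_of_pos ht, Complex.norm_exp]
  simp

/-- For real r > 0 this is the Gamma integral. Both sides are holomorphic in the right half-plane
and agree at the points 1 + 1/(n+1), which accumulate at 1. -/
theorem integral_cpow_mul_exp_neg_mul {s r : ℂ} (hs : 0 < s.re) (hr : 0 < r.re) :
    ∫ t in Set.Ioi (0 : ℝ), (t : ℂ) ^ (s - 1) * exp (-(r * t)) = r ^ (-s) * Gamma s := by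
  set U : Set ℂ := {r | 0 < r.re} with hU
  have hUo : IsOpen U := isOpen_lt continuous_const Complex.continuous_re
  have hUp : IsPreconnected U := (convex_halfSpace_re_gt 0).isPreconnected
  have h1 : DifferentiableOn ℂ
      (fun r => ∫ t in Set.Ioi (0 : ℝ), (t : ℂ) ^ (s - 1) * exp (-(r * t))) U := by
    refine differentiableOn_integral_of_locally_dominated hUo ?_ ?_ ?_
    · intro r _
      exact Measurable.aestronglyMeasurable (by fun_prop)
    · refine Eventually.of_forall fun t => Differentiable.differentiableOn (by fun_prop)
    · intro r hr
      refine ⟨r.re / 2, half_pos hr, _, integrableOn_cpow_mul_exp_neg hs (half_pos hr), ?_⟩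
      refine (ae_restrict_mem measurableSet_Ioi).mono fun t ht r' hr' _ => ?_
      rw [norm_cpow_mul_exp_neg ht]
      have h := (Complex.abs_re_le_norm (r' - r))
      rw [Metric.mem_ball, dist_eq_norm] at hr'
      have h' := (abs_le.1 (h.trans hr'.le)).1
      rw [Complex.sub_re] at h'
      have ht' : (0 : ℝ) < t := ht
      gcongr
      linarith
  have h2 : DifferentiableOn ℂ (fun r : ℂ => r ^ (-s) * Gamma s) U := by
    intro r hr
    exact ((differentiableAt_id.cpow_const (Or.inl hr)).mul_const _).differentiableWithinAt
  refine (h1.analyticOnNhd hUo).eqOn_of_preconnected_of_frequently_eq (h2.analyticOnNhd hUo) hUp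
    (z₀ := 1) (by simp [hU]) ?_ hr
  have htend : Tendsto (fun n : ℕ => ((1 + 1 / (n + 1 : ℝ) : ℝ) : ℂ)) atTop (𝓝[≠] 1) := by
    refine tendsto_nhdsWithin_iff.2 ⟨?_, Eventually.of_forall fun n => ?_⟩
    · have h := (tendsto_one_div_add_atTop_nhds_zero_nat (𝕜 := ℝ)).const_add 1
      exact (Complex.continuous_ofReal.tendsto' (1 + 0) 1 (by simp)).comp h
    · have : (0 : ℝ) < 1 / (n + 1 : ℝ) := by positivity
      rw [Set.mem_compl_singleton_iff, ← Complex.ofReal_one, Ne, Complex.ofReal_inj]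
      linarith
  refine htend.frequently (Frequently.of_forall fun n => ?_)
  have hpos : (0 : ℝ) < 1 + 1 / (n + 1 : ℝ) := by positivity
  rw [Complex.integral_cpow_mul_exp_neg_mul_Ioi hs hpos, one_div, Complex.cpow_neg,
    Complex.inv_cpow _ _ (by rw [Complex.arg_ofReal_of_nonneg hpos.le]; exact Real.pi_pos.ne)]

theorem re_diag_mul_line (c t : ℝ) : (diag * (c + t * diag)).re = c * (Real.sqrt 2 / 2) := by
  rw [mul_add, mul_left_comm, ← sq, diag_sq]
  simp [diag_re, mul_comm]

/-- The rotated Laplace representation of `u^{-s}` on lines of slope `1`. -/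
theorem cpow_neg_mul_Gamma {s : ℂ} (hs : 0 < s.re) {c : ℝ} (hc : 0 < c) (t : ℝ) :
    (c + t * diag) ^ (-s) * Gamma s = exp (I * Real.pi * s / 4) *
      ∫ τ in Set.Ioi (0 : ℝ), (τ : ℂ) ^ (s - 1) * exp (-(diag * (c + t * diag) * τ)) := by
  have hre : 0 < (diag * (c + t * diag)).re := by rw [re_diag_mul_line]; positivity
  rw [integral_cpow_mul_exp_neg_mul hs hre, ← mul_assoc]
  congr 1
  set r := diag * (c + t * diag) with hr
  have hr0 : r ≠ 0 := fun h => by rw [h] at hre; simp at hre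
  have hu : (c + t * diag : ℂ) = diag⁻¹ * r := by
    rw [hr, ← mul_assoc, inv_mul_cancel₀ diag_ne_zero, one_mul]
  have hlogd : log diag⁻¹ = -(I * Real.pi / 4) := by
    rw [diag, ← exp_neg, Complex.log_exp]
    · simp; linarith [Real.pi_pos]
    · simp; linarith [Real.pi_pos]
  have hargd : arg diag⁻¹ = -(Real.pi / 4) := by
    rw [← Complex.log_im, hlogd]; simp
  have hargr := abs_lt.1 (Complex.abs_arg_lt_pi_div_two_iff.2 (Or.inl hre))
  -- The argument -π/4 and an argument in (-π/2, π/2) have their sum inside (-π, π), so the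
  -- principal logarithms add.
  have hlog : log (c + t * diag) = -(I * Real.pi / 4) + log r := by
    rw [hu, Complex.log_mul (inv_ne_zero diag_ne_zero) hr0, hlogd]
    rw [hargd]
    constructor <;> linarith [hargr.1, hargr.2, Real.pi_pos]
  rw [cpow_def_of_ne_zero (slitPlane_ne_zero (line_mem_slitPlane hc t)), cpow_def_of_ne_zero hr0,
    hlog, ← exp_add]
  congr 1; ring

/-- The point `x` with `2πix = -τ e^{iπ/4}`. -/
noncomputable def laplacePoint (τ : ℝ) : ℂ := τ * diag * I / (2 * Real.pi)

theorem two_pi_I_mul_laplacePoint (τ : ℝ) :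
    2 * Real.pi * I * laplacePoint τ = -(τ * diag) := by
  have hpi : (Real.pi : ℂ) ≠ 0 := by exact_mod_cast Real.pi_ne_zero
  rw [laplacePoint]
  field_simp
  linear_combination (τ * diag : ℂ) * I_sq

theorem mordellIntegrand_laplacePoint (τ : ℝ) (u : ℂ) :
    mordellIntegrand (laplacePoint τ) u =
      exp (-(diag * u * τ)) * mordellIntegrand 0 u := by
  rw [mordellIntegrand, mordellIntegrand, two_pi_I_mul_laplacePoint, ← mul_div_assoc, ← exp_add]
  congr 2; ring

/-- Along the line Re(`diag` · u) has the constant value c√2/2. The Laplace kernel thus has modulus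
depending on τ alone, and Fubini needs only a product of two integrable functions. -/
theorem integrable_laplace_mordellIntegrand {s : ℂ} (hs : 0 < s.re) {c : ℝ}
    (hc : c ∈ Set.Ioo (0 : ℝ) 1) :
    Integrable (Function.uncurry fun (t τ : ℝ) => (τ : ℂ) ^ (s - 1) *
      mordellIntegrand (laplacePoint τ) (c + t * diag))
      (volume.prod (volume.restrict (Set.Ioi (0 : ℝ)))) := by
  have hpos : 0 < c * (Real.sqrt 2 / 2) := mul_pos hc.1 (by positivity)
  have hp : Integrable (fun p : ℝ × ℝ => ‖mordellIntegrand 0 (c + p.1 * diag)‖ *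
      (p.2 ^ (s.re - 1) * Real.exp (-(c * (Real.sqrt 2 / 2)) * p.2)))
      (volume.prod (volume.restrict (Set.Ioi (0 : ℝ)))) :=
    Integrable.mul_prod (f := fun t : ℝ => ‖mordellIntegrand 0 (c + t * diag)‖)
      (g := fun τ : ℝ => τ ^ (s.re - 1) * Real.exp (-(c * (Real.sqrt 2 / 2)) * τ))
      (integrable_mordellIntegrand hc 0).norm (integrableOn_cpow_mul_exp_neg hs hpos)
  refine hp.mono' ?_ ?_
  · have hm : Measurable fun p : ℝ × ℝ => (p.2 : ℂ) ^ (s - 1) *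
        mordellIntegrand (laplacePoint p.2) (c + p.1 * diag) := by
      simp only [mordellIntegrand, laplacePoint]
      have := continuous_den.measurable
      fun_prop
    exact hm.aestronglyMeasurable
  · have hae : ∀ᵐ p : ℝ × ℝ ∂(volume.prod (volume.restrict (Set.Ioi (0 : ℝ)))), 0 < p.2 :=
      Measure.quasiMeasurePreserving_snd.ae (ae_restrict_mem measurableSet_Ioi)
    filter_upwards [hae] with p hp
    simp only [Function.uncurry]
    rw [mordellIntegrand_laplacePoint, ← mul_assoc, norm_mul, norm_cpow_mul_exp_neg hp,
      re_diag_mul_line, mul_comm]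

theorem integral_rsIntegrand_mul_Gamma {s : ℂ} (hs : 0 < s.re) {c : ℝ}
    (hc : c ∈ Set.Ioo (0 : ℝ) 1) :
    (∫ t : ℝ, rsIntegrand s (c + t * diag)) * Gamma s = exp (I * Real.pi * s / 4) *
      ∫ τ in Set.Ioi (0 : ℝ), (τ : ℂ) ^ (s - 1) *
        ∫ t : ℝ, mordellIntegrand (laplacePoint τ) (c + t * diag) := by
  rw [← integral_mul_const]
  calc _ = ∫ t : ℝ, exp (I * Real.pi * s / 4) * ∫ τ in Set.Ioi (0 : ℝ), (τ : ℂ) ^ (s - 1) *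
        mordellIntegrand (laplacePoint τ) (c + t * diag) := by
        congr 1; funext t
        rw [rsIntegrand_eq, div_mul_eq_mul_div, mul_assoc, cpow_neg_mul_Gamma hs hc.1,
          mul_left_comm, mul_div_assoc]
        congr 1
        rw [mul_comm, mul_div_assoc, ← integral_mul_const]
        congr 1; funext τ
        rw [mordellIntegrand_laplacePoint, mordellIntegrand]
        simp only [mul_zero, zero_mul, add_zero]
        ring
    _ = _ := by
        rw [integral_const_mul, integral_integral_swap
          (integrable_laplace_mordellIntegrand hs hc)]
        simp only [integral_const_mul]

/-! ### The contour integral of the parabolic cylinder function -/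

/-- The real-line integral `∫_0^∞ t^{s-1} e^{-t²/2 - zt} dt`. -/
noncomputable def laplaceGauss (s z : ℂ) : ℂ :=
  ∫ t in Set.Ioi (0 : ℝ), (t : ℂ) ^ (s - 1) * exp (-t ^ 2 / 2 - z * t)

/-- Cauchy's theorem on the rectangles [-R, 1] × [0, 1]; the bound C eˣ removes the left side as R →
∞. Continuity alone is required on the boundary because an edge will lie on the cut. -/
theorem integral_halfStrip_eq_zero {g : ℂ → ℂ} {C : ℝ}
    (hc : ContinuousOn g {w | 0 ≤ w.im ∧ w.im ≤ 1})
    (hd : DifferentiableOn ℂ g {w | 0 < w.im ∧ w.im < 1})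
    (hb : ∀ x y : ℝ, x ≤ 1 → 0 ≤ y → y ≤ 1 → ‖g (x + y * I)‖ ≤ C * Real.exp x) :
    (∫ t in Set.Iic (1 : ℝ), g t) - (∫ t in Set.Iic (1 : ℝ), g (t + I)) +
      I * ∫ y in (0 : ℝ)..1, g (1 + y * I) = 0 := by
  have hint : ∀ y : ℝ, 0 ≤ y → y ≤ 1 →
      IntegrableOn (fun x : ℝ => g (x + y * I)) (Set.Iic 1) := by
    intro y h0 h1
    refine Integrable.mono' ((integrableOn_exp_Iic 1).const_mul C) ?_ ?_
    · refine (hc.comp_continuous (by fun_prop) fun x => ?_).aestronglyMeasurable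
      simp [h0, h1]
    · filter_upwards [ae_restrict_mem measurableSet_Iic] with x hx using hb x y hx h0 h1
  have hlim : ∀ y : ℝ, 0 ≤ y → y ≤ 1 → Tendsto (fun R : ℝ => ∫ x in (-R)..1, g (x + y * I)) atTop
      (𝓝 (∫ x in Set.Iic (1 : ℝ), g (x + y * I))) := fun y h0 h1 =>
    intervalIntegral_tendsto_integral_Iic 1 (hint y h0 h1) tendsto_neg_atTop_atBot
  have hside : Tendsto (fun R : ℝ => ∫ y in (0 : ℝ)..1, g ((-R : ℝ) + y * I)) atTop (𝓝 0) := by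
    have hz : Tendsto (fun R : ℝ => C * Real.exp (-R)) atTop (𝓝 0) := by
      simpa using (Real.tendsto_exp_neg_atTop_nhds_zero.const_mul C)
    refine squeeze_zero_norm' ?_ hz
    filter_upwards [eventually_ge_atTop (-1)] with R hR
    have := intervalIntegral.norm_integral_le_of_norm_le_const (a := (0 : ℝ)) (b := 1)
      (f := fun y : ℝ => g ((-R : ℝ) + y * I)) (C := C * Real.exp (-R)) fun y hy => by
        rw [Set.uIoc_of_le zero_le_one] at hy
        exact hb (-R) y (by linarith) hy.1.le hy.2
    simpa using this
  have hrect : ∀ R : ℝ, 0 ≤ R → (∫ x in (-R)..1, g (x + (0 : ℝ) * I)) -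
      (∫ x in (-R)..1, g (x + (1 : ℝ) * I)) + I * (∫ y in (0 : ℝ)..1, g ((1 : ℝ) + y * I)) -
      I * (∫ y in (0 : ℝ)..1, g ((-R : ℝ) + y * I)) = 0 := by
    intro R hR
    have h := Complex.integral_boundary_rect_eq_zero_of_continuousOn_of_differentiableOn g
      (-R : ℝ) (1 + I) (hc.mono ?_) (hd.mono ?_)
    · simpa using h
    · intro w hw
      have := hw.2
      simp only [ofReal_im, add_im, one_im, I_im, zero_add, Set.mem_preimage,
        Set.uIcc_of_le zero_le_one] at this
      exact this
    · intro w hw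
      have := hw.2
      simp only [ofReal_im, add_im, one_im, I_im, zero_add, Set.mem_preimage,
        min_eq_left zero_le_one, max_eq_right zero_le_one] at this
      exact this
  have htot := (((hlim 0 le_rfl zero_le_one).sub (hlim 1 zero_le_one le_rfl)).add_const
    (I * (∫ y in (0 : ℝ)..1, g ((1 : ℝ) + y * I)))).sub (hside.const_mul I)
  have hzero := tendsto_nhds_unique htot
    (tendsto_const_nhds.congr' ((eventually_ge_atTop 0).mono fun R hR => (hrect R hR).symm))
  simpa using hzero

theorem norm_exp_quadratic_le (z w : ℂ) (hw : |w.im| ≤ 1) :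
    ‖exp (-w ^ 2 / 2 + z * w)‖ ≤ Real.exp (1 / 2 + |z.im| + (-w.re ^ 2 / 2 + z.re * w.re)) := by
  rw [Complex.norm_exp, Real.exp_le_exp]
  have h1 : (-w ^ 2 / 2 + z * w).re = -(w.re ^ 2 - w.im ^ 2) / 2 + (z.re * w.re - z.im * w.im) := by
    rw [sq, show -(w * w) / 2 = ((-(1 / 2) : ℝ) : ℂ) * (w * w) by push_cast; ring]
    simp only [add_re, mul_re, mul_im, ofReal_re, ofReal_im]
    ring
  have h2 : w.im ^ 2 ≤ 1 := by rw [← sq_abs]; exact pow_le_one₀ (abs_nonneg _) hw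
  have h3 : -(z.im * w.im) ≤ |z.im| := by
    refine (neg_le_abs _).trans ?_
    rw [abs_mul]
    exact mul_le_of_le_one_right (abs_nonneg _) hw
  rw [h1]; linarith

theorem norm_rotated_integrand_le {κ : ℂ} (hκ : ‖κ‖ = 1) (z p : ℂ) (hp : 0 ≤ p.re) :
    ∃ C : ℝ, ∀ w : ℂ, |w.im| ≤ 1 → w.re ≤ 1 →
      ‖exp (-w ^ 2 / 2 + z * w) * (κ * w) ^ p‖ ≤ C * Real.exp w.re := by
  -- The last square is the maximum over x of (|Re z| + Re p + 1)x - x²/2; the summand 1 pays for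
  -- the factor e^{Re w} on the right.
  refine ⟨Real.exp (1 / 2 + |z.im| + Real.pi * |p.im| + p.re + (|z.re| + p.re + 1) ^ 2 / 2),
    fun w him hre => ?_⟩
  have h1 := norm_exp_quadratic_le z w him
  have h2 : ‖(κ * w) ^ p‖ ≤ Real.exp (Real.pi * |p.im| + p.re * (|w.re| + 1)) := by
    refine (Complex.norm_cpow_le _ _).trans ?_
    rw [div_eq_mul_inv, ← Real.exp_neg, add_comm, Real.exp_add, mul_comm]
    have hn : ‖κ * w‖ ≤ |w.re| + 1 := by
      rw [norm_mul, hκ, one_mul]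
      exact (Complex.norm_le_abs_re_add_abs_im w).trans (by linarith)
    have h4 : ‖κ * w‖ ≤ Real.exp (|w.re| + 1) := by
      linarith [Real.add_one_le_exp (|w.re| + 1)]
    refine mul_le_mul ?_ ?_ (Real.rpow_nonneg (norm_nonneg _) _) (Real.exp_pos _).le |>.trans
      (le_of_eq (mul_comm _ _))
    · rw [Real.exp_le_exp]
      refine (neg_le_abs _).trans ?_
      rw [abs_mul]
      exact mul_le_mul_of_nonneg_right (Complex.abs_arg_le_pi _) (abs_nonneg _)
    · refine (Real.rpow_le_rpow (norm_nonneg _) h4 hp).trans (le_of_eq ?_)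
      rw [← Real.exp_mul, mul_comm]
  rw [norm_mul]
  refine (mul_le_mul h1 h2 (norm_nonneg _) (Real.exp_pos _).le).trans ?_
  rw [← Real.exp_add, ← Real.exp_add, Real.exp_le_exp]
  have h5 : z.re * w.re ≤ |z.re| * |w.re| := (le_abs_self _).trans (abs_mul _ _).le
  nlinarith [sq_nonneg (|z.re| + p.re + 1 - |w.re|), sq_abs w.re, neg_abs_le w.re]

/-- Rotation by -i carries the upper half-plane to the right half-plane, where the principal power
extends continuously to the boundary if Re p > 0. This gives the boundary values of w^p above the
cut, up to a constant factor. -/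
theorem neg_I_mul_cpow {w : ℂ} (hw : 0 < w.im ∨ 0 < w.re) (hw' : 0 ≤ w.im) (p : ℂ) :
    (-I * w) ^ p = w ^ p * exp (-(I * Real.pi * p / 2)) := by
  have hne : w ≠ 0 := by rintro rfl; simp at hw
  have harg0 : 0 ≤ arg w := Complex.arg_nonneg_iff.2 hw'
  have hlog : log (-I * w) = -(Real.pi / 2) * I + log w := by
    rw [Complex.log_mul (by simp) hne, Complex.log_neg_I]
    rw [Complex.arg_neg_I]
    constructor
    · linarith [Real.pi_pos]
    · linarith [Real.pi_pos, Complex.arg_le_pi w]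
  rw [cpow_def_of_ne_zero (by simp [hne]), cpow_def_of_ne_zero hne, hlog, ← exp_add]
  congr 1; ring

theorem I_mul_cpow {w : ℂ} (hw : w.im < 0 ∨ 0 < w.re) (hw' : w.im ≤ 0) (p : ℂ) :
    (I * w) ^ p = w ^ p * exp (I * Real.pi * p / 2) := by
  have hne : w ≠ 0 := by rintro rfl; simp at hw
  have harg0 : arg w ≤ 0 := by
    rcases hw'.lt_or_eq with h | h
    · exact (Complex.arg_neg_iff.2 h).le
    · have hre := hw.resolve_left (by rw [h]; exact lt_irrefl _)
      exact (Complex.arg_eq_zero_iff.2 ⟨hre.le, h⟩).le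
  have hlog : log (I * w) = Real.pi / 2 * I + log w := by
    rw [Complex.log_mul I_ne_zero hne, Complex.log_I]
    rw [Complex.arg_I]
    constructor
    · linarith [Real.pi_pos, Complex.neg_pi_lt_arg w]
    · linarith [Real.pi_pos]
  rw [cpow_def_of_ne_zero (by simp [hne]), cpow_def_of_ne_zero hne, hlog, ← exp_add]
  congr 1; ring

theorem continuousOn_rotated_integrand {κ : ℂ} (z p : ℂ) (hp : 0 < p.re) :
    ContinuousOn (fun w : ℂ => exp (-w ^ 2 / 2 + z * w) * (κ * w) ^ p) {w | 0 ≤ (κ * w).re} := by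
  refine ContinuousOn.mul (by fun_prop) fun w hw => ContinuousAt.continuousWithinAt ?_
  exact ContinuousAt.comp (f := fun w => κ * w) (Complex.continuousAt_cpow_const_of_re_pos
    (Or.inl hw) hp) (by fun_prop)

theorem differentiableOn_rotated_integrand {κ : ℂ} (z p : ℂ) :
    DifferentiableOn ℂ (fun w : ℂ => exp (-w ^ 2 / 2 + z * w) * (κ * w) ^ p)
      {w | 0 < (κ * w).re} := by
  refine DifferentiableOn.mul (by fun_prop) fun w hw =>
    DifferentiableAt.differentiableWithinAt ?_
  exact (differentiableAt_id.const_mul κ).cpow_const (Or.inl hw)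

/-- The contour collapses onto the two sides of the cut. -/
theorem hankelIntegral_eq_of_one_lt_re {s : ℂ} (hs : 1 < s.re) (z : ℂ) :
    hankelIntegral (s - 1 / 2) z = 2 * I * sin (Real.pi * s) * laplaceGauss s z := by
  set p := s - 1 with hp
  have hpre : 0 < p.re := by simp [hp, hs]
  set e : ℂ → ℂ := fun w => exp (-w ^ 2 / 2 + z * w) with he
  set q := exp (I * Real.pi * p / 2) with hq
  have hq0 : q ≠ 0 := exp_ne_zero _
  have hqi : exp (-(I * Real.pi * p / 2)) = q⁻¹ := exp_neg _
  set f : ℂ → ℂ := fun w => e w * w ^ p with hf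
  have hI1 : ‖-I‖ = 1 := by simp
  obtain ⟨C₁, hC₁⟩ := norm_rotated_integrand_le hI1 z p hpre.le
  obtain ⟨C₂, hC₂⟩ := norm_rotated_integrand_le norm_I z p hpre.le
  have hcont1 := continuousOn_rotated_integrand (κ := -I) z p hpre
  have hcont2 := continuousOn_rotated_integrand (κ := I) z p hpre
  -- Upper half-strip, with the power rotated so as to be continuous down to the real axis; at 0
  -- this needs Re p > 0, hence Re s > 1.
  have hup := integral_halfStrip_eq_zero (g := fun w => e w * (-I * w) ^ p) (C := C₁)
    (hcont1.mono fun w hw => by simpa using hw.1)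
    ((differentiableOn_rotated_integrand z p).mono fun w hw => by simpa using hw.1)
    fun x y hx h0 h1 => by
      simpa using hC₁ (x + y * I) (by simpa [abs_of_nonneg h0] using h1) (by simpa using hx)
  -- Lower half-strip, translated by i so that the same lemma applies.
  have hlo := integral_halfStrip_eq_zero (g := fun w => e (w - I) * (I * (w - I)) ^ p) (C := C₂)
    (hcont2.comp (by fun_prop) fun w hw => by simpa using hw.2)
    ((differentiableOn_rotated_integrand (κ := I) z p).comp (by fun_prop)
      fun w hw => by simpa using hw.2)
    fun x y hx h0 h1 => by
      have := hC₂ (x + y * I - I) (by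
        simp only [sub_im, add_im, ofReal_im, mul_im, ofReal_re, I_im, I_re]
        rw [abs_le]; constructor <;> linarith) (by simpa using hx)
      simpa using this
  have u1 : ∀ t : ℝ, e (t + I) * (-I * (t + I)) ^ p = f (t + I) * q⁻¹ := fun t => by
    rw [neg_I_mul_cpow (Or.inl (by simp)) (by simp), hqi, hf]; ring
  have u2 : ∀ y ∈ Set.uIcc (0 : ℝ) 1, e (1 + y * I) * (-I * (1 + y * I)) ^ p =
      f (1 + y * I) * q⁻¹ := fun y hy => by
    rw [Set.uIcc_of_le zero_le_one] at hy
    rw [neg_I_mul_cpow (Or.inr (by simp)) (by simpa using hy.1), hqi, hf]; ring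
  have l1 : ∀ t : ℝ, e (t - I) * (I * (t - I)) ^ p = f (t - I) * q := fun t => by
    rw [I_mul_cpow (Or.inl (by simp)) (by simp), hf]; ring
  have l2 : ∀ y ∈ Set.uIcc (0 : ℝ) 1, e (1 + y * I - I) * (I * (1 + y * I - I)) ^ p =
      f (1 + (y - 1 : ℝ) * I) * q := fun y hy => by
    rw [Set.uIcc_of_le zero_le_one] at hy
    rw [I_mul_cpow (Or.inr (by simp)) (by simpa using hy.2), hf]
    push_cast
    simp only [sub_mul, one_mul, ← add_sub_assoc]
    ring
  simp only [u1] at hup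
  rw [intervalIntegral.integral_congr u2] at hup
  simp only [l1, add_sub_cancel_right] at hlo
  rw [intervalIntegral.integral_congr l2] at hlo
  rw [integral_mul_const, intervalIntegral.integral_mul_const] at hup hlo
  rw [intervalIntegral.integral_comp_sub_right (fun y : ℝ => f (1 + y * I))] at hlo
  have hcut : (∫ t in Set.Iic (1 : ℝ), e t * (I * t) ^ p) * q⁻¹ -
      (∫ t in Set.Iic (1 : ℝ), e t * (-I * t) ^ p) * q = 2 * I * sin (Real.pi * s) *
        laplaceGauss s z := by
    have hi1 : IntegrableOn (fun t : ℝ => e t * (-I * t) ^ p) (Set.Iic 1) := by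
      refine Integrable.mono' ((integrableOn_exp_Iic 1).const_mul C₁) ?_ ?_
      · exact (hcont1.comp_continuous (by fun_prop) fun x => by simp).aestronglyMeasurable
      · filter_upwards [ae_restrict_mem measurableSet_Iic] with x hx
        simpa using hC₁ x (by simp) hx
    have hi2 : IntegrableOn (fun t : ℝ => e t * (I * t) ^ p) (Set.Iic 1) := by
      refine Integrable.mono' ((integrableOn_exp_Iic 1).const_mul C₂) ?_ ?_
      · exact (hcont2.comp_continuous (by fun_prop) fun x => by simp).aestronglyMeasurable
      · filter_upwards [ae_restrict_mem measurableSet_Iic] with x hx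
        simpa using hC₂ x (by simp) hx
    have hi3 : IntegrableOn (fun t : ℝ => e t * (I * t) ^ p * q⁻¹ - e t * (-I * t) ^ p * q)
        (Set.Iic 1) := (hi2.mul_const _).sub (hi1.mul_const _)
    rw [← integral_mul_const, ← integral_mul_const, ← integral_sub (hi2.mul_const _)
      (hi1.mul_const _), ← Set.Iic_union_Ioc_eq_Iic (zero_le_one' ℝ),
      setIntegral_union (Set.Iic_disjoint_Ioc le_rfl) measurableSet_Ioc
        (hi3.mono_set (Set.Iic_subset_Iic.2 zero_le_one)) (hi3.mono_set Set.Ioc_subset_Iic_self)]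
    -- On (0, 1] the two boundary values coincide. On the negative axis they differ by the factor
    -- q⁻² - q² = e^{-iπp} - e^{iπp} = 2i sin πs, as p = s - 1.
    have hzero : ∫ t in Set.Ioc (0 : ℝ) 1, (e t * (I * t) ^ p * q⁻¹ - e t * (-I * t) ^ p * q) = 0 := by
      refine setIntegral_eq_zero_of_forall_eq_zero fun t ht => ?_
      rw [I_mul_cpow (Or.inr (by simpa using ht.1)) (by simp),
        neg_I_mul_cpow (Or.inr (by simpa using ht.1)) (by simp), hqi, ← hq]
      field_simp
      ring
    have hneg := integral_comp_neg_Ioi (0 : ℝ) (fun t : ℝ =>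
      e t * (I * t) ^ p * q⁻¹ - e t * (-I * t) ^ p * q)
    rw [neg_zero] at hneg
    rw [hzero, add_zero, laplaceGauss, ← hneg, ← integral_const_mul]
    refine setIntegral_congr_fun measurableSet_Ioi fun t ht => ?_
    have ht' : 0 < (t : ℂ).re := by simpa using ht
    have e1 : I * ((-t : ℝ) : ℂ) = -I * t := by push_cast; ring
    have e2 : -I * ((-t : ℝ) : ℂ) = I * t := by push_cast; ring
    simp only [e1, e2]
    rw [I_mul_cpow (Or.inr ht') (by simp), neg_I_mul_cpow (Or.inr ht') (by simp), hqi, ← hq]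
    have e3 : e ((-t : ℝ) : ℂ) = exp (-t ^ 2 / 2 - z * t) := by
      simp only [he]; congr 1; push_cast; ring
    have hsin : 2 * I * sin (Real.pi * s) = q⁻¹ * q⁻¹ - q * q := by
      have h1 : exp (-(Real.pi * s) * I) = - (q⁻¹ * q⁻¹) := by
        rw [← hqi, ← exp_add, show -(Real.pi * s) * I = -(I * Real.pi) + (-(I * Real.pi * p / 2) +
          -(I * Real.pi * p / 2)) by rw [hp]; ring, exp_add, Complex.exp_neg, exp_I_mul_pi]
        norm_num
      have h2 : exp (Real.pi * s * I) = - (q * q) := by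
        rw [hq, ← exp_add, show Real.pi * s * I = I * Real.pi + (I * Real.pi * p / 2 +
          I * Real.pi * p / 2) by rw [hp]; ring, exp_add, exp_I_mul_pi]
        norm_num
      rw [Complex.sin, h1, h2]
      linear_combination (q * q - q⁻¹ * q⁻¹) * I_sq
    rw [e3, hsin]
    ring
  have hadj : (∫ t in (-1 : ℝ)..1, f (1 + t * I) * I) =
      I * (∫ t in (-1 : ℝ)..0, f (1 + t * I)) + I * ∫ t in (0 : ℝ)..1, f (1 + t * I) := by
    have hcf : ∀ a b : ℝ, IntervalIntegrable (fun t : ℝ => f (1 + t * I)) volume a b := fun a b => by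
      refine Continuous.intervalIntegrable ?_ a b
      refine Continuous.mul (by fun_prop) (Continuous.cpow (by fun_prop) continuous_const fun t => ?_)
      simp [Complex.mem_slitPlane_iff]
    rw [intervalIntegral.integral_mul_const, mul_comm, ← mul_add,
      intervalIntegral.integral_add_adjacent_intervals (hcf _ _) (hcf _ _)]
  have hH : hankelIntegral (s - 1 / 2) z = (∫ t in Set.Iic (1 : ℝ), f (t - I)) +
      (∫ t in (-1 : ℝ)..1, f (1 + t * I) * I) - ∫ t in Set.Iic (1 : ℝ), f (t + I) := by
    simp only [hankelIntegral, hf, he, hp, show s - 1 / 2 - 1 / 2 = s - 1 by ring]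
  norm_num at hlo
  have hqq : q * q⁻¹ = 1 := mul_inv_cancel₀ hq0
  linear_combination q * hup + q⁻¹ * hlo + hcut - hankelIntegral (s - 1 / 2) z * hqq +
    q * q⁻¹ * (hH + hadj)

/-! ### Growth of the contour integral, and analyticity in the order -/

theorem integrable_exp_neg_mul_abs {b : ℝ} (hb : 0 < b) :
    Integrable fun t : ℝ => Real.exp (-(b * |t|)) := by
  rw [← integrableOn_univ, ← Set.Iic_union_Ioi (a := (0 : ℝ))]
  refine IntegrableOn.union ?_ ?_
  · refine (integrableOn_exp_mul_Iic hb 0).congr_fun (fun t ht => ?_) measurableSet_Iic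
    simp [abs_of_nonpos (show t ≤ 0 from ht)]
  · refine (integrableOn_exp_mul_Ioi (neg_lt_zero.2 hb) 0).congr_fun (fun t ht => ?_)
      measurableSet_Ioi
    simp [abs_of_pos (show 0 < t from ht)]

/-- The exponential growth rate in the real direction. -/
noncomputable def growth (x : ℝ) : ℝ := if 0 ≤ x then x else x ^ 2 / 2 + |x| / 5

/-- For x ≥ 0 use t ≤ 1, otherwise complete the square. Of the slack |t|/5, one half is reserved for
the power of w and the other half for integrability along the contour. -/
theorem quadratic_le_growth {t : ℝ} (ht : t ≤ 1) (x : ℝ) :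
    -t ^ 2 / 2 + x * t + |t| / 10 ≤ growth x + 1 / 50 - |t| / 10 := by
  have ht2 : |t| ^ 2 = t ^ 2 := sq_abs t
  unfold growth
  split_ifs with hx
  · nlinarith [sq_nonneg (|t| - 1 / 5), mul_nonneg hx (sub_nonneg.2 ht)]
  · have h1 : x * t ≤ |x| * |t| := (le_abs_self _).trans (abs_mul _ _).le
    have hx2 : |x| ^ 2 = x ^ 2 := sq_abs x
    nlinarith [sq_nonneg (|x| + 1 / 5 - |t|)]

theorem norm_laplaceGauss_integrand_le (s z : ℂ) {t : ℝ} (ht : 0 < t) :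
    ‖(t : ℂ) ^ (s - 1) * exp (-t ^ 2 / 2 - z * t)‖ ≤
      Real.exp (growth z.re + 1 / 50) * (t ^ (s.re - 1) * Real.exp (-(1 / 5) * t)) := by
  rw [norm_mul, Complex.norm_cpow_eq_rpow_re_of_pos ht, Complex.norm_exp, mul_left_comm,
    ← Real.exp_add]
  simp only [sub_re, one_re]
  refine mul_le_mul_of_nonneg_left (Real.exp_le_exp.2 ?_) (Real.rpow_nonneg ht.le _)
  have h := quadratic_le_growth (t := -t) (by linarith) z.re
  have h1 : (-(t : ℂ) ^ 2 / 2).re = -t ^ 2 / 2 := by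
    rw [show -(t : ℂ) ^ 2 / 2 = ((-t ^ 2 / 2 : ℝ) : ℂ) by push_cast; ring, ofReal_re]
  have h2 : (z * t).re = z.re * t := by simp
  rw [abs_neg, abs_of_pos ht] at h
  rw [h1, h2]
  linarith

theorem measurable_laplaceGauss_integrand (s z : ℂ) :
    Measurable fun t : ℝ => (t : ℂ) ^ (s - 1) * exp (-t ^ 2 / 2 - z * t) := by fun_prop

theorem differentiableOn_laplaceGauss (z : ℂ) :
    DifferentiableOn ℂ (fun s => laplaceGauss s z) {s | 0 < s.re} := by
  have hUo : IsOpen {s : ℂ | 0 < s.re} := isOpen_lt continuous_const Complex.continuous_re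
  refine differentiableOn_integral_of_locally_dominated hUo
    (fun s _ => (measurable_laplaceGauss_integrand s z).aestronglyMeasurable) ?_ ?_
  · filter_upwards [ae_restrict_mem measurableSet_Ioi] with t ht
    have : (t : ℂ) ≠ 0 := by exact_mod_cast (show (0 : ℝ) < t from ht).ne'
    refine DifferentiableOn.mul_const ?_ _
    intro s _
    exact ((differentiableAt_id.sub_const 1).const_cpow
      (Or.inl this)).differentiableWithinAt
  · intro s hs
    have hs' : 0 < s.re := hs
    have hint : ∀ σ : ℝ, 0 < σ → IntegrableOn
        (fun t : ℝ => t ^ (σ - 1) * Real.exp (-(1 / 5) * t)) (Set.Ioi 0) := fun σ hσ => by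
      simpa using integrableOn_cpow_mul_exp_neg (s := (σ : ℂ)) (by simpa using hσ)
        (by norm_num : (0 : ℝ) < 1 / 5)
    refine ⟨s.re / 2, by positivity, fun t => Real.exp (growth z.re + 1 / 50) *
      (t ^ (s.re / 2 - 1) * Real.exp (-(1 / 5) * t) + t ^ (s.re + s.re / 2 - 1) *
      Real.exp (-(1 / 5) * t)), ((hint _ (by positivity)).add
        (hint _ (by positivity))).const_mul _, ?_⟩
    filter_upwards [ae_restrict_mem measurableSet_Ioi] with t ht s' hs' _
    have ht' : (0 : ℝ) < t := ht
    refine (norm_laplaceGauss_integrand_le s' z ht').trans ?_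
    rw [← add_mul]
    have h := (Complex.abs_re_le_norm (s' - s))
    rw [Metric.mem_ball, dist_eq_norm] at hs'
    obtain ⟨h1, h2⟩ := abs_le.1 (h.trans hs'.le)
    rw [Complex.sub_re] at h1 h2
    gcongr
    have p1 : 0 ≤ t ^ (s.re / 2 - 1) := Real.rpow_nonneg ht'.le _
    have p2 : 0 ≤ t ^ (s.re + s.re / 2 - 1) := Real.rpow_nonneg ht'.le _
    rcases le_total t 1 with h | h
    · have := Real.rpow_le_rpow_of_exponent_ge ht' h (show s.re / 2 - 1 ≤ s'.re - 1 by linarith)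
      linarith
    · have := Real.rpow_le_rpow_of_exponent_le h
        (show s'.re - 1 ≤ s.re + s.re / 2 - 1 by linarith)
      linarith

/-- The integrand `e^{-w²/2 + zw} w^{s-1}` of the contour integral. -/
noncomputable def hankelIntegrand (s z w : ℂ) : ℂ := exp (-w ^ 2 / 2 + z * w) * w ^ (s - 1)

theorem hankelIntegral_eq (s z : ℂ) :
    hankelIntegral (s - 1 / 2) z = (∫ t in Set.Iic (1 : ℝ), hankelIntegrand s z (t - I)) +
      (∫ t in Set.Ioc (-1 : ℝ) 1, hankelIntegrand s z (1 + t * I) * I) -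
      ∫ t in Set.Iic (1 : ℝ), hankelIntegrand s z (t + I) := by
  rw [← intervalIntegral.integral_of_le (by norm_num)]
  simp only [hankelIntegral, hankelIntegrand, show s - 1 / 2 - 1 / 2 = s - 1 by ring]

theorem exists_norm_hankelIntegrand_le (N : ℝ) :
    ∃ K : ℝ, ∀ s : ℂ, ‖s‖ ≤ N → ∀ z w : ℂ, |w.im| ≤ 1 → w.re ≤ 1 → 1 ≤ ‖w‖ →
      ‖hankelIntegrand s z w‖ ≤
        Real.exp (K + |z.im| + growth z.re) * Real.exp (-(1 / 10 * |w.re|)) := by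
  -- This η makes w^{s-1} cost at most e^{‖w‖/10} up to a constant, uniformly for ‖s‖ ≤ N, which is
  -- the slack in `quadratic_le_growth`.
  set η : ℝ := 1 / (10 * (|N| + 1)) with hη
  have hN1 : 0 < |N| + 1 := by positivity
  have hηpos : 0 < η := by positivity
  have hNη : (|N| + 1) * η = 1 / 10 := by rw [hη]; field_simp
  refine ⟨1 / 2 + (|N| + 1) * (Real.pi + |Real.log 1| + |Real.log η|) + 1 / 10 + 1 / 50,
    fun s hs z w him hre hw => ?_⟩
  have h1 := norm_exp_quadratic_le z w him
  have h2 := norm_cpow_le one_pos hηpos hw (w := s - 1) (N := |N| + 1)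
    ((norm_sub_le _ _).trans (by rw [norm_one]; linarith [le_abs_self N]))
  rw [hNη] at h2
  rw [hankelIntegrand, norm_mul]
  refine (mul_le_mul h1 h2 (norm_nonneg _) (Real.exp_pos _).le).trans ?_
  rw [← Real.exp_add, ← Real.exp_add, Real.exp_le_exp]
  have h3 := quadratic_le_growth hre z.re
  have h4 := (Complex.norm_le_abs_re_add_abs_im w).trans (add_le_add_right him _)
  linarith

theorem differentiable_hankelIntegrand {w : ℂ} (hw : w ≠ 0) (z : ℂ) :
    Differentiable ℂ fun s => hankelIntegrand s z w := by
  intro s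
  exact ((differentiableAt_id.sub_const 1).const_cpow (Or.inl hw)).const_mul _

theorem one_le_norm_of_im {w : ℂ} (h : |w.im| = 1) : 1 ≤ ‖w‖ := h ▸ Complex.abs_im_le_norm w

theorem one_le_norm_of_re {w : ℂ} (h : w.re = 1) : 1 ≤ ‖w‖ :=
  (by rw [h, abs_one] : |w.re| = 1) ▸ Complex.abs_re_le_norm w

theorem integrableOn_exp_neg_abs (C : ℝ) (S : Set ℝ) :
    IntegrableOn (fun t : ℝ => C * Real.exp (-(1 / 10 * |t|))) S :=
  ((integrable_exp_neg_mul_abs (by norm_num : (0 : ℝ) < 1 / 10)).const_mul C).integrableOn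

/-- A set integral of the Hankel integrand over a piece of the contour is entire in the order. -/
theorem differentiable_hankel_piece {S : Set ℝ} (hS : MeasurableSet S) {γ : ℝ → ℂ} {B : ℝ → ℝ}
    (hγ : Measurable γ) (hB : ∀ C : ℝ, IntegrableOn (fun t => C * B t) S)
    (him : ∀ t ∈ S, |(γ t).im| ≤ 1) (hre : ∀ t ∈ S, (γ t).re ≤ 1) (hn : ∀ t ∈ S, 1 ≤ ‖γ t‖)
    (hle : ∀ t ∈ S, Real.exp (-(1 / 10 * |(γ t).re|)) ≤ B t) (z : ℂ) :
    Differentiable ℂ fun s => ∫ t in S, hankelIntegrand s z (γ t) := by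
  rw [← differentiableOn_univ]
  refine differentiableOn_integral_of_locally_dominated isOpen_univ (fun s _ => ?_) ?_ ?_
  · refine Measurable.aestronglyMeasurable ?_
    simp only [hankelIntegrand]
    fun_prop
  · filter_upwards [ae_restrict_mem hS] with t ht
    exact (differentiable_hankelIntegrand
      (norm_pos_iff.1 (one_pos.trans_le (hn t ht))) z).differentiableOn
  · intro s _
    obtain ⟨K, hK⟩ := exists_norm_hankelIntegrand_le (‖s‖ + 1)
    refine ⟨1, one_pos, _, hB (Real.exp (K + |z.im| + growth z.re)), ?_⟩
    filter_upwards [ae_restrict_mem hS] with t ht s' hs' _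
    have := norm_sub_norm_le s' s
    rw [Metric.mem_ball, dist_eq_norm] at hs'
    exact (hK s' (by linarith) z _ (him t ht) (hre t ht) (hn t ht)).trans
      (mul_le_mul_of_nonneg_left (hle t ht) (Real.exp_pos _).le)

theorem integrableOn_const_Ioc (C : ℝ) :
    IntegrableOn (fun _ : ℝ => C * 1) (Set.Ioc (-1) 1) := by
  simp [integrableOn_const_iff]

theorem differentiable_hankelIntegral (z : ℂ) :
    Differentiable ℂ fun s => hankelIntegral (s - 1 / 2) z := by
  simp only [hankelIntegral_eq]
  simp only [integral_mul_const]
  refine ((differentiable_hankel_piece measurableSet_Iic (by fun_prop)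
    (fun C => integrableOn_exp_neg_abs C _) ?_ ?_ ?_ ?_ z).add
    ((differentiable_hankel_piece measurableSet_Ioc (by fun_prop) integrableOn_const_Ioc
      ?_ ?_ ?_ ?_ z).mul_const I)).sub
    (differentiable_hankel_piece measurableSet_Iic (by fun_prop)
    (fun C => integrableOn_exp_neg_abs C _) ?_ ?_ ?_ ?_ z)
  · intro t _; simp
  · intro t ht; simpa using ht
  · intro t _; exact one_le_norm_of_im (by simp)
  · intro t _; simp
  · intro t ht
    have := abs_le.2 ⟨ht.1.le, ht.2⟩
    simpa using this
  · intro t _; simp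
  · intro t _; exact one_le_norm_of_re (by simp)
  · intro t _; exact Real.exp_le_one_iff.2 (neg_nonpos.2 (by positivity))
  · intro t _; simp
  · intro t ht; simpa using ht
  · intro t _; exact one_le_norm_of_im (by simp)
  · intro t _; simp

/-- Collapsing the contour needed Re s > 1 for continuity at 0; the identity theorem carries the
result to the half-plane where the Laplace integral converges. -/
theorem hankelIntegral_eq_laplaceGauss {s : ℂ} (hs : 0 < s.re) (z : ℂ) :
    hankelIntegral (s - 1 / 2) z = 2 * I * sin (Real.pi * s) * laplaceGauss s z := by
  set U : Set ℂ := {s | 0 < s.re} with hU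
  have hUo : IsOpen U := isOpen_lt continuous_const Complex.continuous_re
  have h2 : DifferentiableOn ℂ (fun s => 2 * I * sin (Real.pi * s) * laplaceGauss s z) U :=
    DifferentiableOn.mul (by fun_prop) (differentiableOn_laplaceGauss z)
  refine ((differentiable_hankelIntegral z).differentiableOn.analyticOnNhd
    hUo).eqOn_of_preconnected_of_eventuallyEq (h2.analyticOnNhd hUo)
    (convex_halfSpace_re_gt 0).isPreconnected (z₀ := 2) (by simp [hU]) ?_ hs
  filter_upwards [(isOpen_lt continuous_const Complex.continuous_re).mem_nhds
    (show (1 : ℝ) < (2 : ℂ).re by norm_num)] with s' hs'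
  exact hankelIntegral_eq_of_one_lt_re hs' z

theorem norm_setIntegral_hankel_le {S : Set ℝ} (hS : MeasurableSet S) {γ : ℝ → ℂ} {B : ℝ → ℝ}
    {C : ℝ} (hB : IntegrableOn B S) {f : ℂ → ℂ} (hf : ∀ t ∈ S, ‖f (γ t)‖ ≤ C * B t) :
    ‖∫ t in S, f (γ t)‖ ≤ C * ∫ t in S, B t := by
  rw [← integral_const_mul]
  exact norm_integral_le_of_norm_le (hB.const_mul C) ((ae_restrict_mem hS).mono hf)

theorem exists_norm_hankelIntegral_le (N : ℝ) :
    ∃ C : ℝ, 0 ≤ C ∧ ∀ s : ℂ, ‖s‖ ≤ N → ∀ z : ℂ,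
      ‖hankelIntegral (s - 1 / 2) z‖ ≤ C * Real.exp (|z.im| + growth z.re) := by
  obtain ⟨K, hK⟩ := exists_norm_hankelIntegrand_le N
  set A := ∫ t in Set.Iic (1 : ℝ), Real.exp (-(1 / 10 * |t|)) with hA
  have hA0 : 0 ≤ A := integral_nonneg fun t => (Real.exp_pos _).le
  have hAi : IntegrableOn (fun t : ℝ => Real.exp (-(1 / 10 * |t|))) (Set.Iic 1) := by
    simpa using integrableOn_exp_neg_abs 1 (Set.Iic 1)
  refine ⟨Real.exp K * (A + 2 + A), by positivity, fun s hs z => ?_⟩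
  set E := Real.exp (K + |z.im| + growth z.re) with hE
  have b1 : ‖∫ t in Set.Iic (1 : ℝ), hankelIntegrand s z (t - I)‖ ≤ E * A := by
    refine norm_setIntegral_hankel_le (f := hankelIntegrand s z) (γ := fun t => t - I)
      measurableSet_Iic hAi fun t ht => ?_
    simpa using hK s hs z (t - I) (by simp) (by simpa using ht) (one_le_norm_of_im (by simp))
  have b3 : ‖∫ t in Set.Iic (1 : ℝ), hankelIntegrand s z (t + I)‖ ≤ E * A := by
    refine norm_setIntegral_hankel_le (f := hankelIntegrand s z) (γ := fun t => t + I)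
      measurableSet_Iic hAi fun t ht => ?_
    simpa using hK s hs z (t + I) (by simp) (by simpa using ht) (one_le_norm_of_im (by simp))
  have b2 : ‖∫ t in Set.Ioc (-1 : ℝ) 1, hankelIntegrand s z (1 + t * I) * I‖ ≤ E * 2 := by
    rw [integral_mul_const, norm_mul, norm_I, mul_one]
    have := norm_setIntegral_hankel_le (f := hankelIntegrand s z) (γ := fun t : ℝ => 1 + t * I)
      (B := fun _ => 1) (C := E) measurableSet_Ioc (by simp)
      fun t ht => by
        refine (hK s hs z (1 + t * I) (by simpa using abs_le.2 ⟨ht.1.le, ht.2⟩) (by simp)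
          (one_le_norm_of_re (by simp))).trans (mul_le_mul_of_nonneg_left ?_ (Real.exp_pos _).le)
        exact Real.exp_le_one_iff.2 (neg_nonpos.2 (by positivity))
    refine this.trans (le_of_eq ?_)
    norm_num
  rw [hankelIntegral_eq]
  refine (norm_sub_le _ _).trans ((add_le_add ((norm_add_le _ _).trans (add_le_add b1 b2))
    b3).trans (le_of_eq ?_))
  rw [hE, add_assoc K, Real.exp_add]; ring

theorem norm_laplaceGauss_le {s : ℂ} (hs : 0 < s.re) (z : ℂ) :
    ‖laplaceGauss s z‖ ≤ Real.exp (growth z.re + 1 / 50) *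
      ∫ t in Set.Ioi (0 : ℝ), t ^ (s.re - 1) * Real.exp (-(1 / 5) * t) := by
  rw [← integral_const_mul]
  exact norm_integral_le_of_norm_le
    ((integrableOn_cpow_mul_exp_neg hs (by norm_num : (0 : ℝ) < 1 / 5)).const_mul _)
    ((ae_restrict_mem measurableSet_Ioi).mono fun t ht => norm_laplaceGauss_integrand_le s z ht)

theorem measurable_laplaceGauss (s : ℂ) : Measurable fun z => laplaceGauss s z := by
  have h : Measurable fun p : ℂ × ℝ => (p.2 : ℂ) ^ (s - 1) * exp (-p.2 ^ 2 / 2 - p.1 * p.2) := by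
    fun_prop
  exact h.stronglyMeasurable.integral_prod_right'.measurable

theorem measurable_hankelIntegral (s : ℂ) : Measurable fun z => hankelIntegral (s - 1 / 2) z := by
  simp only [hankelIntegral_eq]
  have h1 : Measurable fun p : ℂ × ℝ => hankelIntegrand s p.1 (p.2 - I) := by
    simp only [hankelIntegrand]; fun_prop
  have h2 : Measurable fun p : ℂ × ℝ => hankelIntegrand s p.1 (1 + p.2 * I) * I := by
    simp only [hankelIntegrand]; fun_prop
  have h3 : Measurable fun p : ℂ × ℝ => hankelIntegrand s p.1 (p.2 + I) := by
    simp only [hankelIntegrand]; fun_prop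
  exact (h1.stronglyMeasurable.integral_prod_right'.measurable.add
    h2.stronglyMeasurable.integral_prod_right'.measurable).sub
    h3.stronglyMeasurable.integral_prod_right'.measurable

/-! ### The parabolic cylinder function -/

/-- The reflection formula replaces Γ(1 - s) sin πs by π / Γ(s), which removes the indeterminacy at
positive integers. -/
theorem parabolicUContour_eq_laplaceGauss {s : ℂ} (hs : 0 < s.re) (hsin : sin (Real.pi * s) ≠ 0)
    (z : ℂ) : parabolicUContour (s - 1 / 2) z =
      exp (-z ^ 2 / 4) * ((Gamma s)⁻¹ * laplaceGauss s z) := by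
  rw [parabolicUContour, hankelIntegral_eq_laplaceGauss hs, show 1 / 2 - (s - 1 / 2) = 1 - s by ring]
  have hpi : (Real.pi : ℂ) ≠ 0 := by exact_mod_cast Real.pi_ne_zero
  have hG := Complex.Gamma_ne_zero_of_re_pos hs
  have h := Complex.Gamma_mul_Gamma_one_sub s
  rw [eq_div_iff hsin] at h
  have hI := I_ne_zero
  field_simp
  rw [mul_comm (Real.pi : ℂ) s] at h
  linear_combination laplaceGauss s z * h

theorem sin_pi_mul_ne_zero {s : ℂ} (h : ∀ n : ℤ, s ≠ n) : sin (Real.pi * s) ≠ 0 := by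
  have hd : den s ≠ 0 := by
    rw [Ne, den_eq_zero_iff]; rintro ⟨n, hn⟩; exact h n hn
  rw [den_eq] at hd
  exact right_ne_zero_of_mul hd

/-- At a positive integer s, U is a limit in the order; the right side is continuous there and
equals the contour formula at nearby orders, since no other integer lies within distance 1. -/
theorem parabolicU_eq_laplaceGauss {s : ℂ} (hs : 0 < s.re) (z : ℂ) :
    parabolicU (s - 1 / 2) z = exp (-z ^ 2 / 4) * ((Gamma s)⁻¹ * laplaceGauss s z) := by
  rw [parabolicU]
  split_ifs with h
  · obtain ⟨n, hn⟩ := h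
    have hsn : s = ((n + 1 : ℤ) : ℂ) := by push_cast; linear_combination hn
    refine Tendsto.limUnder_eq ?_
    have hUo : IsOpen {s : ℂ | 0 < s.re} := isOpen_lt continuous_const Complex.continuous_re
    have hc : ContinuousAt (fun s => exp (-z ^ 2 / 4) * ((Gamma s)⁻¹ * laplaceGauss s z)) s :=
      ContinuousAt.mul continuousAt_const (ContinuousAt.mul
        (Complex.differentiable_one_div_Gamma s).continuousAt
        ((differentiableOn_laplaceGauss z).differentiableAt (hUo.mem_nhds hs)).continuousAt)
    have hadd : Tendsto (fun b : ℂ => b + 1 / 2) (𝓝[≠] (s - 1 / 2)) (𝓝 s) := by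
      have : Continuous fun b : ℂ => b + 1 / 2 := by fun_prop
      exact (this.tendsto' _ _ (by ring)).mono_left nhdsWithin_le_nhds
    refine (hc.tendsto.comp hadd).congr' ?_
    have hball := hadd.eventually (Metric.ball_mem_nhds s one_pos)
    filter_upwards [hball, hadd.eventually (hUo.mem_nhds hs), self_mem_nhdsWithin] with b hb hb' hne
    have hsin : sin (Real.pi * (b + 1 / 2)) ≠ 0 := by
      refine sin_pi_mul_ne_zero fun m hm => hne ?_
      rw [dist_eq_norm, hm, hsn, ← Int.cast_sub, Complex.norm_intCast] at hb
      have : m = n + 1 := by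
        have h1 : |m - (n + 1)| < 1 := by exact_mod_cast hb
        have := Int.abs_lt_one_iff.1 h1
        omega
      rw [Set.mem_singleton_iff, hsn, ← this, ← hm]; ring
    have := parabolicUContour_eq_laplaceGauss hb' hsin z
    rw [add_sub_cancel_right] at this
    simpa using this.symm
  · refine parabolicUContour_eq_laplaceGauss hs (sin_pi_mul_ne_zero fun n hn => h ?_) z
    have hpos : 0 < n := by rw [hn, intCast_re] at hs; exact_mod_cast hs
    obtain ⟨m, rfl⟩ := Int.eq_succ_of_zero_lt hpos
    refine ⟨m, ?_⟩
    rw [hn]; push_cast; ring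

/-- The exceptional orders correspond to s = 1, 2, 3, …. Together with `parabolicU_eq_laplaceGauss`
this covers the plane, with overlap 0 < Re s < 1. -/
theorem parabolicU_eq_contour {s : ℂ} (hs : s.re < 1) (z : ℂ) :
    parabolicU (s - 1 / 2) z = exp (-z ^ 2 / 4) *
      (Gamma (1 - s) / (2 * Real.pi * I) * hankelIntegral (s - 1 / 2) z) := by
  rw [parabolicU, if_neg, parabolicUContour, show 1 / 2 - (s - 1 / 2) = 1 - s by ring]
  · ring
  · rintro ⟨n, hn⟩
    have : s = ((n + 1 : ℝ) : ℂ) := by push_cast; linear_combination hn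
    rw [this, ofReal_re] at hs
    linarith [n.cast_nonneg (α := ℝ)]

/-! ### The integral over the parabolic cylinder function -/

/-- The unit vector `e^{-iπ/4}` of slope `-1`. -/
noncomputable def antidiag : ℂ := (starRingEnd ℂ) diag

theorem southEast_eq_antidiag : southEast = antidiag := southEast_eq

theorem diag_mul_antidiag : diag * antidiag = 1 := by
  rw [antidiag, Complex.mul_conj, Complex.normSq_eq_norm_sq, norm_diag]; norm_num

theorem antidiag_sq : antidiag ^ 2 = -I := by
  rw [antidiag, ← map_pow, diag_sq, Complex.conj_I]

theorem conj_antidiag : (starRingEnd ℂ) antidiag = diag := Complex.conj_conj _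

theorem antidiag_im : antidiag.im = -(Real.sqrt 2 / 2) := by
  rw [antidiag, Complex.conj_im, diag_im]

/-- The argument of the parabolic cylinder function at the point `u`. -/
noncomputable def cylArg (u : ℂ) : ℂ := (Real.sqrt (2 * Real.pi) : ℂ) * diag * u

theorem sqrt_two_pi_sq : (Real.sqrt (2 * Real.pi) : ℂ) ^ 2 = 2 * Real.pi := by
  rw [← Complex.ofReal_pow, Real.sq_sqrt (by positivity)]; push_cast; rfl

theorem cylArg_sq (u : ℂ) : cylArg u ^ 2 = 2 * Real.pi * I * u ^ 2 := by
  rw [cylArg, mul_pow, mul_pow, sqrt_two_pi_sq, diag_sq]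

theorem cylArg_line (b r : ℝ) : cylArg (b + r * antidiag) =
    Real.sqrt (2 * Real.pi) * (r + b * diag) := by
  rw [cylArg]
  linear_combination (Real.sqrt (2 * Real.pi) * r : ℂ) * diag_mul_antidiag

theorem cylArg_line_re (b r : ℝ) : (cylArg (b + r * antidiag)).re =
    Real.sqrt (2 * Real.pi) * (r + b * (Real.sqrt 2 / 2)) := by
  rw [cylArg_line]; simp [diag_re]

theorem cylArg_line_im (b r : ℝ) : (cylArg (b + r * antidiag)).im =
    Real.sqrt (2 * Real.pi) * (b * (Real.sqrt 2 / 2)) := by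
  rw [cylArg_line]; simp [diag_im]

theorem measurable_cylArg_line (b : ℝ) : Measurable fun r : ℝ => cylArg (b + r * antidiag) := by
  unfold cylArg; fun_prop

/-- The factor `e^{-iπu² + iπu} / (2i cos πu)` that multiplies `e^{z²/4} U(s - 1/2, z)`. -/
noncomputable def cylKernel (u : ℂ) : ℂ :=
  exp (-(I * Real.pi * u ^ 2) + I * Real.pi * u) / den (u + 1 / 2)

theorem den_add_half (u : ℂ) : den (u + 1 / 2) = 2 * I * cos (Real.pi * u) := by
  rw [den_eq, show (Real.pi : ℂ) * (u + 1 / 2) = Real.pi * u + Real.pi / 2 by ring,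
    Complex.sin_add_pi_div_two]

/-- With z = `cylArg u` one has e^{-z²/4} = e^{-iπu²/2}, so the Gaussian of the integrand is doubled
to e^{-iπu²}. -/
theorem cylinderIntegrand_eq {s u W : ℂ}
    (hW : parabolicU (s - 1 / 2) (cylArg u) = exp (-cylArg u ^ 2 / 4) * W) :
    cylinderIntegrand s u = cylKernel u * W := by
  have h : (Real.sqrt (2 * Real.pi) : ℂ) * exp (I * Real.pi / 4) * u = cylArg u := rfl
  rw [cylinderIntegrand, h, hW, cylKernel, den_add_half, div_mul_eq_mul_div, div_mul_eq_mul_div,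
    ← mul_assoc, ← exp_add, cylArg_sq]
  congr 3; ring

theorem measurable_cylKernel_line (b : ℝ) :
    Measurable fun r : ℝ => cylKernel (b + r * antidiag) := by
  have := continuous_den.measurable
  unfold cylKernel; fun_prop

/-- Here q, m, β stand for √(2π), π/√2 and b√2/2, and q(r + β) = x is the real part of the cylinder
argument. For x < 0 the x²/2 in `growth` cancels the Gaussian, and the decay comes from mr, which
dominates |x|/5. For x ≥ 0 and r ≥ 0 the constant 13 exceeds the maximum of -x²/2 + 4.3x + 3.3,
attained at x = 4.3. -/
theorem growth_exponent_le {q m β : ℝ} (hq : 1 ≤ q) (hq' : q ≤ 2.6) (hm : 2 ≤ m) (hm' : m ≤ 2.3)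
    (hβ : |β| ≤ 1) (r : ℝ) :
    -(q * (r + β)) ^ 2 / 2 + growth (q * (r + β)) + m * r ≤ 13 - |r| := by
  obtain ⟨hβ1, hβ2⟩ := abs_le.1 hβ
  set x := q * (r + β) with hx
  unfold growth
  split_ifs with h
  · have hrβ : 0 ≤ r + β := by
      by_contra! h'
      have : x < 0 := mul_neg_of_pos_of_neg (by linarith) h'
      linarith
    have hr : r + β ≤ x := le_mul_of_one_le_left hrβ hq
    rcases le_total 0 r with h0 | h0
    · rw [abs_of_nonneg h0]
      nlinarith [sq_nonneg (x - 4.3)]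
    · rw [abs_of_nonpos h0]
      nlinarith [sq_nonneg (x - 1)]
  · push Not at h
    have hrβ : r + β < 0 := by
      by_contra! h'
      have : 0 ≤ x := mul_nonneg (by linarith) h'
      linarith
    rw [abs_of_neg h]
    have hxl : -x ≤ 2.6 * -(r + β) := by rw [hx]; nlinarith
    rcases le_total 0 r with h0 | h0
    · rw [abs_of_nonneg h0]; nlinarith
    · rw [abs_of_nonpos h0]; nlinarith

theorem add_half_mem {b : ℝ} (hb : b ∈ Set.Ioo (-(1 / 2) : ℝ) (1 / 2)) :
    b + 1 / 2 ∈ Set.Ioo (0 : ℝ) 1 := ⟨by linarith [hb.1], by linarith [hb.2]⟩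

theorem conj_line (b r : ℝ) : (starRingEnd ℂ) (b + r * antidiag) = b + r * diag := by
  simp [conj_antidiag]

theorem exists_norm_cylKernel_le {b : ℝ} (hb : b ∈ Set.Ioo (-(1 / 2) : ℝ) (1 / 2)) :
    ∃ C : ℝ, 0 ≤ C ∧ ∀ r : ℝ, ‖cylKernel (b + r * antidiag)‖ *
      Real.exp (growth (cylArg (b + r * antidiag)).re) ≤ C * Real.exp (-(1 * |r|)) := by
  obtain ⟨C, hC, hden⟩ := exists_norm_inv_den_le (add_half_mem hb)
  set y := Real.sqrt (2 * Real.pi) * (b * (Real.sqrt 2 / 2)) with hy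
  refine ⟨C * Real.exp (y ^ 2 / 2 + 13), by positivity, fun r => ?_⟩
  set u : ℂ := b + r * antidiag with hu
  set x := (cylArg u).re with hx
  have hdenu : ‖(den (u + 1 / 2))⁻¹‖ ≤ C := by
    refine le_trans (le_of_eq ?_) (hden r)
    rw [norm_inv, norm_inv, ← Complex.norm_conj, conj_den, norm_neg, map_add, hu, conj_line]
    congr 3
    simp only [map_div₀, map_one, map_ofNat]
    push_cast; ring
  have hexp : ‖exp (-(I * Real.pi * u ^ 2) + I * Real.pi * u)‖ =
      Real.exp (-x ^ 2 / 2 + y ^ 2 / 2 + Real.pi * (Real.sqrt 2 / 2) * r) := by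
    rw [Complex.norm_exp]
    congr 1
    -- In the variable z = `cylArg u` the Gaussian is e^{-z²/2}, with Im z constant along the line.
    have h1 : -(I * Real.pi * u ^ 2) = ((-(1 / 2) : ℝ) : ℂ) * (cylArg u) ^ 2 := by
      rw [cylArg_sq]; push_cast; ring
    have h2 : (I * Real.pi * u).re = Real.pi * (Real.sqrt 2 / 2) * r := by
      simp [hu, antidiag_im]; ring
    have h3 : (cylArg u).im = y := by rw [hu, cylArg_line_im]
    rw [add_re, h1, h2, sq (cylArg u), re_ofReal_mul, mul_re, h3, ← hx]
    ring
  have hq1 : 1 ≤ Real.sqrt (2 * Real.pi) := by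
    rw [Real.one_le_sqrt]; linarith [Real.pi_gt_three]
  have hq2 : Real.sqrt (2 * Real.pi) ≤ 2.6 := by
    rw [Real.sqrt_le_left (by norm_num)]; linarith [Real.pi_lt_d2]
  have h2l : 1.4 ≤ Real.sqrt 2 := Real.le_sqrt_of_sq_le (by norm_num)
  have h2u : Real.sqrt 2 ≤ 1.42 := by rw [Real.sqrt_le_left (by norm_num)]; norm_num
  have hm1 : 2 ≤ Real.pi * (Real.sqrt 2 / 2) := by nlinarith [Real.pi_gt_three]
  have hm2 : Real.pi * (Real.sqrt 2 / 2) ≤ 2.3 := by nlinarith [Real.pi_lt_d2, Real.pi_gt_three]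
  have hβ : |b * (Real.sqrt 2 / 2)| ≤ 1 := by
    rw [abs_mul, abs_of_nonneg (by positivity : (0 : ℝ) ≤ Real.sqrt 2 / 2)]
    have := abs_lt.2 ⟨hb.1, hb.2⟩
    nlinarith [abs_nonneg b]
  have hg := growth_exponent_le hq1 hq2 hm1 hm2 hβ r
  rw [← cylArg_line_re, ← hu, ← hx] at hg
  rw [cylKernel, div_eq_mul_inv, norm_mul, hexp]
  calc _ ≤ Real.exp (-x ^ 2 / 2 + y ^ 2 / 2 + Real.pi * (Real.sqrt 2 / 2) * r) * C *
        Real.exp (growth x) := by gcongr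
    _ = C * Real.exp (y ^ 2 / 2 + (-x ^ 2 / 2 + growth x + Real.pi * (Real.sqrt 2 / 2) * r)) := by
        rw [mul_comm _ C, mul_assoc, ← Real.exp_add]; congr 2; ring
    _ ≤ C * Real.exp (y ^ 2 / 2 + (13 - |r|)) := by gcongr
    _ = _ := by rw [mul_assoc, ← Real.exp_add]; congr 2; ring

theorem cylinderIntegrand_of_re_pos {s : ℂ} (hs : 0 < s.re) (u : ℂ) :
    cylinderIntegrand s u = cylKernel u * ((Gamma s)⁻¹ * laplaceGauss s (cylArg u)) :=
  cylinderIntegrand_eq (parabolicU_eq_laplaceGauss hs _)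

theorem cylinderIntegrand_of_re_lt_one {s : ℂ} (hs : s.re < 1) (u : ℂ) :
    cylinderIntegrand s u = cylKernel u *
      (Gamma (1 - s) / (2 * Real.pi * I) * hankelIntegral (s - 1 / 2) (cylArg u)) :=
  cylinderIntegrand_eq (parabolicU_eq_contour hs _)

theorem norm_cylKernel_mul_le {b C K r : ℝ} {W : ℂ}
    (hC : ‖cylKernel (b + r * antidiag)‖ *
      Real.exp (growth (cylArg (b + r * antidiag)).re) ≤ C * Real.exp (-(1 * |r|))) (hK : 0 ≤ K)
    (hW : ‖W‖ ≤ K * Real.exp (growth (cylArg (b + r * antidiag)).re)) :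
    ‖cylKernel (b + r * antidiag) * W‖ ≤ K * C * Real.exp (-(1 * |r|)) := by
  rw [norm_mul]
  calc _ ≤ ‖cylKernel (b + r * antidiag)‖ *
        (K * Real.exp (growth (cylArg (b + r * antidiag)).re)) := by gcongr
    _ = K * (‖cylKernel (b + r * antidiag)‖ *
        Real.exp (growth (cylArg (b + r * antidiag)).re)) := by ring
    _ ≤ K * (C * Real.exp (-(1 * |r|))) := by gcongr
    _ = _ := by ring

theorem measurable_cylinderIntegrand_line (s : ℂ) (b : ℝ) :
    Measurable fun r : ℝ => cylinderIntegrand s (b + r * antidiag) := by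
  rcases lt_or_ge 0 s.re with hs | hs
  · simp only [cylinderIntegrand_of_re_pos hs]
    exact (measurable_cylKernel_line b).mul
      (((measurable_laplaceGauss s).comp (measurable_cylArg_line b)).const_mul _)
  · simp only [cylinderIntegrand_of_re_lt_one (show s.re < 1 by linarith)]
    exact (measurable_cylKernel_line b).mul
      (((measurable_hankelIntegral s).comp (measurable_cylArg_line b)).const_mul _)

theorem integrable_cylinderIntegrand_of_re_pos {s : ℂ} (hs : 0 < s.re) {b : ℝ}
    (hb : b ∈ Set.Ioo (-(1 / 2) : ℝ) (1 / 2)) :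
    Integrable fun r : ℝ => cylinderIntegrand s (b + r * antidiag) := by
  obtain ⟨C, hC, hker⟩ := exists_norm_cylKernel_le hb
  set A := ∫ t in Set.Ioi (0 : ℝ), t ^ (s.re - 1) * Real.exp (-(1 / 5) * t) with hA
  have hA0 : 0 ≤ A := setIntegral_nonneg measurableSet_Ioi fun t ht =>
    mul_nonneg (Real.rpow_nonneg (le_of_lt ht) _) (Real.exp_pos _).le
  refine ((integrable_exp_neg_mul_abs one_pos).const_mul
    (‖(Gamma s)⁻¹‖ * (Real.exp (1 / 50) * A) * C)).mono'
    (measurable_cylinderIntegrand_line s b).aestronglyMeasurable (Eventually.of_forall fun r => ?_)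
  rw [cylinderIntegrand_of_re_pos hs]
  refine norm_cylKernel_mul_le (hker r) (by positivity) ?_
  rw [norm_mul]
  refine (mul_le_mul_of_nonneg_left (norm_laplaceGauss_le hs _) (norm_nonneg _)).trans
    (le_of_eq ?_)
  rw [Real.exp_add]; ring

theorem exists_norm_cylinderIntegrand_le {b : ℝ} (hb : b ∈ Set.Ioo (-(1 / 2) : ℝ) (1 / 2))
    (N : ℝ) : ∃ C : ℝ, 0 ≤ C ∧ ∀ s : ℂ, s.re < 1 → ‖s‖ ≤ N → ∀ r : ℝ,
      ‖cylinderIntegrand s (b + r * antidiag)‖ ≤ ‖Gamma (1 - s)‖ * C * Real.exp (-(1 * |r|)) := by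
  obtain ⟨C, hC, hker⟩ := exists_norm_cylKernel_le hb
  obtain ⟨D, hD, hhank⟩ := exists_norm_hankelIntegral_le N
  set y := Real.sqrt (2 * Real.pi) * (b * (Real.sqrt 2 / 2)) with hy
  refine ⟨‖(2 * Real.pi * I : ℂ)⁻¹‖ * (D * Real.exp |y|) * C, by positivity,
    fun s hs hN r => ?_⟩
  rw [cylinderIntegrand_of_re_lt_one hs]
  refine (norm_cylKernel_mul_le (K := ‖Gamma (1 - s)‖ * (‖(2 * Real.pi * I : ℂ)⁻¹‖ *
    (D * Real.exp |y|))) (hker r) (by positivity) ?_).trans (le_of_eq (by ring))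
  rw [norm_mul, div_eq_mul_inv, norm_mul]
  refine (mul_le_mul_of_nonneg_left (hhank s hN _) (by positivity)).trans (le_of_eq ?_)
  rw [Real.exp_add, cylArg_line_im]; ring

theorem integrable_cylinderIntegrand (s : ℂ) {b : ℝ}
    (hb : b ∈ Set.Ioo (-(1 / 2) : ℝ) (1 / 2)) :
    Integrable fun r : ℝ => cylinderIntegrand s (b + r * antidiag) := by
  rcases lt_or_ge 0 s.re with hs | hs
  · exact integrable_cylinderIntegrand_of_re_pos hs hb
  · obtain ⟨C, -, h⟩ := exists_norm_cylinderIntegrand_le hb ‖s‖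
    exact ((integrable_exp_neg_mul_abs one_pos).const_mul _).mono'
      (measurable_cylinderIntegrand_line s b).aestronglyMeasurable
      (Eventually.of_forall fun r => h s (by linarith) le_rfl r)

theorem differentiableOn_integral_cylinderIntegrand {b : ℝ}
    (hb : b ∈ Set.Ioo (-(1 / 2) : ℝ) (1 / 2)) :
    DifferentiableOn ℂ (fun s => ∫ r : ℝ, cylinderIntegrand s (b + r * antidiag))
      {s | s.re < 1} := by
  have hUo : IsOpen {s : ℂ | s.re < 1} := isOpen_lt Complex.continuous_re continuous_const
  have hGd : ∀ s : ℂ, s.re < 1 → DifferentiableAt ℂ (fun s => Gamma (1 - s)) s := by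
    intro s hs
    refine (Complex.differentiableAt_Gamma _ fun m hm => ?_).comp s (by fun_prop)
    have := congrArg Complex.re hm
    simp at this
    linarith [m.cast_nonneg (α := ℝ)]
  refine differentiableOn_integral_of_locally_dominated hUo
    (fun s _ => (measurable_cylinderIntegrand_line s b).aestronglyMeasurable)
    (Eventually.of_forall fun r => ?_) fun s hs => ?_
  · refine DifferentiableOn.congr (f := fun s => cylKernel (b + r * antidiag) *
      (Gamma (1 - s) / (2 * Real.pi * I) *
        hankelIntegral (s - 1 / 2) (cylArg (b + r * antidiag)))) ?_
      fun s hs => cylinderIntegrand_of_re_lt_one hs _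
    refine DifferentiableOn.const_mul (DifferentiableOn.mul (DifferentiableOn.div_const ?_ _)
      (differentiable_hankelIntegral _).differentiableOn) _
    exact fun s hs => (hGd s hs).differentiableWithinAt
  · obtain ⟨C, hC, h⟩ := exists_norm_cylinderIntegrand_le hb (‖s‖ + 1)
    have hev : ∀ᶠ s' in 𝓝 s, ‖Gamma (1 - s')‖ < ‖Gamma (1 - s)‖ + 1 :=
      (hGd s hs).continuousAt.norm.eventually (gt_mem_nhds (lt_add_one _))
    obtain ⟨ε, hε, hball⟩ := Metric.eventually_nhds_iff_ball.1 hev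
    refine ⟨min ε 1, by positivity, fun r => (‖Gamma (1 - s)‖ + 1) * C * Real.exp (-(1 * |r|)),
      (integrable_exp_neg_mul_abs one_pos).const_mul _, Eventually.of_forall fun r s' hs' hU => ?_⟩
    have h1 := hball s' (Metric.ball_subset_ball (min_le_left _ _) hs')
    have h2 := Metric.ball_subset_ball (min_le_right _ _) hs'
    rw [Metric.mem_ball, dist_eq_norm] at h2
    have h3 := norm_sub_norm_le s' s
    exact (h s' hU (by linarith) r).trans (mul_le_mul_of_nonneg_right
      (mul_le_mul_of_nonneg_right h1.le hC) (Real.exp_pos _).le)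

/-! ### Comparison with Mordell's integral -/

/-- Conjugation turns slope -1 into slope 1, and the shift by 1/2 turns the cosine into a sine and
moves the crossing into (0, 1): the result is again a Mordell integrand. -/
theorem cylKernel_mul_exp (y u : ℂ) :
    cylKernel u * exp (2 * Real.pi * I * y * u) = -exp (-(3 * I * Real.pi / 4) - I * Real.pi * y) *
      (starRingEnd ℂ) (mordellIntegrand (-((starRingEnd ℂ) y + 1)) ((starRingEnd ℂ) (u + 1 / 2))) := by
  rw [cylKernel, mordellIntegrand, map_div₀, conj_den, Complex.conj_conj, ← Complex.exp_conj,
    div_mul_eq_mul_div, ← exp_add, div_neg, mul_neg, neg_mul, neg_neg, ← mul_div_assoc, ← exp_add]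
  congr 2
  simp only [map_add, map_mul, map_pow, map_neg, Complex.conj_I, Complex.conj_ofReal,
    Complex.conj_conj, map_ofNat, map_one, map_div₀]
  ring

theorem laplacePoint_im {τ : ℝ} (hτ : 0 < τ) : 0 < (laplacePoint τ).im := by
  have h : laplacePoint τ = ((τ / (2 * Real.pi) : ℝ) : ℂ) * (diag * I) := by
    rw [laplacePoint]; push_cast; ring
  rw [h, Complex.im_ofReal_mul]
  have : 0 < (diag * I).im := by simp [diag_re]
  have := Real.pi_pos
  positivity

theorem exp_laplacePoint_sq (τ : ℝ) :
    exp (-(I * Real.pi * laplacePoint τ ^ 2)) = exp (-(τ ^ 2 / (4 * Real.pi))) := by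
  have hpi : (Real.pi : ℂ) ≠ 0 := by exact_mod_cast Real.pi_ne_zero
  congr 1
  rw [laplacePoint, div_pow, mul_pow, mul_pow, diag_sq]
  field_simp
  linear_combination (4 * (τ : ℂ) ^ 2 * (1 - I ^ 2)) * I_sq

theorem cylArg_mul_eq (t : ℝ) (u : ℂ) :
    -(cylArg u * t) = 2 * Real.pi * I * laplacePoint (Real.sqrt (2 * Real.pi) * t) * u := by
  rw [two_pi_I_mul_laplacePoint, cylArg]; push_cast; ring

/-- Both integrals have closed forms. With p = e^{iπy} and g = e^{-iπy²} = e^{-t²/2} their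
numerators are p - p²g⁻¹ and p - g, and gp⁻¹(p - p²g⁻¹) = g - p; the Gaussian e^{-t²/2} coming from
U is what makes them match. -/
theorem exp_mul_integral_cylKernel {b c : ℝ} (hb : b ∈ Set.Ioo (-(1 / 2) : ℝ) (1 / 2))
    (hc : c ∈ Set.Ioo (0 : ℝ) 1) {t : ℝ} (ht : 0 < t) :
    exp (-(t : ℂ) ^ 2 / 2) * (∫ r : ℝ, cylKernel (b + r * antidiag) *
      exp (-(cylArg (b + r * antidiag) * t))) = -I * diag *
      ∫ r : ℝ, mordellIntegrand (laplacePoint (Real.sqrt (2 * Real.pi) * t)) (c + r * diag) := by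
  set τ := Real.sqrt (2 * Real.pi) * t with hτ
  have hτ0 : 0 < τ := mul_pos (by positivity) ht
  set y := laplacePoint τ with hy
  have hden : den y ≠ 0 := den_ne_zero_of_im (laplacePoint_im hτ0).ne'
  have hM := diag_mul_mordell hc y
  have hM' := congrArg (starRingEnd ℂ)
    (diag_mul_mordell (add_half_mem hb) (-((starRingEnd ℂ) y + 1)))
  set M := ∫ r : ℝ, mordellIntegrand y (c + r * diag)
  set M' := ∫ r : ℝ, mordellIntegrand (-((starRingEnd ℂ) y + 1)) ((b + 1 / 2 : ℝ) + r * diag)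
    with hM'def
  have hL : (∫ r : ℝ, cylKernel (b + r * antidiag) * exp (-(cylArg (b + r * antidiag) * t))) =
      -exp (-(3 * I * Real.pi / 4) - I * Real.pi * y) * (starRingEnd ℂ) M' := by
    rw [hM'def, ← integral_conj, ← integral_const_mul]
    congr 1; funext r
    have hl : (starRingEnd ℂ) (b + r * antidiag + 1 / 2) = ((b + 1 / 2 : ℝ) : ℂ) + r * diag := by
      rw [map_add, conj_line, map_div₀, map_one, map_ofNat]
      push_cast; ring
    rw [cylArg_mul_eq, cylKernel_mul_exp, hl]
  set p := exp (I * Real.pi * y) with hp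
  have hp0 : p ≠ 0 := exp_ne_zero _
  set g := exp (-(I * Real.pi * y ^ 2)) with hg
  have hg0 : g ≠ 0 := exp_ne_zero _
  have hgt : exp (-(t : ℂ) ^ 2 / 2) = g := by
    rw [hg, hy, exp_laplacePoint_sq, hτ]
    congr 1
    have hpi : (Real.pi : ℂ) ≠ 0 := by exact_mod_cast Real.pi_ne_zero
    push_cast
    rw [mul_pow, sqrt_two_pi_sq]
    field_simp; norm_num
  have hpe : exp (-(3 * I * Real.pi / 4) - I * Real.pi * y) = antidiag ^ 3 * p⁻¹ := by
    rw [sub_eq_add_neg, exp_add, exp_neg (I * Real.pi * y), antidiag, conj_diag, ← exp_nat_mul]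
    congr 2; push_cast; ring
  have hconj : antidiag * (starRingEnd ℂ) M' * (-den y) = -p + p * p * g⁻¹ := by
    have e1 : (starRingEnd ℂ) (den (-((starRingEnd ℂ) y + 1))) = -den y := by
      rw [conj_den, map_neg, map_add, Complex.conj_conj, map_one, den_neg, den_add_one]; ring
    have e2 : (starRingEnd ℂ) (exp (I * Real.pi * -((starRingEnd ℂ) y + 1))) = -p := by
      rw [← Complex.exp_conj, hp, show (starRingEnd ℂ) (I * Real.pi * -((starRingEnd ℂ) y + 1)) =
        I * Real.pi * y + I * Real.pi by simp; ring, exp_add, exp_I_mul_pi]; ring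
    have e3 : (starRingEnd ℂ) (exp (-(I * Real.pi * (-((starRingEnd ℂ) y + 1)) ^ 2))) =
        -(p * p * g⁻¹) := by
      rw [← Complex.exp_conj, hp, hg, ← exp_neg, show
        (starRingEnd ℂ) (-(I * Real.pi * (-((starRingEnd ℂ) y + 1)) ^ 2)) =
        I * Real.pi * y + I * Real.pi * y + - -(I * Real.pi * y ^ 2) + I * Real.pi by
          simp; ring, exp_add _ (I * Real.pi), exp_I_mul_pi, exp_add, exp_add]; ring
    rw [map_mul, map_mul, map_sub, e1, e2, e3] at hM'
    rw [antidiag, hM']; ring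
  rw [hL, hgt, hpe]
  refine mul_right_cancel₀ hden ?_
  have hM2 : diag * M * den y = p - g := hM
  have ha := antidiag_sq
  have h1 : antidiag * (starRingEnd ℂ) M' * den y = p - p * p * g⁻¹ := by
    linear_combination -hconj
  have h2 : g * (-(antidiag ^ 3 * p⁻¹) * (starRingEnd ℂ) M') * den y =
      -(g * antidiag ^ 2 * p⁻¹) * (antidiag * (starRingEnd ℂ) M' * den y) := by ring
  rw [h2, h1, ha]
  have h3 : -I * diag * M * den y = -I * (p - g) := by rw [← hM2]; ring
  rw [h3]
  field_simp
  ring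

theorem integral_cylinderIntegrand_of_re_pos {s : ℂ} (hs : 0 < s.re) {b c : ℝ}
    (hb : b ∈ Set.Ioo (-(1 / 2) : ℝ) (1 / 2)) (hc : c ∈ Set.Ioo (0 : ℝ) 1) :
    (∫ r : ℝ, cylinderIntegrand s (b + r * antidiag)) = (Gamma s)⁻¹ * (-I * diag) *
      ∫ t in Set.Ioi (0 : ℝ), (t : ℂ) ^ (s - 1) * ∫ r : ℝ,
        mordellIntegrand (laplacePoint (Real.sqrt (2 * Real.pi) * t)) (c + r * diag) := by
  obtain ⟨C, hC, hker⟩ := exists_norm_cylKernel_le hb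
  set F : ℝ → ℝ → ℂ := fun r t => cylKernel (b + r * antidiag) *
    ((t : ℂ) ^ (s - 1) * exp (-t ^ 2 / 2 - cylArg (b + r * antidiag) * t)) with hF
  have hint : Integrable (Function.uncurry F)
      (volume.prod (volume.restrict (Set.Ioi (0 : ℝ)))) := by
    have hp : Integrable (fun p : ℝ × ℝ => (C * Real.exp (-(1 * |p.1|))) *
        (Real.exp (1 / 50) * (p.2 ^ (s.re - 1) * Real.exp (-(1 / 5) * p.2))))
        (volume.prod (volume.restrict (Set.Ioi (0 : ℝ)))) :=
      Integrable.mul_prod (f := fun r : ℝ => C * Real.exp (-(1 * |r|)))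
        (g := fun t : ℝ => Real.exp (1 / 50) * (t ^ (s.re - 1) * Real.exp (-(1 / 5) * t)))
        ((integrable_exp_neg_mul_abs one_pos).const_mul C)
        ((integrableOn_cpow_mul_exp_neg hs (by norm_num : (0 : ℝ) < 1 / 5)).const_mul _)
    refine hp.mono' ?_ ?_
    · have hm : Measurable fun p : ℝ × ℝ => cylKernel (b + p.1 * antidiag) *
          ((p.2 : ℂ) ^ (s - 1) * exp (-p.2 ^ 2 / 2 - cylArg (b + p.1 * antidiag) * p.2)) := by
        refine ((measurable_cylKernel_line b).comp measurable_fst).mul (Measurable.mul ?_ ?_)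
        · fun_prop
        · unfold cylArg; fun_prop
      exact hm.aestronglyMeasurable
    · have hae : ∀ᵐ p : ℝ × ℝ ∂(volume.prod (volume.restrict (Set.Ioi (0 : ℝ)))), 0 < p.2 :=
        Measure.quasiMeasurePreserving_snd.ae (ae_restrict_mem measurableSet_Ioi)
      filter_upwards [hae] with p hp
      simp only [Function.uncurry, hF]
      have h1 := norm_laplaceGauss_integrand_le s (cylArg (b + p.1 * antidiag)) hp
      have hnn : 0 ≤ p.2 ^ (s.re - 1) * Real.exp (-(1 / 5) * p.2) :=
        mul_nonneg (Real.rpow_nonneg hp.le _) (Real.exp_pos _).le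
      refine (norm_cylKernel_mul_le (K := Real.exp (1 / 50) * (p.2 ^ (s.re - 1) *
        Real.exp (-(1 / 5) * p.2))) (hker p.1) (by positivity) ?_).trans (le_of_eq (by ring))
      refine h1.trans (le_of_eq ?_)
      rw [Real.exp_add]; ring
  calc _ = ∫ r : ℝ, (Gamma s)⁻¹ * ∫ t in Set.Ioi (0 : ℝ), F r t := by
        congr 1; funext r
        rw [cylinderIntegrand_of_re_pos hs, laplaceGauss, mul_left_comm, ← integral_const_mul]
    _ = (Gamma s)⁻¹ * ∫ t in Set.Ioi (0 : ℝ), ∫ r : ℝ, F r t := by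
        rw [integral_const_mul, integral_integral_swap hint]
    _ = _ := by
        rw [mul_assoc, ← integral_const_mul (-I * diag)]
        congr 1
        refine setIntegral_congr_fun measurableSet_Ioi fun t ht => ?_
        rw [mul_left_comm, ← exp_mul_integral_cylKernel hb hc ht, ← mul_assoc,
          ← integral_const_mul]
        congr 1; funext r
        simp only [hF]
        rw [sub_eq_add_neg (-(t : ℂ) ^ 2 / 2), exp_add]; ring

/-- The two Mellin transforms differ by the substitution τ = √(2π) t, which produces the factor
(2π)^{s/2}. -/
theorem cylinder_identity_of_re_pos {s : ℂ} (hs : 0 < s.re) {b c : ℝ}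
    (hb : b ∈ Set.Ioo (-(1 / 2) : ℝ) (1 / 2)) (hc : c ∈ Set.Ioo (0 : ℝ) 1) :
    -I * diag * (∫ t : ℝ, rsIntegrand s (c + t * diag)) =
      exp (I * Real.pi * s / 4) * (2 * Real.pi) ^ (s / 2) *
        ∫ r : ℝ, cylinderIntegrand s (b + r * antidiag) := by
  have h1 := integral_rsIntegrand_mul_Gamma hs hc
  have h2 := integral_cylinderIntegrand_of_re_pos hs hb hc
  have hG := Complex.Gamma_ne_zero_of_re_pos hs
  set q := Real.sqrt (2 * Real.pi) with hq
  have hq0 : 0 < q := by positivity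
  have hsub := MeasureTheory.integral_comp_mul_left_Ioi (fun τ : ℝ => (τ : ℂ) ^ (s - 1) *
    ∫ r : ℝ, mordellIntegrand (laplacePoint τ) (c + r * diag)) 0 hq0
  rw [mul_zero] at hsub
  have hqs : (q : ℂ) ^ s = (2 * Real.pi) ^ (s / 2) := by
    have : (2 * Real.pi : ℂ) = ((q ^ 2 : ℝ) : ℂ) := by
      rw [hq, Real.sq_sqrt (by positivity)]; push_cast; rfl
    have hqc : (q : ℂ) ≠ 0 := by exact_mod_cast hq0.ne'
    rw [this, cpow_def_of_ne_zero hqc, cpow_def_of_ne_zero (by exact_mod_cast (pow_pos hq0 2).ne'),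
      ← Complex.ofReal_log hq0.le, ← Complex.ofReal_log (sq_nonneg q), Real.log_pow]
    congr 1; push_cast; ring
  have h3 : (∫ t in Set.Ioi (0 : ℝ), ((q * t : ℝ) : ℂ) ^ (s - 1) *
      ∫ r : ℝ, mordellIntegrand (laplacePoint (q * t)) (c + r * diag)) =
      (q : ℂ) ^ (s - 1) * ∫ t in Set.Ioi (0 : ℝ), (t : ℂ) ^ (s - 1) *
      ∫ r : ℝ, mordellIntegrand (laplacePoint (q * t)) (c + r * diag) := by
    rw [← integral_const_mul]
    refine setIntegral_congr_fun measurableSet_Ioi fun t ht => ?_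
    rw [Complex.ofReal_mul, Complex.mul_cpow_ofReal_nonneg hq0.le (le_of_lt ht), mul_assoc]
  rw [h3] at hsub
  set X := ∫ t in Set.Ioi (0 : ℝ), (t : ℂ) ^ (s - 1) *
      ∫ r : ℝ, mordellIntegrand (laplacePoint (q * t)) (c + r * diag)
  set Y := ∫ τ in Set.Ioi (0 : ℝ), (τ : ℂ) ^ (s - 1) *
    ∫ r : ℝ, mordellIntegrand (laplacePoint τ) (c + r * diag)
  have hqc : (q : ℂ) ≠ 0 := by exact_mod_cast hq0.ne'
  have h4 : Y = (q : ℂ) ^ s * X := by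
    rw [Complex.cpow_sub _ _ hqc, cpow_one, Complex.real_smul, Complex.ofReal_inv] at hsub
    field_simp at hsub
    exact hsub.symm
  rw [h2, ← hqs]
  refine mul_right_cancel₀ hG ?_
  rw [mul_assoc, h1, h4]
  field_simp

theorem cylinder_identity (s : ℂ) {b c : ℝ}
    (hb : b ∈ Set.Ioo (-(1 / 2) : ℝ) (1 / 2)) (hc : c ∈ Set.Ioo (0 : ℝ) 1) :
    -I * diag * (∫ t : ℝ, rsIntegrand s (c + t * diag)) =
      exp (I * Real.pi * s / 4) * (2 * Real.pi) ^ (s / 2) *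
        ∫ r : ℝ, cylinderIntegrand s (b + r * antidiag) := by
  rcases lt_or_ge 0 s.re with hs | hs
  · exact cylinder_identity_of_re_pos hs hb hc
  set U : Set ℂ := {s | s.re < 1} with hU
  have hUo : IsOpen U := isOpen_lt Complex.continuous_re continuous_const
  have h2pi : (2 * Real.pi : ℂ) ≠ 0 := by
    have := Real.pi_ne_zero
    exact mul_ne_zero two_ne_zero (by exact_mod_cast this)
  have h1 : DifferentiableOn ℂ (fun s => -I * diag * ∫ t : ℝ, rsIntegrand s (c + t * diag)) U :=
    ((differentiable_integral_rsIntegrand hc).const_mul _).differentiableOn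
  have h2 : DifferentiableOn ℂ (fun s => exp (I * Real.pi * s / 4) * (2 * Real.pi) ^ (s / 2) *
      ∫ r : ℝ, cylinderIntegrand s (b + r * antidiag)) U := by
    refine DifferentiableOn.mul (DifferentiableOn.mul (by fun_prop) ?_)
      (differentiableOn_integral_cylinderIntegrand hb)
    intro s _
    exact ((differentiableAt_id.div_const 2).const_cpow (Or.inl h2pi)).differentiableWithinAt
  -- The base point 1/2 lies in the overlap 0 < Re s < 1, where the identity is already known.
  refine (h1.analyticOnNhd hUo).eqOn_of_preconnected_of_eventuallyEq (h2.analyticOnNhd hUo)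
    (convex_halfSpace_re_lt 1).isPreconnected (z₀ := ((1 / 2 : ℝ) : ℂ)) ?_ ?_
    (show s.re < 1 by linarith)
  · rw [hU, Set.mem_ofPred_eq, Complex.ofReal_re]; norm_num
  · filter_upwards [(isOpen_lt continuous_const Complex.continuous_re).mem_nhds
      (show (0 : ℝ) < (((1 / 2 : ℝ) : ℂ)).re by rw [Complex.ofReal_re]; norm_num)] with s' hs'
    exact cylinder_identity_of_re_pos hs' hb hc

/-- The cylinder side of `cylinder_identity` does not involve c, so no further contour shift is
needed. -/
theorem integral_rsIntegrand_indep (s : ℂ) {c c' : ℝ} (hc : c ∈ Set.Ioo (0 : ℝ) 1)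
    (hc' : c' ∈ Set.Ioo (0 : ℝ) 1) :
    (∫ t : ℝ, rsIntegrand s (c + t * diag)) = ∫ t : ℝ, rsIntegrand s (c' + t * diag) := by
  have h0 : (0 : ℝ) ∈ Set.Ioo (-(1 / 2) : ℝ) (1 / 2) := by constructor <;> norm_num
  refine mul_left_cancel₀ (mul_ne_zero (neg_ne_zero.2 I_ne_zero) diag_ne_zero) ?_
  rw [cylinder_identity s h0 hc, cylinder_identity s h0 hc']

/-! ### Line integrals -/

theorem lineIntegral_southWest (c : ℝ) (f : ℂ → ℂ) :
    lineIntegral c southWest f = -diag * ∫ t : ℝ, f (c + t * diag) := by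
  rw [lineIntegral, southWest_eq, integral_mul_const, mul_comm,
    ← integral_neg_eq_self (fun t : ℝ => f (c + t * diag))]
  simp

theorem lineIntegral_southEast (c : ℝ) (f : ℂ → ℂ) :
    lineIntegral c southEast f = antidiag * ∫ t : ℝ, f (c + t * antidiag) := by
  rw [lineIntegral, southEast_eq_antidiag, integral_mul_const, mul_comm]

theorem lineIntegrable_southWest {c : ℝ} {f : ℂ → ℂ}
    (h : Integrable fun t : ℝ => f (c + t * diag)) : LineIntegrable c southWest f := by
  rw [LineIntegrable, southWest_eq]
  refine Integrable.mul_const ?_ _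
  simpa using h.comp_neg

theorem lineIntegrable_southEast {c : ℝ} {f : ℂ → ℂ}
    (h : Integrable fun t : ℝ => f (c + t * antidiag)) : LineIntegrable c southEast f := by
  rw [LineIntegrable, southEast_eq_antidiag]
  exact h.mul_const _

theorem exp_neg_I_mul_pi_mul (s : ℂ) :
    exp (-(I * Real.pi * (1 - s) / 4)) = antidiag * exp (I * Real.pi * s / 4) := by
  rw [antidiag, conj_diag, ← exp_add]; congr 1; ring

theorem two_pi_cpow (w : ℂ) : (2 * Real.pi : ℂ) ^ w = (2 : ℂ) ^ w * (Real.pi : ℂ) ^ w := by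
  have := Complex.mul_cpow_ofReal_nonneg (a := 2) (b := Real.pi) zero_le_two Real.pi_pos.le w
  simpa using this

/-- The identity between the two line integrals, with the gamma factor cancelled. -/
theorem rs_eq_cylinder (s : ℂ) {b c : ℝ}
    (hb : b ∈ Set.Ioo (-(1 / 2) : ℝ) (1 / 2)) (hc : c ∈ Set.Ioo (0 : ℝ) 1) :
    (Real.pi : ℂ) ^ (-s / 2) * lineIntegral c southWest (rsIntegrand s) =
      (2 : ℂ) ^ (s / 2) * exp (-(I * Real.pi * (1 - s) / 4)) *
        lineIntegral b southEast (cylinderIntegrand s) := by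
  have h := cylinder_identity s hb hc
  have hpi : (Real.pi : ℂ) ≠ 0 := by exact_mod_cast Real.pi_ne_zero
  have hpp : (Real.pi : ℂ) ^ (-s / 2) * (Real.pi : ℂ) ^ (s / 2) = 1 := by
    rw [← Complex.cpow_add _ _ hpi, neg_div, neg_add_cancel, cpow_zero]
  rw [lineIntegral_southWest, lineIntegral_southEast, exp_neg_I_mul_pi_mul]
  rw [two_pi_cpow] at h
  set R := ∫ t : ℝ, rsIntegrand s (c + t * diag)
  set Y := ∫ r : ℝ, cylinderIntegrand s (b + r * antidiag)
  set E := exp (I * Real.pi * s / 4)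
  have ha := antidiag_sq
  linear_combination (-(Real.pi : ℂ) ^ (-s / 2) * I) * h -
    (Real.pi : ℂ) ^ (-s / 2) * diag * R * I_sq - I * E * (2 : ℂ) ^ (s / 2) * Y * hpp -
    (2 : ℂ) ^ (s / 2) * E * Y * ha

/-! ### Complex conjugation -/

theorem conj_cpow_of_mem_slitPlane {u : ℂ} (hu : u ∈ slitPlane) (w : ℂ) :
    (starRingEnd ℂ) (u ^ w) = ((starRingEnd ℂ) u) ^ ((starRingEnd ℂ) w) := by
  have harg : ((starRingEnd ℂ) u).arg ≠ Real.pi := by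
    rw [Complex.arg_conj, if_neg (Complex.slitPlane_arg_ne_pi hu)]
    intro h
    exact (Complex.neg_pi_lt_arg u).ne (by linarith)
  rw [Complex.cpow_conj _ _ harg, Complex.conj_conj]

theorem conj_ofReal_cpow {x : ℝ} (hx : 0 < x) (w : ℂ) :
    (starRingEnd ℂ) ((x : ℂ) ^ w) = (x : ℂ) ^ ((starRingEnd ℂ) w) := by
  rw [conj_cpow_of_mem_slitPlane (Complex.ofReal_mem_slitPlane.2 hx), Complex.conj_ofReal]

theorem rsIntegrandDual_conj (s : ℂ) {u : ℂ} (hu : u ∈ slitPlane) :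
    rsIntegrandDual s ((starRingEnd ℂ) u) =
      -(starRingEnd ℂ) (rsIntegrand (1 - (starRingEnd ℂ) s) u) := by
  rw [rsIntegrand_eq, map_div₀, map_mul, conj_den, conj_cpow_of_mem_slitPlane hu, ← exp_conj,
    div_neg, neg_neg]
  simp only [map_mul, map_pow, map_neg, map_sub, map_one, conj_I, conj_ofReal, conj_conj]
  rw [rsIntegrandDual, den]
  congr 3 <;> ring

theorem conj_line' (c t : ℝ) : (starRingEnd ℂ) (c + t * diag) = c + t * antidiag := by
  simp [antidiag]

theorem rsIntegrandDual_line (s : ℂ) {c : ℝ} (hc : 0 < c) (t : ℝ) :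
    rsIntegrandDual s (c + t * antidiag) =
      -(starRingEnd ℂ) (rsIntegrand (1 - (starRingEnd ℂ) s) (c + t * diag)) := by
  rw [← conj_line', rsIntegrandDual_conj s (line_mem_slitPlane hc t)]

theorem integrable_rsIntegrandDual (s : ℂ) {c : ℝ} (hc : c ∈ Set.Ioo (0 : ℝ) 1) :
    Integrable fun t : ℝ => rsIntegrandDual s (c + t * antidiag) := by
  simp only [rsIntegrandDual_line s hc.1]
  exact (Complex.conjLIE.toContinuousLinearEquiv.toContinuousLinearMap.integrable_comp
    (integrable_rsIntegrand hc (1 - (starRingEnd ℂ) s))).neg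

/-- Conjugation changes the sign of the denominator, and it carries ↙ to the reverse of ↘; the two
signs cancel. -/
theorem lineIntegral_rsIntegrandDual (s : ℂ) {c : ℝ} (hc : 0 < c) :
    lineIntegral c southEast (rsIntegrandDual s) =
      (starRingEnd ℂ) (lineIntegral c southWest (rsIntegrand (1 - (starRingEnd ℂ) s))) := by
  rw [lineIntegral_southEast, lineIntegral_southWest, map_mul, map_neg, ← integral_conj]
  simp only [rsIntegrandDual_line s hc]
  rw [integral_neg, antidiag]; ring

theorem conj_laplaceGauss (s z : ℂ) : (starRingEnd ℂ) (laplaceGauss s z) =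
    laplaceGauss ((starRingEnd ℂ) s) ((starRingEnd ℂ) z) := by
  rw [laplaceGauss, ← integral_conj, laplaceGauss]
  refine setIntegral_congr_fun measurableSet_Ioi fun t ht => ?_
  simp only [map_mul, conj_ofReal_cpow ht, ← exp_conj]
  simp [map_div₀, map_ofNat]

theorem conj_hankelIntegrand (s z : ℂ) {w : ℂ} (hw : w ∈ slitPlane) :
    (starRingEnd ℂ) (hankelIntegrand s z w) =
      hankelIntegrand ((starRingEnd ℂ) s) ((starRingEnd ℂ) z) ((starRingEnd ℂ) w) := by
  rw [hankelIntegrand, map_mul, conj_cpow_of_mem_slitPlane hw, ← exp_conj, hankelIntegrand]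
  simp [map_div₀, map_ofNat]

/-- The contour is symmetric about the real axis, but reflection reverses its orientation; in U the
sign is cancelled by conjugating 2πi. -/
theorem conj_hankelIntegral (s z : ℂ) : (starRingEnd ℂ) (hankelIntegral (s - 1 / 2) z) =
    -hankelIntegral ((starRingEnd ℂ) s - 1 / 2) ((starRingEnd ℂ) z) := by
  rw [hankelIntegral_eq, hankelIntegral_eq, map_sub, map_add, ← integral_conj, ← integral_conj,
    ← integral_conj]
  have h1 : ∀ t : ℝ, (starRingEnd ℂ) (hankelIntegrand s z (t - I)) =
      hankelIntegrand ((starRingEnd ℂ) s) ((starRingEnd ℂ) z) (t + I) := fun t => by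
    rw [conj_hankelIntegrand _ _ (by simp [mem_slitPlane_iff])]; simp
  have h2 : ∀ t : ℝ, (starRingEnd ℂ) (hankelIntegrand s z (t + I)) =
      hankelIntegrand ((starRingEnd ℂ) s) ((starRingEnd ℂ) z) (t - I) := fun t => by
    rw [conj_hankelIntegrand _ _ (by simp [mem_slitPlane_iff])]; simp [sub_eq_add_neg]
  have h3 : ∀ t : ℝ, (starRingEnd ℂ) (hankelIntegrand s z (1 + t * I) * I) =
      -(hankelIntegrand ((starRingEnd ℂ) s) ((starRingEnd ℂ) z) (1 + (-t : ℝ) * I) * I) := fun t => by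
    rw [map_mul, conj_hankelIntegrand _ _ (by simp [mem_slitPlane_iff])]; simp
  simp only [h1, h2, h3]
  rw [integral_neg, ← intervalIntegral.integral_of_le (by norm_num),
    ← intervalIntegral.integral_of_le (by norm_num), intervalIntegral.integral_comp_neg (fun t : ℝ =>
      hankelIntegrand ((starRingEnd ℂ) s) ((starRingEnd ℂ) z) (1 + t * I) * I), neg_neg]
  ring

theorem conj_parabolicU (s z : ℂ) : (starRingEnd ℂ) (parabolicU (s - 1 / 2) z) =
    parabolicU ((starRingEnd ℂ) s - 1 / 2) ((starRingEnd ℂ) z) := by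
  have hexp : (starRingEnd ℂ) (exp (-z ^ 2 / 4)) = exp (-(starRingEnd ℂ) z ^ 2 / 4) := by
    rw [← exp_conj]; simp [map_div₀, map_ofNat]
  rcases lt_or_ge 0 s.re with hs | hs
  · rw [parabolicU_eq_laplaceGauss hs, parabolicU_eq_laplaceGauss (by simpa using hs)]
    simp only [map_mul, map_inv₀, hexp, Complex.Gamma_conj, conj_laplaceGauss]
  · have hs1 : s.re < 1 := by linarith
    rw [parabolicU_eq_contour hs1, parabolicU_eq_contour (by simpa using hs1)]
    simp only [map_mul, map_div₀, hexp, conj_hankelIntegral, ← Complex.Gamma_conj, map_sub, map_one,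
      conj_I, conj_ofReal, map_ofNat]
    ring

theorem cylinderIntegrandDual_line (s : ℂ) (b r : ℝ) :
    cylinderIntegrandDual s (b + r * diag) =
      -(starRingEnd ℂ) (cylinderIntegrand (1 - (starRingEnd ℂ) s) (b + r * antidiag)) := by
  rw [← conj_line]
  set u : ℂ := b + r * antidiag
  rw [cylinderIntegrandDual, cylinderIntegrand, map_mul, conj_parabolicU, map_div₀, ← exp_conj]
  simp only [map_mul, map_pow, map_neg, map_sub, map_add, map_one, map_div₀, conj_I, conj_ofReal,
    conj_conj, map_ofNat, ← Complex.cos_conj, ← exp_conj]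
  rw [show (1 : ℂ) - s - 1 / 2 = 1 / 2 - s by ring,
    show (2 : ℂ) * -I * cos (Real.pi * (starRingEnd ℂ) u) =
      -(2 * I * cos (Real.pi * (starRingEnd ℂ) u)) by ring, div_neg, neg_mul, neg_neg]
  congr 3
  · ring
  · congr 3; ring

theorem integrable_cylinderIntegrandDual (s : ℂ) {b : ℝ}
    (hb : b ∈ Set.Ioo (-(1 / 2) : ℝ) (1 / 2)) :
    Integrable fun r : ℝ => cylinderIntegrandDual s (b + r * diag) := by
  simp only [cylinderIntegrandDual_line]
  exact (Complex.conjLIE.toContinuousLinearEquiv.toContinuousLinearMap.integrable_comp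
    (integrable_cylinderIntegrand (1 - (starRingEnd ℂ) s) hb)).neg

theorem lineIntegral_cylinderIntegrandDual (s : ℂ) (b : ℝ) :
    lineIntegral b southWest (cylinderIntegrandDual s) =
      (starRingEnd ℂ) (lineIntegral b southEast (cylinderIntegrand (1 - (starRingEnd ℂ) s))) := by
  rw [lineIntegral_southEast, lineIntegral_southWest, map_mul, conj_antidiag, ← integral_conj]
  simp only [cylinderIntegrandDual_line]
  rw [integral_neg]; ring

theorem conj_pi_cpow (s : ℂ) : (starRingEnd ℂ) ((Real.pi : ℂ) ^ (-(1 - (starRingEnd ℂ) s) / 2)) =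
    (Real.pi : ℂ) ^ (-(1 - s) / 2) := by
  rw [conj_ofReal_cpow Real.pi_pos]; simp [map_div₀, map_ofNat]

theorem rs_eq_cylinder_dual (s : ℂ) {b c : ℝ}
    (hb : b ∈ Set.Ioo (-(1 / 2) : ℝ) (1 / 2)) (hc : c ∈ Set.Ioo (0 : ℝ) 1) :
    (Real.pi : ℂ) ^ (-(1 - s) / 2) * lineIntegral c southEast (rsIntegrandDual s) =
      (2 : ℂ) ^ ((1 - s) / 2) * exp (I * Real.pi * s / 4) *
        lineIntegral b southWest (cylinderIntegrandDual s) := by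
  have h := congrArg (starRingEnd ℂ) (rs_eq_cylinder (1 - (starRingEnd ℂ) s) hb hc)
  have h2 : (starRingEnd ℂ) ((2 : ℂ) ^ ((1 - (starRingEnd ℂ) s) / 2)) = (2 : ℂ) ^ ((1 - s) / 2) := by
    have := conj_ofReal_cpow two_pos ((1 - (starRingEnd ℂ) s) / 2)
    simpa [map_div₀, map_ofNat] using this
  have h3 : (starRingEnd ℂ) (exp (-(I * Real.pi * (1 - (1 - (starRingEnd ℂ) s)) / 4))) =
      exp (I * Real.pi * s / 4) := by
    rw [← exp_conj]
    congr 1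
    simp [map_div₀, neg_div, map_ofNat]
  rw [map_mul, map_mul, map_mul, conj_pi_cpow, h2, h3, ← lineIntegral_rsIntegrandDual s hc.1,
    ← lineIntegral_cylinderIntegrandDual] at h
  exact h

/-! ### The line through the origin -/

theorem deriv_den_zero : deriv den 0 ≠ 0 := by
  have h0 : HasDerivAt (fun u : ℂ => I * Real.pi * u) (I * Real.pi) 0 := by
    simpa using (hasDerivAt_id (0 : ℂ)).const_mul (I * Real.pi)
  have h : HasDerivAt den (exp (I * Real.pi * 0) * (I * Real.pi) -
      exp (-(I * Real.pi * 0)) * (-(I * Real.pi))) 0 := h0.cexp.sub h0.neg.cexp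
  have hpi : (Real.pi : ℂ) ≠ 0 := by exact_mod_cast Real.pi_ne_zero
  rw [h.deriv, mul_zero, neg_zero, exp_zero,
    show 1 * (I * (Real.pi : ℂ)) - 1 * -(I * Real.pi) = 2 * (I * Real.pi) by ring]
  simp

/-- The zero of `den` at 0 is simple, so u / `den u` is bounded near it. The threshold 3 = 2(1 +
1/2) is where `abs_im_add_mul_diag` takes over for all c ≤ 1/2. -/
theorem exists_norm_div_den_le : ∃ M : ℝ, 0 ≤ M ∧ ∀ c ∈ Set.Icc (0 : ℝ) (1 / 2), ∀ t : ℝ,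
    ‖(c + t * diag : ℂ) / den (c + t * diag)‖ ≤ M * Real.exp |t| := by
  have hden0 : den 0 = 0 := den_eq_zero_iff.2 ⟨0, by simp⟩
  have hne : ∀ p ∈ Set.Icc (0 : ℝ) (1 / 2) ×ˢ Set.Icc (-3 : ℝ) 3,
      dslope den 0 (p.1 + p.2 * diag) ≠ 0 := by
    rintro ⟨c, t⟩ ⟨hc, -⟩
    rcases eq_or_ne (c + t * diag : ℂ) 0 with h | h
    · simp only [h, dslope_same]; exact deriv_den_zero
    · simp only [dslope_of_ne _ h, slope_def_field, hden0, sub_zero]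
      refine div_ne_zero ?_ h
      rw [Ne, den_eq_zero_iff]
      rintro ⟨n, hn⟩
      have hcr : crossing (c + t * diag) = c := by rw [crossing_add_mul_diag, crossing_ofReal]
      rw [hn] at hcr
      simp only [crossing, intCast_re, intCast_im, sub_zero] at hcr
      have h0 : (0 : ℝ) ≤ n := by rw [hcr]; exact hc.1
      have h1 : (n : ℝ) < 1 := by rw [hcr]; linarith [hc.2]
      have : n = 0 := by
        have h0' : 0 ≤ n := by exact_mod_cast h0
        have h1' : n < 1 := by exact_mod_cast h1
        omega
      rw [this] at hn
      exact h (by simpa using hn)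
  have hcont : ContinuousOn (fun p : ℝ × ℝ => (dslope den 0 (p.1 + p.2 * diag))⁻¹)
      (Set.Icc (0 : ℝ) (1 / 2) ×ˢ Set.Icc (-3 : ℝ) 3) := by
    refine ContinuousOn.inv₀ (Continuous.continuousOn ?_) hne
    exact (differentiable_dslope differentiable_den 0).continuous.comp (by fun_prop)
  obtain ⟨M, hM⟩ := (isCompact_Icc.prod isCompact_Icc).exists_bound_of_continuousOn hcont
  refine ⟨max M 1, by positivity, fun c hc t => ?_⟩
  have hexp : |t| + 1 ≤ Real.exp |t| := Real.add_one_le_exp _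
  rcases le_total |t| 3 with ht | ht
  · rcases eq_or_ne (c + t * diag : ℂ) 0 with h | h
    · rw [h, zero_div, norm_zero]; positivity
    · have h1 := hM (c, t) ⟨hc, abs_le.1 ht⟩
      simp only [dslope_of_ne _ h, slope_def_field, hden0, sub_zero, inv_div] at h1
      calc _ ≤ M := h1
        _ ≤ max M 1 * 1 := by rw [mul_one]; exact le_max_left _ _
        _ ≤ _ := by gcongr; linarith [abs_nonneg t]
  · have hcn : ‖(c : ℂ)‖ ≤ 1 / 2 := by
      rw [Complex.norm_real, Real.norm_of_nonneg hc.1]; exact hc.2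
    have hd := one_le_norm_den (abs_im_add_mul_diag (a := c) (t := t) (by linarith))
    rw [norm_div]
    have hl := norm_line_le c t
    rw [abs_of_nonneg hc.1] at hl
    calc _ ≤ ‖(c + t * diag : ℂ)‖ := div_le_self (norm_nonneg _) hd
      _ ≤ 1 * Real.exp |t| := by linarith [hc.2]
      _ ≤ _ := by gcongr; exact le_max_right _ _

/-- Writing u^{-s} / `den u` as u^{-s-1} · (u / `den u`) with Re(-s - 1) > 0 removes the singularity
at 0, with a bound uniform as the line approaches the origin. -/
theorem exists_norm_rsIntegrand_near_zero_le {s : ℂ} (hs : s.re < -1) :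
    ∃ C : ℝ, ∀ c ∈ Set.Icc (0 : ℝ) (1 / 2), ∀ t : ℝ,
      ‖rsIntegrand s (c + t * diag)‖ ≤ C * Real.exp (-t ^ 2) := by
  obtain ⟨M, hM0, hM⟩ := exists_norm_div_den_le
  set p := -s - 1 with hp
  have hpre : 0 < p.re := by simp [hp]; linarith
  refine ⟨M * Real.exp ((Real.pi / 4 + Real.pi * |p.im|) + (Real.pi + p.re + 1) ^ 2 / 4),
    fun c hc t => ?_⟩
  set u : ℂ := c + t * diag with hu
  have hcn : ‖(c : ℂ)‖ ≤ 1 / 2 := by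
    rw [Complex.norm_real, Real.norm_of_nonneg hc.1]; exact hc.2
  have h1 : ‖exp (I * Real.pi * u ^ 2)‖ ≤ Real.exp (Real.pi / 4 + Real.pi * |t| - Real.pi * t ^ 2) := by
    refine (norm_exp_gaussian_le c t).trans (Real.exp_le_exp.2 ?_)
    have hpi := Real.pi_pos
    have e1 : ‖(c : ℂ)‖ ^ 2 ≤ 1 / 4 := by nlinarith [norm_nonneg (c : ℂ)]
    have e2 : 2 * Real.pi * ‖(c : ℂ)‖ * |t| ≤ 2 * Real.pi * (1 / 2) * |t| := by gcongr
    nlinarith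
  have h2 : ‖u ^ p‖ ≤ Real.exp (Real.pi * |p.im| + p.re * |t|) := by
    refine (Complex.norm_cpow_le _ _).trans ?_
    rw [div_eq_mul_inv, ← Real.exp_neg, add_comm (Real.pi * |p.im|), Real.exp_add]
    refine mul_le_mul ?_ ?_ (Real.exp_pos _).le (Real.exp_pos _).le
    · have hn : ‖u‖ ≤ Real.exp |t| := by
        have hl := norm_line_le c t
        rw [abs_of_nonneg hc.1] at hl
        linarith [Real.add_one_le_exp |t|, hc.2]
      refine (Real.rpow_le_rpow (norm_nonneg _) hn hpre.le).trans (le_of_eq ?_)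
      rw [← Real.exp_mul, mul_comm]
    · rw [Real.exp_le_exp]
      refine (neg_le_abs _).trans ?_
      rw [abs_mul]
      exact mul_le_mul_of_nonneg_right (Complex.abs_arg_le_pi _) (abs_nonneg _)
  -- At u = 0 both sides are 0, because division by zero gives 0.
  have h3 : rsIntegrand s u = exp (I * Real.pi * u ^ 2) * u ^ p * (u / den u) := by
    rcases eq_or_ne u 0 with h | h
    · have hden0 : den 0 = 0 := den_eq_zero_iff.2 ⟨0, by simp⟩
      rw [rsIntegrand_eq, h, hden0]; simp
    · rw [rsIntegrand_eq, show -s = p + 1 by rw [hp]; ring, cpow_add _ _ h, cpow_one]; ring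
  rw [h3, norm_mul, norm_mul]
  calc _ ≤ Real.exp (Real.pi / 4 + Real.pi * |t| - Real.pi * t ^ 2) *
        Real.exp (Real.pi * |p.im| + p.re * |t|) * (M * Real.exp |t|) := by
        gcongr
        exact hM c hc t
    _ = M * Real.exp ((Real.pi / 4 + Real.pi * |p.im|) + (Real.pi + p.re + 1) * |t| -
        Real.pi * t ^ 2) := by
        rw [← Real.exp_add, mul_left_comm, ← Real.exp_add]; congr 2; ring
    _ ≤ _ := by
        rw [mul_assoc M (Real.exp _)]
        exact mul_le_mul_of_nonneg_left (exp_quadratic_le _ _ _) hM0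

theorem measurable_rsIntegrand_line (s : ℂ) (c : ℝ) :
    Measurable fun t : ℝ => rsIntegrand s (c + t * diag) := by
  have := continuous_den.measurable
  simp only [rsIntegrand_eq]; fun_prop

theorem integrable_rsIntegrand_zero {s : ℂ} (hs : s.re < -1) :
    Integrable fun t : ℝ => rsIntegrand s (t * diag) := by
  obtain ⟨C, hC⟩ := exists_norm_rsIntegrand_near_zero_le hs
  have h := (integrable_const_mul_exp_neg_sq C).mono'
    (measurable_rsIntegrand_line s 0).aestronglyMeasurable
    (Eventually.of_forall fun t => hC 0 (by simp) t)
  simpa using h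

/-- Dominated convergence along the crossings 1/(n + 2), whose integrals all coincide by
`integral_rsIntegrand_indep`. -/
theorem integral_rsIntegrand_eq_zero_line {s : ℂ} (hs : s.re < -1) {c : ℝ}
    (hc : c ∈ Set.Ioo (0 : ℝ) 1) :
    (∫ t : ℝ, rsIntegrand s (c + t * diag)) = ∫ t : ℝ, rsIntegrand s (t * diag) := by
  obtain ⟨C, hC⟩ := exists_norm_rsIntegrand_near_zero_le hs
  set cn : ℕ → ℝ := fun n => 1 / (n + 2 : ℝ) with hcn
  have hcn0 : ∀ n, 0 < cn n := fun n => by simp only [hcn]; positivity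
  have hcn1 : ∀ n, cn n ≤ 1 / 2 := fun n => by
    simp only [hcn]
    exact one_div_le_one_div_of_le two_pos (by linarith [n.cast_nonneg (α := ℝ)])
  have hlim : Tendsto cn atTop (𝓝 0) := by
    have := (tendsto_add_atTop_iff_nat 2).2 (tendsto_one_div_atTop_nhds_zero_nat (𝕜 := ℝ))
    simpa [hcn] using this
  have htend : Tendsto (fun n => ∫ t : ℝ, rsIntegrand s (cn n + t * diag)) atTop
      (𝓝 (∫ t : ℝ, rsIntegrand s (t * diag))) := by
    refine tendsto_integral_of_dominated_convergence _
      (fun n => (measurable_rsIntegrand_line s (cn n)).aestronglyMeasurable)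
      (integrable_const_mul_exp_neg_sq C)
      (fun n => Eventually.of_forall fun t => hC _ ⟨(hcn0 n).le, hcn1 n⟩ t) ?_
    have hne : ∀ᵐ t : ℝ, t ≠ 0 := by simp [ae_iff, measure_singleton]
    filter_upwards [hne] with t ht
    have him : (t * diag).im ≠ 0 := by simp [diag_im, ht]
    have hcont : ContinuousAt (rsIntegrand s) (t * diag) := by
      have h1 : ContinuousAt (fun u : ℂ => u ^ (-s)) (t * diag) :=
        continuousAt_id.cpow continuousAt_const (mem_slitPlane_iff.2 (Or.inr him))
      exact ((by fun_prop : Continuous fun u : ℂ => exp (I * Real.pi * u ^ 2)).continuousAt.mul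
        h1).div continuous_den.continuousAt (den_ne_zero_of_im him)
    refine hcont.tendsto.comp ?_
    have : Tendsto (fun n => ((cn n : ℝ) : ℂ) + t * diag) atTop (𝓝 (((0 : ℝ) : ℂ) + t * diag)) :=
      ((Complex.continuous_ofReal.tendsto 0).comp hlim).add_const _
    simpa using this
  refine tendsto_nhds_unique (tendsto_const_nhds.congr fun n => ?_) htend
  exact integral_rsIntegrand_indep s hc ⟨hcn0 n, by linarith [hcn1 n]⟩

/-- The half-line integral `∫_0^∞ t^{-s} e^{-πt²} / (e^{iπtω} - e^{-iπtω}) dt`, `ω = e^{iπ/4}`. -/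
noncomputable def halfLine (s : ℂ) : ℂ :=
  ∫ t in Set.Ioi (0 : ℝ), (t : ℂ) ^ (-s) * exp (-(Real.pi * t ^ 2)) / den (t * diag)

theorem log_diag : log diag = I * Real.pi / 4 := by
  rw [diag, Complex.log_exp]
  · simp; linarith [Real.pi_pos]
  · simp; linarith [Real.pi_pos]

/-- On the lower ray the principal argument is -3π/4 and not 5π/4; this is the source of e^{3iπs/4}.
-/
theorem log_neg_diag : log (-diag) = -(3 * I * Real.pi / 4) := by
  have : -diag = exp (-(3 * I * Real.pi / 4)) := by
    rw [show -(3 * I * Real.pi / 4) = I * Real.pi / 4 + -(I * Real.pi) by ring, exp_add,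
      Complex.exp_neg (I * Real.pi), exp_I_mul_pi, diag]
    norm_num
  rw [this, Complex.log_exp]
  · simp; linarith [Real.pi_pos]
  · simp; linarith [Real.pi_pos]

theorem mul_cpow_of_log {t : ℝ} (ht : 0 < t) {v : ℂ} (hv : v ≠ 0) (w : ℂ) :
    (t * v) ^ w = (t : ℂ) ^ w * exp (log v * w) := by
  have ht0 : (t : ℂ) ≠ 0 := by exact_mod_cast ht.ne'
  rw [cpow_def_of_ne_zero (mul_ne_zero ht0 hv), Complex.log_ofReal_mul ht hv,
    cpow_def_of_ne_zero ht0, Complex.ofReal_log ht.le, ← exp_add]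
  congr 1; ring

theorem rsIntegrand_ray (s : ℂ) {t : ℝ} (ht : 0 < t) :
    rsIntegrand s (t * diag) = exp (-(I * Real.pi * s / 4)) *
      ((t : ℂ) ^ (-s) * exp (-(Real.pi * t ^ 2)) / den (t * diag)) := by
  rw [rsIntegrand_eq, mul_cpow_of_log ht diag_ne_zero, log_diag, mul_pow, diag_sq,
    show I * Real.pi * (t ^ 2 * I) = -(Real.pi * (t : ℂ) ^ 2) by
      linear_combination (Real.pi * (t : ℂ) ^ 2) * I_sq,
    show I * Real.pi / 4 * -s = -(I * Real.pi * s / 4) by ring]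
  ring

theorem rsIntegrand_neg_ray (s : ℂ) {t : ℝ} (ht : 0 < t) :
    rsIntegrand s ((-t : ℝ) * diag) = -exp (3 * I * Real.pi * s / 4) *
      ((t : ℂ) ^ (-s) * exp (-(Real.pi * t ^ 2)) / den (t * diag)) := by
  rw [show ((-t : ℝ) : ℂ) * diag = t * -diag by push_cast; ring, rsIntegrand_eq,
    mul_cpow_of_log ht (neg_ne_zero.2 diag_ne_zero), log_neg_diag, mul_pow, neg_sq, diag_sq,
    show I * Real.pi * (t ^ 2 * I) = -(Real.pi * (t : ℂ) ^ 2) by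
      linear_combination (Real.pi * (t : ℂ) ^ 2) * I_sq,
    show -(3 * I * Real.pi / 4) * -s = 3 * I * Real.pi * s / 4 by ring, mul_neg, den_neg]
  ring

theorem integrableOn_halfLine {s : ℂ} (hs : s.re < -1) :
    IntegrableOn (fun t : ℝ => (t : ℂ) ^ (-s) * exp (-(Real.pi * t ^ 2)) / den (t * diag))
      (Set.Ioi 0) := by
  have h := ((integrable_rsIntegrand_zero hs).integrableOn (s := Set.Ioi 0)).const_mul
    (exp (I * Real.pi * s / 4))
  refine IntegrableOn.congr_fun h (fun t ht => ?_) measurableSet_Ioi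
  rw [rsIntegrand_ray s ht, ← mul_assoc, ← exp_add, add_neg_cancel, exp_zero, one_mul]

theorem integral_rsIntegrand_eq_halfLine {s : ℂ} (hs : s.re < -1) {c : ℝ}
    (hc : c ∈ Set.Ioo (0 : ℝ) 1) :
    (∫ t : ℝ, rsIntegrand s (c + t * diag)) =
      (exp (-(I * Real.pi * s / 4)) - exp (3 * I * Real.pi * s / 4)) * halfLine s := by
  have hint := integrable_rsIntegrand_zero hs
  rw [integral_rsIntegrand_eq_zero_line hs hc, ← intervalIntegral.integral_Iic_add_Ioi
    (b := 0) hint.integrableOn hint.integrableOn]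
  have hneg := integral_comp_neg_Ioi (0 : ℝ) (fun t : ℝ => rsIntegrand s (t * diag))
  rw [neg_zero] at hneg
  rw [← hneg, setIntegral_congr_fun measurableSet_Ioi fun t ht => rsIntegrand_neg_ray s ht,
    setIntegral_congr_fun measurableSet_Ioi fun t ht => rsIntegrand_ray s ht,
    integral_const_mul, integral_const_mul, halfLine]
  ring

/-! ### The zeta function -/

/-- Termwise Laplace integrals, as in the classical formula for Γ(s) ζ(s); the rotation contributes
`diag` to the power -s, that is, e^{-iπs/4}. -/
theorem integral_zeta_series {s : ℂ} (hs : 1 < s.re) :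
    ∫ τ in Set.Ioi (0 : ℝ), ∑' n : ℕ, (τ : ℂ) ^ (s - 1) * exp (-((n + 1 : ℝ) * diag * τ)) =
      exp (-(I * Real.pi * s / 4)) * (Gamma s * riemannZeta s) := by
  have hs0 : 0 < s.re := by linarith
  have hre : ∀ n : ℕ, (((n + 1 : ℝ) : ℂ) * diag).re = (n + 1) * (Real.sqrt 2 / 2) := fun n => by
    rw [Complex.re_ofReal_mul, diag_re]
  have hpos : ∀ n : ℕ, 0 < (n + 1 : ℝ) * (Real.sqrt 2 / 2) := fun n => by positivity
  have hnorm : ∀ n : ℕ, (∫ τ in Set.Ioi (0 : ℝ),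
      ‖(τ : ℂ) ^ (s - 1) * exp (-((n + 1 : ℝ) * diag * τ))‖) =
      (1 / ((n + 1 : ℕ) : ℝ) ^ s.re) * ((1 / (Real.sqrt 2 / 2)) ^ s.re * Real.Gamma s.re) := by
    intro n
    rw [setIntegral_congr_fun measurableSet_Ioi fun τ hτ => norm_cpow_mul_exp_neg hτ]
    simp only [hre, neg_mul]
    rw [Real.integral_rpow_mul_exp_neg_mul_Ioi hs0 (hpos n), ← one_div_mul_one_div,
      Real.mul_rpow (by positivity) (by positivity),
      Real.div_rpow (y := (n + 1 : ℝ)) zero_le_one (by positivity), Real.one_rpow]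
    push_cast
    ring
  have hsum := MeasureTheory.hasSum_integral_of_summable_integral_norm
    (μ := volume.restrict (Set.Ioi (0 : ℝ)))
    (F := fun (n : ℕ) (τ : ℝ) => (τ : ℂ) ^ (s - 1) * exp (-((n + 1 : ℝ) * diag * τ))) ?_ ?_
  · rw [← hsum.tsum_eq, zeta_eq_tsum_one_div_nat_add_one_cpow hs, ← tsum_mul_left, ← tsum_mul_left]
    congr 1; funext n
    rw [integral_cpow_mul_exp_neg_mul hs0 (by rw [hre]; exact hpos n),
      mul_cpow_of_log (by positivity) diag_ne_zero, log_diag, cpow_neg,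
      show I * Real.pi / 4 * -s = -(I * Real.pi * s / 4) by ring]
    push_cast
    ring
  · intro n
    refine Integrable.mono' (integrableOn_cpow_mul_exp_neg hs0 (hpos n))
      (Measurable.aestronglyMeasurable (by fun_prop)) ?_
    filter_upwards [ae_restrict_mem measurableSet_Ioi] with τ hτ
    rw [norm_cpow_mul_exp_neg hτ, hre]
  · simp only [hnorm]
    exact ((summable_nat_add_iff 1).2 (Real.summable_one_div_nat_rpow.2 hs)).mul_right _

/-- With p² = e^{-diag·τ}, of modulus less than 1, the first term of the closed form is -p/(p - p⁻¹)
= p²/(1 - p²), a geometric series. -/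
theorem neg_diag_mul_mordell {c : ℝ} (hc : c ∈ Set.Ioo (0 : ℝ) 1) {τ : ℝ} (hτ : 0 < τ) :
    -diag * (∫ t : ℝ, mordellIntegrand (laplacePoint τ) (c + t * diag)) =
      (∑' n : ℕ, exp (-((n + 1 : ℝ) * diag * τ))) +
        exp (-(τ ^ 2 / (4 * Real.pi))) / den (laplacePoint τ) := by
  have hM := diag_mul_mordell hc (laplacePoint τ)
  have hden : den (laplacePoint τ) ≠ 0 := den_ne_zero_of_im (laplacePoint_im hτ).ne'
  rw [exp_laplacePoint_sq] at hM
  set M := ∫ t : ℝ, mordellIntegrand (laplacePoint τ) (c + t * diag)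
  set p := exp (I * Real.pi * laplacePoint τ) with hp
  have hp0 : p ≠ 0 := exp_ne_zero _
  have hpp : exp (-(diag * τ)) = p * p := by
    rw [hp, ← exp_add]
    congr 1
    linear_combination -two_pi_I_mul_laplacePoint τ
  have hnorm : ‖exp (-(diag * τ))‖ < 1 := by
    rw [Complex.norm_exp, Real.exp_lt_one_iff, Complex.neg_re, Complex.re_mul_ofReal, diag_re]
    have : 0 < Real.sqrt 2 / 2 * τ := by positivity
    linarith
  have hgeom : (∑' n : ℕ, exp (-((n + 1 : ℝ) * diag * τ))) = p * p * (1 - p * p)⁻¹ := by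
    rw [← hpp, ← tsum_geometric_of_norm_lt_one hnorm, ← tsum_mul_left]
    congr 1; funext n
    rw [← exp_nat_mul, ← exp_add]
    congr 1; push_cast; ring
  have hden' : den (laplacePoint τ) = p - p⁻¹ := by rw [den, exp_neg]
  have h1 : 1 - p * p ≠ 0 := by
    rw [hden'] at hden
    intro h
    apply hden
    field_simp
    linear_combination -h
  rw [hgeom]
  refine mul_right_cancel₀ hden ?_
  rw [add_mul, div_mul_cancel₀ _ hden]
  have h2 : p * p * (1 - p * p)⁻¹ * den (laplacePoint τ) = -p := by
    have h3 : (1 - p * p)⁻¹ * (1 - p * p) = 1 := inv_mul_cancel₀ h1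
    have h4 : p * p⁻¹ = 1 := mul_inv_cancel₀ hp0
    rw [hden']
    linear_combination (-p) * h3 - p * (1 - p * p)⁻¹ * h4
  linear_combination -hM - h2

theorem laplacePoint_two_pi (r : ℝ) : laplacePoint (2 * Real.pi * r) = -(starRingEnd ℂ) (r * diag) := by
  have hpi : (Real.pi : ℂ) ≠ 0 := by exact_mod_cast Real.pi_ne_zero
  have hd : diag * I = -antidiag := by
    have h1 := diag_mul_antidiag
    have h2 := diag_sq
    have h3 := antidiag_sq
    have : diag * I * 1 = -antidiag * (I ^ 2 * -1) := by
      linear_combination (-diag * I) * h1 + antidiag * I * h2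
    rw [I_sq] at this
    linear_combination this
  rw [laplacePoint, map_mul, conj_ofReal]
  change _ = -(r * antidiag)
  push_cast
  field_simp
  linear_combination (r : ℂ) * hd

/-- The substitution τ = 2πr places `laplacePoint τ` at minus the conjugate of r · `diag`, so the
Gaussian term becomes the conjugated integrand of `halfLine` at 1 - s̄. -/
theorem gaussian_part_eq {s : ℂ} {r : ℝ} (hr : 0 < r) :
    ((2 * Real.pi * r : ℝ) : ℂ) ^ (s - 1) * (exp (-(((2 * Real.pi * r : ℝ) : ℂ) ^ 2 /
      (4 * Real.pi))) / den (laplacePoint (2 * Real.pi * r))) =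
    (2 * Real.pi : ℂ) ^ (s - 1) * (starRingEnd ℂ) ((r : ℂ) ^ (-(1 - (starRingEnd ℂ) s)) *
      exp (-(Real.pi * r ^ 2)) / den (r * diag)) := by
  have hpi : (Real.pi : ℂ) ≠ 0 := by exact_mod_cast Real.pi_ne_zero
  have h1 : ((2 * Real.pi * r : ℝ) : ℂ) ^ (s - 1) = (2 * Real.pi : ℂ) ^ (s - 1) * (r : ℂ) ^ (s - 1) := by
    rw [Complex.ofReal_mul, Complex.mul_cpow_ofReal_nonneg (by positivity) hr.le]
    push_cast; rfl
  have h2 : -(((2 * Real.pi * r : ℝ) : ℂ) ^ 2 / (4 * Real.pi)) = -(Real.pi * r ^ 2) := by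
    push_cast; field_simp; norm_num; ring
  rw [h1, h2, laplacePoint_two_pi, den_neg, ← conj_den, map_div₀, map_mul, conj_ofReal_cpow hr,
    ← exp_conj, mul_assoc, mul_div_assoc]
  simp

theorem integral_gaussian_part {s : ℂ} (hs : 2 < s.re) :
    IntegrableOn (fun τ : ℝ => (τ : ℂ) ^ (s - 1) *
      (exp (-((τ : ℂ) ^ 2 / (4 * Real.pi))) / den (laplacePoint τ))) (Set.Ioi 0) ∧
    (∫ τ in Set.Ioi (0 : ℝ), (τ : ℂ) ^ (s - 1) *
      (exp (-((τ : ℂ) ^ 2 / (4 * Real.pi))) / den (laplacePoint τ))) =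
      (2 * Real.pi : ℂ) ^ s * (starRingEnd ℂ) (halfLine (1 - (starRingEnd ℂ) s)) := by
  have h2pi : 0 < 2 * Real.pi := by positivity
  have h2pi0 : (2 * Real.pi : ℂ) ≠ 0 := by exact_mod_cast h2pi.ne'
  have hs' : (1 - (starRingEnd ℂ) s).re < -1 := by simp; linarith
  set B : ℝ → ℂ := fun τ => (τ : ℂ) ^ (s - 1) *
      (exp (-((τ : ℂ) ^ 2 / (4 * Real.pi))) / den (laplacePoint τ)) with hB
  have hI : IntegrableOn (fun r => B (2 * Real.pi * r)) (Set.Ioi 0) := by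
    have h := (Complex.conjLIE.toContinuousLinearEquiv.toContinuousLinearMap.integrable_comp
      (integrableOn_halfLine hs')).const_mul ((2 * Real.pi : ℂ) ^ (s - 1))
    exact IntegrableOn.congr_fun h (fun r hr => (gaussian_part_eq hr).symm) measurableSet_Ioi
  constructor
  · have := (integrableOn_Ioi_comp_mul_left_iff B 0 h2pi).1 hI
    rwa [mul_zero] at this
  · have hsub := MeasureTheory.integral_comp_mul_left_Ioi B 0 h2pi
    rw [mul_zero, setIntegral_congr_fun measurableSet_Ioi fun r hr => gaussian_part_eq hr,
      integral_const_mul, integral_conj] at hsub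
    change (2 * Real.pi : ℂ) ^ (s - 1) * (starRingEnd ℂ) (halfLine (1 - (starRingEnd ℂ) s)) = _ at hsub
    rw [Complex.real_smul, cpow_sub _ _ h2pi0, cpow_one] at hsub
    push_cast at hsub
    field_simp at hsub
    rw [hsub]

theorem zeta_sub_lineIntegral {s : ℂ} (hs : 2 < s.re) {c : ℝ} (hc : c ∈ Set.Ioo (0 : ℝ) 1) :
    (lineIntegral c southWest (rsIntegrand s) - riemannZeta s) * Gamma s =
      exp (I * Real.pi * s / 4) * (2 * Real.pi : ℂ) ^ s *
        (starRingEnd ℂ) (halfLine (1 - (starRingEnd ℂ) s)) := by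
  have hs0 : 0 < s.re := by linarith
  have h1 := integral_rsIntegrand_mul_Gamma hs0 hc
  obtain ⟨hBi, hB⟩ := integral_gaussian_part hs
  have hZ := integral_zeta_series (show 1 < s.re by linarith)
  have htot : IntegrableOn (fun τ : ℝ => -diag * ((τ : ℂ) ^ (s - 1) *
      ∫ t : ℝ, mordellIntegrand (laplacePoint τ) (c + t * diag))) (Set.Ioi 0) := by
    have h := (integrable_laplace_mordellIntegrand hs0 hc).integral_prod_right
    simp only [Function.uncurry, integral_const_mul] at h
    exact h.const_mul _
  have hsplit : (∫ τ in Set.Ioi (0 : ℝ), -diag * ((τ : ℂ) ^ (s - 1) *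
      ∫ t : ℝ, mordellIntegrand (laplacePoint τ) (c + t * diag))) -
      (∫ τ in Set.Ioi (0 : ℝ), (τ : ℂ) ^ (s - 1) *
        (exp (-((τ : ℂ) ^ 2 / (4 * Real.pi))) / den (laplacePoint τ))) =
      ∫ τ in Set.Ioi (0 : ℝ), ∑' n : ℕ, (τ : ℂ) ^ (s - 1) * exp (-((n + 1 : ℝ) * diag * τ)) := by
    rw [← integral_sub htot hBi]
    refine setIntegral_congr_fun measurableSet_Ioi fun τ hτ => ?_
    rw [tsum_mul_left, mul_left_comm, neg_diag_mul_mordell hc hτ]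
    ring
  rw [hZ, hB, integral_const_mul] at hsplit
  rw [lineIntegral_southWest]
  have hee : exp (I * Real.pi * s / 4) * exp (-(I * Real.pi * s / 4)) = 1 := by
    rw [← exp_add, add_neg_cancel, exp_zero]
  linear_combination (-diag) * h1 + exp (I * Real.pi * s / 4) * hsplit +
    Gamma s * riemannZeta s * hee

theorem lineIntegral_rsIntegrandDual_eq_halfLine {s : ℂ} (hs : 2 < s.re) {c : ℝ}
    (hc : c ∈ Set.Ioo (0 : ℝ) 1) :
    lineIntegral c southEast (rsIntegrandDual s) = -(exp (I * Real.pi * s / 4) *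
      (2 * cos (Real.pi * s / 2)) * (starRingEnd ℂ) (halfLine (1 - (starRingEnd ℂ) s))) := by
  have hs' : (1 - (starRingEnd ℂ) s).re < -1 := by simp; linarith
  rw [lineIntegral_rsIntegrandDual s hc.1, lineIntegral_southWest,
    integral_rsIntegrand_eq_halfLine hs' hc, map_mul, map_neg, map_mul, ← mul_assoc, ← neg_mul]
  congr 1
  rw [map_sub, ← exp_conj, ← exp_conj, show (starRingEnd ℂ) diag = exp (-(I * Real.pi / 4)) from
    conj_diag, neg_mul, neg_inj, mul_sub, ← exp_add, ← exp_add, Complex.two_cos, mul_add,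
    ← exp_add, ← exp_add]
  simp only [map_div₀, map_neg, map_mul, map_sub, map_one, conj_I, conj_ofReal, conj_conj,
    map_ofNat]
  have e2 : exp (-(I * Real.pi / 4) + 3 * -I * Real.pi * (1 - s) / 4) =
      -exp (I * Real.pi * s / 4 + Real.pi * s / 2 * I) := by
    rw [show -(I * Real.pi / 4) + 3 * -I * Real.pi * (1 - s) / 4 = I * Real.pi * s / 4 +
      Real.pi * s / 2 * I + -(I * Real.pi) by ring, exp_add _ (-(I * Real.pi)),
      Complex.exp_neg (I * Real.pi), exp_I_mul_pi]
    norm_num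
  rw [e2, sub_neg_eq_add, add_comm]
  congr 2
  ring

theorem differentiable_lineIntegral_rsIntegrand {c : ℝ} (hc : c ∈ Set.Ioo (0 : ℝ) 1) :
    Differentiable ℂ fun s => lineIntegral c southWest (rsIntegrand s) := by
  simp only [lineIntegral_southWest]
  exact (differentiable_integral_rsIntegrand hc).const_mul _

/-- Conjugating both the argument and the value of an entire function gives an entire function. -/
theorem differentiable_lineIntegral_rsIntegrandDual {c : ℝ} (hc : c ∈ Set.Ioo (0 : ℝ) 1) :
    Differentiable ℂ fun s => lineIntegral c southEast (rsIntegrandDual s) := by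
  simp only [lineIntegral_rsIntegrandDual _ hc.1]
  intro s
  have h : DifferentiableAt ℂ (fun w => lineIntegral c southWest (rsIntegrand (1 - w)))
      ((starRingEnd ℂ) s) :=
    ((differentiable_lineIntegral_rsIntegrand hc).comp
      (differentiable_const (1 : ℂ) |>.sub differentiable_id)).differentiableAt
  have := h.conj_conj
  rwa [conj_conj] at this

/-- Both sides are multiples of the same conjugated `halfLine`; the constants agree because `Gammaℝ
s / Gammaℝ (1 - s)` equals 2(2π)^{-s} Γ(s) cos(πs/2). -/
theorem riemannSiegel_of_two_lt_re {s : ℂ} (hs : 2 < s.re) {c c' : ℝ}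
    (hc : c ∈ Set.Ioo (0 : ℝ) 1) (hc' : c' ∈ Set.Ioo (0 : ℝ) 1) :
    (Gammaℝ (1 - s))⁻¹ * (riemannZeta s - lineIntegral c southWest (rsIntegrand s)) =
      (Gammaℝ s)⁻¹ * lineIntegral c' southEast (rsIntegrandDual s) := by
  have hG := Complex.Gamma_ne_zero_of_re_pos (show 0 < s.re by linarith)
  have hGR := Complex.Gammaℝ_ne_zero_of_re_pos (show 0 < s.re by linarith)
  have h2pi0 : (2 * Real.pi : ℂ) ≠ 0 := by
    have : (2 * Real.pi : ℝ) ≠ 0 := by positivity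
    exact_mod_cast this
  have hdiv := Complex.Gammaℝ_div_Gammaℝ_one_sub (s := s) fun n hn => by
    rw [hn] at hs
    simp at hs
    linarith [n.cast_nonneg (α := ℝ)]
  rw [Gammaℂ_def, div_eq_mul_inv] at hdiv
  have hpp : (2 * Real.pi : ℂ) ^ (-s) * (2 * Real.pi : ℂ) ^ s = 1 := by
    rw [← cpow_add _ _ h2pi0, neg_add_cancel, cpow_zero]
  have hz := zeta_sub_lineIntegral hs hc
  rw [lineIntegral_rsIntegrandDual_eq_halfLine hs hc']
  set L := lineIntegral c southWest (rsIntegrand s)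
  set E := exp (I * Real.pi * s / 4)
  set K := (starRingEnd ℂ) (halfLine (1 - (starRingEnd ℂ) s))
  set g := (Gammaℝ (1 - s))⁻¹
  refine mul_left_cancel₀ hGR (mul_right_cancel₀ hG ?_)
  rw [mul_inv_cancel_left₀ hGR]
  linear_combination (riemannZeta s - L) * Gamma s * hdiv -
    2 * (2 * Real.pi : ℂ) ^ (-s) * Gamma s * cos (Real.pi * s / 2) * hz -
    2 * Gamma s * cos (Real.pi * s / 2) * E * K * hpp

/-- The Riemann–Siegel formula, with the gamma factors inverted so that both sides are entire. -/
theorem riemannSiegel {s : ℂ} (hs : s ≠ 1) {c c' : ℝ}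
    (hc : c ∈ Set.Ioo (0 : ℝ) 1) (hc' : c' ∈ Set.Ioo (0 : ℝ) 1) :
    (Gammaℝ (1 - s))⁻¹ * (riemannZeta s - lineIntegral c southWest (rsIntegrand s)) =
      (Gammaℝ s)⁻¹ * lineIntegral c' southEast (rsIntegrandDual s) := by
  have hUo : IsOpen ({1}ᶜ : Set ℂ) := isOpen_compl_singleton
  have h1 : DifferentiableOn ℂ (fun s => (Gammaℝ (1 - s))⁻¹ *
      (riemannZeta s - lineIntegral c southWest (rsIntegrand s))) {1}ᶜ := by
    refine DifferentiableOn.mul ?_ (differentiableOn_riemannZeta.sub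
      (differentiable_lineIntegral_rsIntegrand hc).differentiableOn)
    exact (differentiable_Gammaℝ_inv.comp
      (differentiable_const (1 : ℂ) |>.sub differentiable_id)).differentiableOn
  have h2 : DifferentiableOn ℂ (fun s => (Gammaℝ s)⁻¹ *
      lineIntegral c' southEast (rsIntegrandDual s)) {1}ᶜ :=
    (differentiable_Gammaℝ_inv.mul
      (differentiable_lineIntegral_rsIntegrandDual hc')).differentiableOn
  -- The punctured plane ℂ ∖ {1} is connected, and the identity is known near 3.
  refine (h1.analyticOnNhd hUo).eqOn_of_preconnected_of_eventuallyEq (h2.analyticOnNhd hUo)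
    (isConnected_compl_singleton_of_one_lt_rank (by simp) 1).isPreconnected (z₀ := 3)
    (by simp) ?_ hs
  filter_upwards [(isOpen_lt continuous_const Complex.continuous_re).mem_nhds
    (show (2 : ℝ) < (3 : ℂ).re by norm_num)] with s' hs'
  exact riemannSiegel_of_two_lt_re hs' hc hc'

theorem rsF_eq (c : ℝ) (s : ℂ) :
    rsF c s = Gammaℝ s * lineIntegral c southWest (rsIntegrand s) := rfl

theorem conj_rsF (s : ℂ) {c c' : ℝ} (hc : c ∈ Set.Ioo (0 : ℝ) 1) (hc' : c' ∈ Set.Ioo (0 : ℝ) 1) :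
    (starRingEnd ℂ) (rsF c (1 - (starRingEnd ℂ) s)) =
      (Real.pi : ℂ) ^ (-(1 - s) / 2) * Gamma ((1 - s) / 2) *
        lineIntegral c' southEast (rsIntegrandDual s) := by
  rw [lineIntegral_rsIntegrandDual s hc'.1, rsF, map_mul, map_mul, conj_pi_cpow,
    ← Complex.Gamma_conj, lineIntegral_southWest, lineIntegral_southWest,
    integral_rsIntegrand_indep _ hc hc']
  congr 3
  simp [map_div₀, map_ofNat]

end ParabolicRS

/-! ### Assembly: restoring the gamma factors. -/

theorem mainTheorem1 (s : ℂ) (c c' b b' : ℝ)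
    (hc : c ∈ Set.Ioo (0 : ℝ) 1) (hc' : c' ∈ Set.Ioo (0 : ℝ) 1)
    (hb : b ∈ Set.Ioo (-(1 / 2) : ℝ) (1 / 2)) (hb' : b' ∈ Set.Ioo (-(1 / 2) : ℝ) (1 / 2)) :
    -- all four integrals converge absolutely, for every `s`
    (ParabolicRS.LineIntegrable c ParabolicRS.southWest (ParabolicRS.rsIntegrand s) ∧
      ParabolicRS.LineIntegrable c' ParabolicRS.southEast (ParabolicRS.rsIntegrandDual s) ∧
      ParabolicRS.LineIntegrable b ParabolicRS.southEast (ParabolicRS.cylinderIntegrand s) ∧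
      ParabolicRS.LineIntegrable b' ParabolicRS.southWest
        (ParabolicRS.cylinderIntegrandDual s)) ∧
    -- the two identities with the gamma factors cancelled, for every `s`
    ((Real.pi : ℂ) ^ (-s / 2) *
        ParabolicRS.lineIntegral c ParabolicRS.southWest (ParabolicRS.rsIntegrand s) =
      (2 : ℂ) ^ (s / 2) * Complex.exp (-(Complex.I * Real.pi * (1 - s) / 4)) *
        ParabolicRS.lineIntegral b ParabolicRS.southEast (ParabolicRS.cylinderIntegrand s)) ∧
    ((Real.pi : ℂ) ^ (-(1 - s) / 2) *
        ParabolicRS.lineIntegral c' ParabolicRS.southEast (ParabolicRS.rsIntegrandDual s) =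
      (2 : ℂ) ^ ((1 - s) / 2) * Complex.exp (Complex.I * Real.pi * s / 4) *
        ParabolicRS.lineIntegral b' ParabolicRS.southWest
          (ParabolicRS.cylinderIntegrandDual s)) ∧
    -- the representation of `𝓕(s)`, off the poles of `Γ(s/2)`
    ((∀ n : ℕ, s ≠ -(2 * n)) →
      ParabolicRS.rsF c s =
        (2 : ℂ) ^ (s / 2) * Complex.Gamma (s / 2) *
          Complex.exp (-(Complex.I * Real.pi * (1 - s) / 4)) *
          ParabolicRS.lineIntegral b ParabolicRS.southEast (ParabolicRS.cylinderIntegrand s)) ∧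
    -- the representation of the conjugate of `𝓕(1 - s̄)`, off the poles of `Γ((1-s)/2)`
    ((∀ n : ℕ, 1 - s ≠ -(2 * n)) →
      (starRingEnd ℂ) (ParabolicRS.rsF c (1 - (starRingEnd ℂ) s)) =
          (Real.pi : ℂ) ^ (-(1 - s) / 2) * Complex.Gamma ((1 - s) / 2) *
            ParabolicRS.lineIntegral c' ParabolicRS.southEast (ParabolicRS.rsIntegrandDual s) ∧
        (starRingEnd ℂ) (ParabolicRS.rsF c (1 - (starRingEnd ℂ) s)) =
          (2 : ℂ) ^ ((1 - s) / 2) * Complex.Gamma ((1 - s) / 2) *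
            Complex.exp (Complex.I * Real.pi * s / 4) *
            ParabolicRS.lineIntegral b' ParabolicRS.southWest
              (ParabolicRS.cylinderIntegrandDual s)) ∧
    -- the resulting form of the Riemann–Siegel formula, off the poles of both gamma factors
    ((∀ n : ℕ, s ≠ -(2 * n)) → (∀ n : ℕ, 1 - s ≠ -(2 * n)) →
      (Real.pi : ℂ) ^ (-s / 2) * Complex.Gamma (s / 2) * riemannZeta s =
          ParabolicRS.rsF c s +
            (starRingEnd ℂ) (ParabolicRS.rsF c' (1 - (starRingEnd ℂ) s)) ∧
      (Real.pi : ℂ) ^ (-s / 2) * Complex.Gamma (s / 2) * riemannZeta s =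
        (2 : ℂ) ^ (s / 2) * Complex.Gamma (s / 2) *
            Complex.exp (-(Complex.I * Real.pi * (1 - s) / 4)) *
            ParabolicRS.lineIntegral b ParabolicRS.southEast (ParabolicRS.cylinderIntegrand s) +
          (2 : ℂ) ^ ((1 - s) / 2) * Complex.Gamma ((1 - s) / 2) *
            Complex.exp (Complex.I * Real.pi * s / 4) *
            ParabolicRS.lineIntegral b' ParabolicRS.southWest
              (ParabolicRS.cylinderIntegrandDual s)) := by
  open ParabolicRS in
  have hF : rsF c s = (2 : ℂ) ^ (s / 2) * Complex.Gamma (s / 2) *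
      Complex.exp (-(Complex.I * Real.pi * (1 - s) / 4)) *
      lineIntegral b southEast (cylinderIntegrand s) := by
    rw [rsF, mul_right_comm, rs_eq_cylinder s hb hc]; ring
  open ParabolicRS in
  have hFd : ∀ d : ℝ, d ∈ Set.Ioo (0 : ℝ) 1 →
      (starRingEnd ℂ) (rsF d (1 - (starRingEnd ℂ) s)) = (2 : ℂ) ^ ((1 - s) / 2) *
        Complex.Gamma ((1 - s) / 2) * Complex.exp (Complex.I * Real.pi * s / 4) *
        lineIntegral b' southWest (cylinderIntegrandDual s) := fun d hd => by
    rw [conj_rsF s hd hc', mul_right_comm, rs_eq_cylinder_dual s hb' hc']; ring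
  open ParabolicRS in
  have hzeta : (∀ n : ℕ, s ≠ -(2 * n)) → (∀ n : ℕ, 1 - s ≠ -(2 * n)) →
      (Real.pi : ℂ) ^ (-s / 2) * Complex.Gamma (s / 2) * riemannZeta s =
        rsF c s + (starRingEnd ℂ) (rsF c' (1 - (starRingEnd ℂ) s)) := fun h h' => by
    -- The pole of ζ at 1 is also the pole n = 0 of Γ((1 - s)/2), hence excluded.
    have hs1 : s ≠ 1 := fun h1 => h' 0 (by simp [h1])
    -- `Gammaℝ` takes the default value 0 exactly at its poles; excluding them makes the factors
    -- invertible in `riemannSiegel`.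
    have hG : Gammaℝ s ≠ 0 := fun h0 => by
      obtain ⟨n, hn⟩ := Gammaℝ_eq_zero_iff.1 h0
      exact h n hn
    have hG' : Gammaℝ (1 - s) ≠ 0 := fun h0 => by
      obtain ⟨n, hn⟩ := Gammaℝ_eq_zero_iff.1 h0
      exact h' n hn
    have hRS := riemannSiegel hs1 hc hc'
    rw [conj_rsF s hc' hc', rsF_eq, ← Gammaℝ_def, ← Gammaℝ_def]
    field_simp at hRS
    linear_combination hRS
  refine ⟨⟨ParabolicRS.lineIntegrable_southWest (ParabolicRS.integrable_rsIntegrand hc s),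
    ParabolicRS.lineIntegrable_southEast (ParabolicRS.integrable_rsIntegrandDual s hc'),
    ParabolicRS.lineIntegrable_southEast (ParabolicRS.integrable_cylinderIntegrand s hb),
    ParabolicRS.lineIntegrable_southWest (ParabolicRS.integrable_cylinderIntegrandDual s hb')⟩,
    ParabolicRS.rs_eq_cylinder s hb hc, ParabolicRS.rs_eq_cylinder_dual s hb' hc',
    fun _ => hF, fun _ => ⟨ParabolicRS.conj_rsF s hc hc', hFd c hc⟩,
    fun h h' => ⟨hzeta h h', ?_⟩⟩
  rw [hzeta h h', hF, hFd c' hc']
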